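/- Let $M$ be a smooth manifold of dimension $n\ge 3$, let $\alpha=\sqrt{a_{ij}(x)y^iy^j}$ be a smooth Riemannian metric and $\beta=b_i(x)y^i$ a smooth $1$-form on $M$ with $\|\beta\|_\alpha=1$ (that is, $a^{ij}b_ib_j=1$, where $(a^{ij})=(a_{ij})^{-1}$), and let $F=\alpha^2/\beta$ be the associated Kropina metric, considered on the tangent vectors $y$ with $\beta(y)>0$. \emph{Curvature.} For a metric $F$ put $g_{ij}=\frac12[F^2]_{y^iy^j}$, $y_k=g_{ik}y^i$ and $G^i=\frac14 g^{il}\{[F^2]_{x^ky^l}y^k-[F^2]_{x^l}\}$. Its Riemann curvature is $$R^i_{\ k}=2\frac{\partial G^i}{\partial x^k}-y^j\frac{\partial^2G^i}{\partial x^j\partial y^k}+2G^j\frac{\partial^2G^i}{\partial y^j\partial y^k}-\frac{\partial G^i}{\partial y^j}\frac{\partial G^j}{\partial y^k}.$$ $F$ is of scalar flag curvature if there is a function $\mathbf K=\mathbf K(x,y)$ with $R^i_{\ k}=\mathbf K\,(F^2\delta^i_k-y^iy_k)$. Denote by $\bar R^i_{\ k}$ the Riemann curvature of $\alpha$. \emph{Notation.}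 A bar $|$ denotes the covariant derivative with respect to the Levi-Civita connection of $\alpha$, indices are raised and lowered with $a_{ij}$, an index $0$ denotes contraction with $y$, and $$r_{ij}=\tfrac12(b_{i|j}+b_{j|i}),\quad s_{ij}=\tfrac12(b_{i|j}-b_{j|i}),\quad q_{ij}=r_{ik}s^k_{\ j},\quad t_{ij}=s_{ik}s^k_{\ j},\quad s_j=b^is_{ij},\quad t_j=b^it_{ij}.$$ The symbol $(i/j)$ denotes the terms obtained from all the preceding terms (of the bracket or of the right-hand side in which it stands) by interchanging $i$ and $j$. In the four equations and in the definitions of $\sigma_i$ and $B_{ik}$ below, $y_k=a_{kl}y^l$. Then $F$ is of scalar flag curvature if and only if there is a scalar function $\lambda=\lambda(x)$ on $M$ such that $$t_{ij}=b_it_j+b_jt_i-s_is_j+\frac1{n-1}\Big\{(t^l_{\ l}+2s^ls_l)a_{ij}-\big[t^l_{\ l}-(n-3)s^ls_l\big]b_ib_j\Big\},$$ $$s_{ij|k}=\Big\{t_j-\frac{t^l_{\ l}-(n-3)s^ls_l}{n-1}b_j\Big\}a_{ik}+r_{ik}s_j+q_{ki}b_j+s_{j|k}b_i-(i/j),$$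 $$q_{ik}=\tfrac12b^pb^l\big[(r_{lp|i}-r_{li|p})b_k-(i/k)\big]-\tfrac12b^l(r_{lk|i}+r_{li|k})-r_{il}r^l_{\ k}-s_{i|k},$$ $$\bar R^i_{\ k}=\frac{(n-3)s^ls_l-t^l_{\ l}}{n-1}\big(\alpha^2\delta^i_k-y^iy_k\big)-B_{00}\delta^i_k-B^i_{\ k}\alpha^2+B_{0k}y^i+B^i_{\ 0}y_k+r^i_{\ 0}r_{k0}-r_{00}r^i_{\ k},$$ where $$\sigma_i=2\big[(n-3)s^ls_l-(n-1)\lambda-t^l_{\ l}\big]b_i+2(n-1)b^pb^l(r_{lp|i}-r_{li|p}),$$ $$B_{ik}=\tfrac12(r_{il}r^l_{\ k}+b^lr_{lk|i})+\frac{b_k\sigma_i}{4(n-1)}+s_{i|k}+(i/k).$$ In this case, with $s=\beta/\alpha$, the scalar flag curvature of $F$ is given by $$\mathbf K=\lambda s^2+\frac{s^2}{\alpha^2}\Big\{\frac{3s^2}{\alpha^2}r_{00}^2+\frac s\alpha(r_{00|0}+6r_{00}s_0)+3q_{00}+3s_0^2-b^l(r_{l0|0}-r_{00|l})\Big\}+\frac1{4(n-1)}\big[(4s^2-1)t^l_{\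 l}-2(1+2ns^2-6s^2)s^ls_l\big].$$ -/

import Mathlib

open scoped Manifold ContDiff Bundle

noncomputable section

namespace Kropina

/-- The coordinate space `ℝⁿ`. -/
abbrev Coord (n : ℕ) := EuclideanSpace ℝ (Fin n)

/-! ### Local Finsler geometry in coordinates

A metric is given in coordinates by a function `F x y` of the position `x` and the direction `y`. -/

section LocalFinsler

variable {n : ℕ}

/-- The partial derivative `∂f/∂xⁱ` at `x`. -/
def pd (f : Coord n → ℝ) (i : Fin n) (x : Coord n) : ℝ :=
  fderiv ℝ f x (EuclideanSpace.single i 1)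

/-- The fundamental tensor `g_{ij} = ½ [F²]_{yⁱyʲ}`. -/
def fundTensor (F : Coord n → Coord n → ℝ) (x y : Coord n) : Matrix (Fin n) (Fin n) ℝ :=
  Matrix.of fun i j => (1 / 2) * pd (fun w => pd (fun w' => F x w' ^ 2) i w) j y

/-- The lowered direction `y_k = g_{ik} yⁱ`. -/
def lowerDir (F : Coord n → Coord n → ℝ) (k : Fin n) (x y : Coord n) : ℝ :=
  ∑ i, fundTensor F x y i k * y i

/-- The spray coefficients `Gⁱ = ¼ g^{il} ([F²]_{xᵏyˡ} yᵏ - [F²]_{xˡ})`. -/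
def spray (F : Coord n → Coord n → ℝ) (i : Fin n) (x y : Coord n) : ℝ :=
  (1 / 4) * ∑ l, (fundTensor F x y)⁻¹ i l *
    ((∑ k, pd (fun w => pd (fun z => F z w ^ 2) k x) l y * y k) - pd (fun z => F z y ^ 2) l x)

/-- The Riemann curvature
`Rⁱ_k = 2 ∂Gⁱ/∂xᵏ - yʲ ∂²Gⁱ/∂xʲ∂yᵏ + 2 Gʲ ∂²Gⁱ/∂yʲ∂yᵏ - ∂Gⁱ/∂yʲ ∂Gʲ/∂yᵏ`. -/
def riemann (F : Coord n → Coord n → ℝ) (i k : Fin n) (x y : Coord n) : ℝ :=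
  2 * pd (fun z => spray F i z y) k x
    - ∑ j, y j * pd (fun w => pd (fun z => spray F i z w) j x) k y
    + 2 * ∑ j, spray F j x y * pd (fun w => pd (fun w' => spray F i x w') j w) k y
    - ∑ j, pd (fun w => spray F i x w) j y * pd (fun w => spray F j x w) k y

end LocalFinsler

/-! ### Tensors of a Riemannian metric `a_{ij}` and a one-form `b_i` in coordinates

The bar in the names of the mathematical notation, `T_{i|k}`, is the covariant derivative with
respect to the Levi-Civita connection of `a`. An index is raised with `a^{ij}`. -/

section LocalTensors

variable {n : ℕ}

/-- The Christoffel symbols `Γˡ_{ij}` of `a`. -/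
def christoffel (a : Coord n → Matrix (Fin n) (Fin n) ℝ) (l i j : Fin n) (x : Coord n) : ℝ :=
  (1 / 2) * ∑ m, (a x)⁻¹ l m *
    (pd (fun z => a z m j) i x + pd (fun z => a z m i) j x - pd (fun z => a z i j) m x)

/-- The covariant derivative `T_{i|k}` of a covector field. -/
def cov1 (a : Coord n → Matrix (Fin n) (Fin n) ℝ) (T : Fin n → Coord n → ℝ)
    (i k : Fin n) (x : Coord n) : ℝ :=
  pd (T i) k x - ∑ l, christoffel a l i k x * T l x

/-- The covariant derivative `T_{ij|k}` of a covariant 2-tensor field. -/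
def cov2 (a : Coord n → Matrix (Fin n) (Fin n) ℝ) (T : Fin n → Fin n → Coord n → ℝ)
    (i j k : Fin n) (x : Coord n) : ℝ :=
  pd (T i j) k x - ∑ l, christoffel a l i k x * T l j x - ∑ l, christoffel a l j k x * T i l x

variable (a : Coord n → Matrix (Fin n) (Fin n) ℝ) (b : Fin n → Coord n → ℝ)

/-- `bⁱ = a^{ij} b_j`. -/
def bUp (i : Fin n) (x : Coord n) : ℝ := ∑ j, (a x)⁻¹ i j * b j x

/-- `r_{ij} = ½ (b_{i|j} + b_{j|i})`. -/
def r (i j : Fin n) (x : Coord n) : ℝ := (1 / 2) * (cov1 a b i j x + cov1 a b j i x)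

/-- `s_{ij} = ½ (b_{i|j} - b_{j|i})`. -/
def s (i j : Fin n) (x : Coord n) : ℝ := (1 / 2) * (cov1 a b i j x - cov1 a b j i x)

/-- `rⁱ_j = a^{ik} r_{kj}`. -/
def rUp (i j : Fin n) (x : Coord n) : ℝ := ∑ k, (a x)⁻¹ i k * r a b k j x

/-- `sⁱ_j = a^{ik} s_{kj}`. -/
def sUp (i j : Fin n) (x : Coord n) : ℝ := ∑ k, (a x)⁻¹ i k * s a b k j x

/-- `q_{ij} = r_{ik} sᵏ_j`. -/
def q (i j : Fin n) (x : Coord n) : ℝ := ∑ k, r a b i k x * sUp a b k j x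

/-- `t_{ij} = s_{ik} sᵏ_j`. -/
def t (i j : Fin n) (x : Coord n) : ℝ := ∑ k, s a b i k x * sUp a b k j x

/-- `s_j = bⁱ s_{ij}`. -/
def sVec (j : Fin n) (x : Coord n) : ℝ := ∑ i, bUp a b i x * s a b i j x

/-- `t_j = bⁱ t_{ij}`. -/
def tVec (j : Fin n) (x : Coord n) : ℝ := ∑ i, bUp a b i x * t a b i j x

/-- The trace `tˡ_l = a^{lm} t_{ml}`. -/
def tTrace (x : Coord n) : ℝ := ∑ l, ∑ m, (a x)⁻¹ l m * t a b m l x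

/-- `sˡ s_l = a^{lm} s_m s_l`. -/
def sNormSq (x : Coord n) : ℝ := ∑ l, ∑ m, (a x)⁻¹ l m * sVec a b m x * sVec a b l x

/-- `r_{ij|k}`. -/
def rCov (i j k : Fin n) (x : Coord n) : ℝ := cov2 a (r a b) i j k x

/-- `s_{ij|k}`. -/
def sCov (i j k : Fin n) (x : Coord n) : ℝ := cov2 a (s a b) i j k x

/-- `s_{i|k}`, the covariant derivative of the covector `s_i`. -/
def sVecCov (i k : Fin n) (x : Coord n) : ℝ := cov1 a (sVec a b) i k x

/-- `r_{il} rˡ_k`. -/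
def rSq (i k : Fin n) (x : Coord n) : ℝ := ∑ l, r a b i l x * rUp a b l k x

/-- `bˡ r_{lk|i}`. -/
def bR (k i : Fin n) (x : Coord n) : ℝ := ∑ l, bUp a b l x * rCov a b l k i x

/-- `bᵖ bˡ (r_{lp|i} - r_{li|p})`. -/
def bbR (i : Fin n) (x : Coord n) : ℝ :=
  ∑ p, ∑ l, bUp a b p x * bUp a b l x * (rCov a b l p i x - rCov a b l i p x)

/-- `σ_i = 2 [(n-3) sˡs_l - (n-1) λ - tˡ_l] b_i + 2 (n-1) bᵖ bˡ (r_{lp|i} - r_{li|p})`. -/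
def sigma (lam : ℝ) (i : Fin n) (x : Coord n) : ℝ :=
  2 * (((n : ℝ) - 3) * sNormSq a b x - ((n : ℝ) - 1) * lam - tTrace a b x) * b i x
    + 2 * ((n : ℝ) - 1) * bbR a b i x

/-- The terms `½ (r_{il} rˡ_k + bˡ r_{lk|i}) + b_k σ_i / (4(n-1)) + s_{i|k}`. -/
def bTensorTerm (lam : ℝ) (i k : Fin n) (x : Coord n) : ℝ :=
  (1 / 2) * (rSq a b i k x + bR a b k i x)
    + b k x * sigma a b lam i x / (4 * ((n : ℝ) - 1)) + sVecCov a b i k x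

/-- `B_{ik}`, the sum of the terms above and of the same terms with `i` and `k` interchanged. -/
def bTensor (lam : ℝ) (i k : Fin n) (x : Coord n) : ℝ :=
  bTensorTerm a b lam i k x + bTensorTerm a b lam k i x

/-- `Bⁱ_k = a^{il} B_{lk}`. -/
def bTensorUp (lam : ℝ) (i k : Fin n) (x : Coord n) : ℝ :=
  ∑ l, (a x)⁻¹ i l * bTensor a b lam l k x

/-- The equation for `t_{ij}` at the point `x`:
`t_{ij} = b_i t_j + b_j t_i - s_i s_j
  + 1/(n-1) {(tˡ_l + 2 sˡs_l) a_{ij} - [tˡ_l - (n-3) sˡs_l] b_i b_j}`. -/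
def TEquation (x : Coord n) : Prop :=
  ∀ i j : Fin n,
    t a b i j x = b i x * tVec a b j x + b j x * tVec a b i x - sVec a b i x * sVec a b j x
      + 1 / ((n : ℝ) - 1) * ((tTrace a b x + 2 * sNormSq a b x) * a x i j
        - (tTrace a b x - ((n : ℝ) - 3) * sNormSq a b x) * b i x * b j x)

/-- The terms
`{t_j - (tˡ_l - (n-3) sˡs_l)/(n-1) b_j} a_{ik} + r_{ik} s_j + q_{ki} b_j + s_{j|k} b_i`. -/
def sCovTerm (i j k : Fin n) (x : Coord n) : ℝ :=
  (tVec a b j x - (tTrace a b x - ((n : ℝ) - 3) * sNormSq a b x) / ((n : ℝ) - 1) * b j x) * a x i k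
    + r a b i k x * sVec a b j x + q a b k i x * b j x + sVecCov a b j k x * b i x

/-- The equation for `s_{ij|k}` at the point `x`: it is the difference of the terms above and of the
same terms with `i` and `j` interchanged. -/
def SEquation (x : Coord n) : Prop :=
  ∀ i j k : Fin n, sCov a b i j k x = sCovTerm a b i j k x - sCovTerm a b j i k x

/-- The equation for `q_{ik}` at the point `x`:
`q_{ik} = ½ bᵖbˡ [(r_{lp|i} - r_{li|p}) b_k - (r_{lp|k} - r_{lk|p}) b_i]
  - ½ bˡ (r_{lk|i} + r_{li|k}) - r_{il} rˡ_k - s_{i|k}`. -/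
def QEquation (x : Coord n) : Prop :=
  ∀ i k : Fin n,
    q a b i k x = (1 / 2) * (bbR a b i x * b k x - bbR a b k x * b i x)
      - (1 / 2) * (bR a b k i x + bR a b i k x) - rSq a b i k x - sVecCov a b i k x

/-- `α² = a_{ij} yⁱ yʲ`. -/
def alphaSq (x y : Coord n) : ℝ := ∑ i, ∑ j, a x i j * y i * y j

/-- `y_k = a_{kl} yˡ`. -/
def yLow (k : Fin n) (x y : Coord n) : ℝ := ∑ l, a x k l * y l

/-- `r_{00} = r_{ij} yⁱ yʲ`. -/
def r00 (x y : Coord n) : ℝ := ∑ i, ∑ j, r a b i j x * y i * y j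

/-- The equation at the point `x` for the Riemann curvature `R̄ⁱ_k` of `α`, as an identity in `y`:
`R̄ⁱ_k = ((n-3) sˡs_l - tˡ_l)/(n-1) (α² δⁱ_k - yⁱ y_k) - B_{00} δⁱ_k - Bⁱ_k α² + B_{0k} yⁱ + Bⁱ_0 y_k
  + rⁱ_0 r_{k0} - r_{00} rⁱ_k`, where an index `0` is the contraction with `y`. -/
def CurvatureEquation (Rbar : Fin n → Fin n → Coord n → ℝ) (lam : ℝ) (x : Coord n) : Prop :=
  ∀ (y : Coord n) (i k : Fin n),
    Rbar i k y =
      (((n : ℝ) - 3) * sNormSq a b x - tTrace a b x) / ((n : ℝ) - 1)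
          * (alphaSq a x y * (1 : Matrix (Fin n) (Fin n) ℝ) i k - y i * yLow a k x y)
        - (∑ j, ∑ l, bTensor a b lam j l x * y j * y l) * (1 : Matrix (Fin n) (Fin n) ℝ) i k
        - bTensorUp a b lam i k x * alphaSq a x y
        + (∑ j, bTensor a b lam j k x * y j) * y i
        + (∑ j, bTensorUp a b lam i j x * y j) * yLow a k x y
        + (∑ j, rUp a b i j x * y j) * (∑ j, r a b k j x * y j)
        - r00 a b x y * rUp a b i k x

/-- The expression, with `α = √(a_{ij}yⁱyʲ)`, `β = b_i yⁱ` and `s = β/α`,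
`λ s² + s²/α² {3 s²/α² r_{00}² + s/α (r_{00|0} + 6 r_{00} s_0) + 3 q_{00} + 3 s_0²
    - bˡ (r_{l0|0} - r_{00|l})}
  + 1/(4(n-1)) [(4s² - 1) tˡ_l - 2 (1 + 2 n s² - 6 s²) sˡs_l]`. -/
def flagFormula (lam : ℝ) (x y : Coord n) : ℝ :=
  let α : ℝ := √(alphaSq a x y)
  let S : ℝ := (∑ i, b i x * y i) / α
  let s0 : ℝ := ∑ i, sVec a b i x * y i
  let q00 : ℝ := ∑ i, ∑ j, q a b i j x * y i * y j
  let r000 : ℝ := ∑ i, ∑ j, ∑ k, rCov a b i j k x * y i * y j * y k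
  let bdr : ℝ := ∑ l, bUp a b l x * ∑ i, ∑ j, (rCov a b l i j x - rCov a b i j l x) * y i * y j
  lam * S ^ 2
    + S ^ 2 / α ^ 2 * (3 * S ^ 2 / α ^ 2 * r00 a b x y ^ 2
        + S / α * (r000 + 6 * r00 a b x y * s0) + 3 * q00 + 3 * s0 ^ 2 - bdr)
    + 1 / (4 * ((n : ℝ) - 1)) * ((4 * S ^ 2 - 1) * tTrace a b x
        - 2 * (1 + 2 * n * S ^ 2 - 6 * S ^ 2) * sNormSq a b x)

end LocalTensors

/-! ### Metrics on a manifold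

All the notions above are tensorial. They are evaluated at a point `p` of a manifold in the local
coordinates given by the preferred chart at `p`. -/

section OnManifold

variable {n : ℕ} {M : Type*} [TopologicalSpace M] [ChartedSpace (Coord n) M]

/-- The coordinates of the point `p` in the chart at `p`. -/
def chartPt (p : M) : Coord n := extChartAt (𝓡 n) p p

/-- The components `yⁱ` of a tangent vector at `p` in the chart at `p`. -/
def components (p : M) (y : TangentSpace (𝓡 n) p) : Coord n :=
  mfderiv (𝓡 n) 𝓘(ℝ, Coord n) (extChartAt (𝓡 n) p) p y

/-- The tangent vector `yⁱ ∂/∂xⁱ` at the point with coordinates `u` in the chart at `p`. -/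
def coordVec (p : M) (u y : Coord n) : TangentSpace (𝓡 n) ((extChartAt (𝓡 n) p).symm u) :=
  mfderiv 𝓘(ℝ, Coord n) (𝓡 n) (extChartAt (𝓡 n) p).symm u y

/-- The coordinate expression `F(x, y)` in the chart at `p` of a function `F` on the tangent
bundle. -/
def localExpr (F : ∀ p : M, TangentSpace (𝓡 n) p → ℝ) (p : M) (u y : Coord n) : ℝ :=
  F ((extChartAt (𝓡 n) p).symm u) (coordVec p u y)

/-- The metric `F`, considered for the directions in `C`, is of scalar flag curvature `K`:
`Rⁱ_k = K (F² δⁱ_k - yⁱ y_k)`, where `y_k = ½ [F²]_{yⁱyᵏ} yⁱ`. -/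
def HasScalarFlagCurvature (F : ∀ p : M, TangentSpace (𝓡 n) p → ℝ)
    (C : ∀ p : M, Set (TangentSpace (𝓡 n) p)) (K : ∀ p : M, TangentSpace (𝓡 n) p → ℝ) : Prop :=
  ∀ (p : M), ∀ y ∈ C p, ∀ i k : Fin n,
    riemann (localExpr F p) i k (chartPt p) (components p y)
      = K p y * (F p y ^ 2 * (1 : Matrix (Fin n) (Fin n) ℝ) i k
          - components p y i * lowerDir (localExpr F p) k (chartPt p) (components p y))

variable [IsManifold (𝓡 n) ∞ M]

/-- Smooth Riemannian metrics on `M`. -/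
abbrev RiemMetric (n : ℕ) (M : Type*) [TopologicalSpace M] [ChartedSpace (Coord n) M]
    [IsManifold (𝓡 n) ∞ M] :=
  Bundle.ContMDiffRiemannianMetric (𝓡 n) ∞ (Coord n) (fun p : M => TangentSpace (𝓡 n) p)

/-- Smooth one-forms on `M`. -/
abbrev OneForm (n : ℕ) (M : Type*) [TopologicalSpace M] [ChartedSpace (Coord n) M]
    [IsManifold (𝓡 n) ∞ M] :=
  ContMDiffSection (𝓡 n) (Coord n →L[ℝ] ℝ) ∞ (fun p : M => TangentSpace (𝓡 n) p →L[ℝ] ℝ)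

/-- `α = √(a_{ij} yⁱ yʲ)` as a function on the tangent bundle. -/
def alpha (g : RiemMetric n M) (p : M) (y : TangentSpace (𝓡 n) p) : ℝ := √(g.inner p y y)

/-- The Kropina metric `F = α²/β`. -/
def kropinaMetric (g : RiemMetric n M) (β : OneForm n M) (p : M) (y : TangentSpace (𝓡 n) p) : ℝ :=
  alpha g p y ^ 2 / β p y

/-- The conic domain `β > 0` on which the Kropina metric is defined and positive. -/
def kropinaCone (β : OneForm n M) (p : M) : Set (TangentSpace (𝓡 n) p) := {y | 0 < β p y}

/-- `‖β‖_α = 1`: at every point the vector dual to `β` with respect to the metric has length one. -/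
def HasUnitLength (g : RiemMetric n M) (β : OneForm n M) : Prop :=
  ∀ p : M, ∃ v : TangentSpace (𝓡 n) p,
    (∀ w : TangentSpace (𝓡 n) p, g.inner p v w = β p w) ∧ g.inner p v v = 1

/-- The components `a_{ij}` in the chart at `p`. -/
def metricCoord (g : RiemMetric n M) (p : M) (u : Coord n) : Matrix (Fin n) (Fin n) ℝ :=
  Matrix.of fun i j => g.inner ((extChartAt (𝓡 n) p).symm u)
    (coordVec p u (EuclideanSpace.single i 1)) (coordVec p u (EuclideanSpace.single j 1))

/-- The components `b_i` in the chart at `p`. -/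
def formCoord (β : OneForm n M) (p : M) (i : Fin n) (u : Coord n) : ℝ :=
  β ((extChartAt (𝓡 n) p).symm u) (coordVec p u (EuclideanSpace.single i 1))

/-- The four tensor equations for `(α, β)` at the point `p`, with the value `lam` of the scalar
function `λ` at `p`. The curvature `R̄ⁱ_k` in the last one is the Riemann curvature of `α`. -/
def KropinaEquations (g : RiemMetric n M) (β : OneForm n M) (p : M) (lam : ℝ) : Prop :=
  TEquation (metricCoord g p) (formCoord β p) (chartPt p) ∧
  SEquation (metricCoord g p) (formCoord β p) (chartPt p) ∧
  QEquation (metricCoord g p) (formCoord β p) (chartPt p) ∧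
  CurvatureEquation (metricCoord g p) (formCoord β p)
    (fun i k y => riemann (localExpr (alpha g) p) i k (chartPt p) y) lam (chartPt p)

end OnManifold

end Kropina

end

noncomputable section

namespace Kropina

/-! Put φ = α²/(2β), so that F = 2φ. Once the spray of F is known, the theorem is linear algebra at
a point.

The spray is G = ½Γ(y,y) + φ Uy + ½ r_00 b + P y with Uy = s_0 b − Sy and P = −(s_0 + r_00/(2φ)). It
is not found by inverting the fundamental tensor. One checks that φ is constant along the horizontal
directions of G (`horConst_kphi`); for a 2-homogeneous G this gives the Euler–Lagrange equation of
F² = 4φ² (`HorConst.fderiv_vertical_sprayVec`), and G is then the spray because the fundamental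
tensor is positive definite (`fund_pos`, `spray_eq`). Homogeneity also gives R y = 0
(`curvVec_self`), and horizontal constancy gives dφ(R w) = 0 for vertical arguments
(`HorConst.fderiv_curvVec`). The endomorphism F²δ − y ⊗ (y_k) has both properties as well, so to
compare R with a multiple of it one only needs g(κ, R w) for κ orthogonal to y and w orthogonal to
b.

Write y = βb + z and κ = v − (g(v,z)/β) b with v, w, z orthogonal to b. The central identity
`curv_eq` says that g(κ, R w) equals K F² g(v,w), with K the expression of the theorem, plus a
linear expression in three deviations: from the equation for t_{ij} (`tDef`), from the equation for
s_{ij|k} (`sDef`), and from the equation for the curvature of α (`curvDef`). Its coefficients are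
rational in β, and it holds for all values of the constants c and μ = λ + c. If the equations hold,
the deviations vanish and F has scalar flag curvature K.

Conversely, scalar flag curvature makes g(κ, R w) vanish whenever v and w are orthogonal. Multiplied
by β² this is a quartic polynomial in β, so five coefficients vanish (`WeylVanishes.coeffs`). The
lowest one shows that the deviation of t is a multiple of the metric (`exists_eq_mul_g`); this
multiple is absorbed into c, and the trace identifies c (`cst_eq_of_TEq`). The next two remove the
deviation of s by polarisation (`WeylVanishes.sDef_eq_zero`). The deviation of the curvature is an
algebraic curvature tensor; the top coefficient shows that its value on (v, b, w, b) is a multiple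
of g(v,w), and this multiple is μ, which is how λ arises. The remaining coefficients make the tensor
vanish (`curvDef_eq_zero`). The equation for q_{ik} follows from the vanishing of `sDef` together
with the closedness of s (`QEq_of_sDef`).

The unit length of b enters through R b = S b and its derivative `r2_b`, which replace contractions
of b with r by contractions with s. The flag curvature is unique because F²δ − y ⊗ (y_k) has trace
(n−1)F². -/

/-- The tensors at a point of a Riemannian metric `g` and a unit one-form: the vector `b` dual to
the form, the endomorphisms `S = sⁱ_j` and `R = rⁱ_j`, the covariant derivatives `s2 = s_{ij|k}` and
`r2 = r_{ij|k}` and the curvature `R4 = R̄_{ijkl}`, with the identities that hold between them. -/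
structure PointData (E : Type*) [AddCommGroup E] [Module ℝ E] where
  g : E →ₗ[ℝ] E →ₗ[ℝ] ℝ
  b : E
  S : E →ₗ[ℝ] E
  R : E →ₗ[ℝ] E
  s2 : E →ₗ[ℝ] E →ₗ[ℝ] E →ₗ[ℝ] ℝ
  r2 : E →ₗ[ℝ] E →ₗ[ℝ] E →ₗ[ℝ] ℝ
  R4 : E → E → E →ₗ[ℝ] E →ₗ[ℝ] ℝ
  g_symm : ∀ u v, g u v = g v u
  g_pos : ∀ v, v ≠ 0 → 0 < g v v
  b_unit : g b b = 1
  S_skew : ∀ u v, g (S u) v = -g u (S v)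
  R_symm : ∀ u v, g (R u) v = g u (R v)
  R_b : R b = S b
  s2_skew : ∀ u v p, s2 u v p = -s2 v u p
  r2_symm : ∀ u v p, r2 u v p = r2 v u p
  r2_b : ∀ v p, r2 b v p = -(s2 b v p + g (S v) (R p + S p)) - g (R v) (R p + S p)
  ricci : ∀ i k l, r2 i k l + s2 i k l - (r2 i l k + s2 i l k) = R4 b i k l
  R4_add_left : ∀ u v j, R4 (u + v) j = R4 u j + R4 v j
  R4_smul_left : ∀ (t : ℝ) u j, R4 (t • u) j = t • R4 u j
  R4_skew_left : ∀ i j k l, R4 i j k l = -R4 j i k l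
  R4_skew_right : ∀ i j k l, R4 i j k l = -R4 i j l k
  R4_bianchi : ∀ i j k l, R4 i j k l + R4 i k l j + R4 i l j k = 0

/-! ### Tensor algebra at a point: the curvature and the three deviations. -/

namespace PointData

variable {E : Type*} [AddCommGroup E] [Module ℝ E] (D : PointData E)

/-- `σ(v) = s_j vʲ`. -/
def sig (v : E) : ℝ := D.g (D.S v) D.b

/-- `d(u, p) = b_{i|k} uⁱ pᵏ`. -/
def d (u p : E) : ℝ := D.g u (D.R p + D.S p)

/-- `s_{i|k} vⁱ pᵏ`. -/
def s1 (v p : E) : ℝ := D.s2 D.b v p + D.g (D.S v) (D.R p + D.S p)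

/-- `U y = s_0 b - S y`. -/
def U (y : E) : E := D.sig y • D.b - D.S y

/-- The covariant derivative of `g(κ, U j)` in the direction `p`. -/
def dU (κ j p : E) : ℝ := D.s1 j p * D.g D.b κ + D.sig j * D.d κ p - D.s2 κ j p

/-- `φ = α²/(2β)`. -/
def phi (y : E) : ℝ := D.g y y / (2 * D.g D.b y)

/-- The derivative of `φ` at `y` in the direction `w`. -/
def phiW (y w : E) : ℝ := (D.g y w - D.phi y * D.g D.b w) / D.g D.b y

/-- The part `φ U y + ½ r_00 b` of the difference of the sprays of `α²/β` and of `α`. -/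
def T (y : E) : E := D.phi y • D.U y + (D.g (D.R y) y / 2) • D.b

/-- The derivative of `T` at `y` in the direction `w`. -/
def TW (y w : E) : E :=
  D.phiW y w • D.U y + D.phi y • D.U w + D.g (D.R y) w • D.b

/-- The coefficient of `δⁱ_k` in the curvature which comes from the projective factor. -/
def projTerm (y : E) : ℝ :=
  D.s1 y y - 2 * D.phi y * D.sig (D.U y) + D.g D.b y / D.g y y * D.r2 y y y
    - 2 * D.g (D.R y) (D.U y) + D.sig y ^ 2
    + 6 * (D.g D.b y * D.g (D.R y) y / D.g y y) * D.sig y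
    + 3 * (D.g D.b y * D.g (D.R y) y / D.g y y) ^ 2

/-- The curvature of `α²/β` in the direction `y`, contracted with `w` and with a vector `κ`
orthogonal to `y`. -/
def curv (κ w y : E) : ℝ :=
  D.R4 κ y w y + D.phi y * (2 * D.dU κ y w - D.dU κ w y) - D.phiW y w * D.dU κ y y
    + D.g (D.R y) y * D.d κ w + D.g D.b κ * (D.r2 y y w - D.r2 y w y)
    - D.g (D.R y) w * D.d κ y
    + 2 * D.phiW y w * D.g κ (D.U (D.T y)) - D.phi y * D.g κ (D.U (D.TW y w))
    + D.g D.b κ * (2 * D.g (D.R w) (D.T y) - D.g (D.R y) (D.TW y w))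
    - (D.phiW y w * D.sig y + D.phi y * D.sig w + D.g (D.R y) w) * D.g κ (D.U y)
    + 2 * (D.phi y * D.sig y + D.g (D.R y) y / 2) * D.g κ (D.U w)
    + D.projTerm y * D.g κ w

/-- `bᵖ bˡ (r_{lp|i} - r_{li|p}) vⁱ`. -/
def bbr (v : E) : ℝ := D.r2 D.b D.b v - D.r2 D.b v D.b

/-- The terms of `B_{ik}` before the interchange of the indices; `μ` stands for `λ + c`, where
`c = (tˡ_l - (n-3) sˡs_l)/(n-1)`. -/
def BTerm (μ : ℝ) (i k : E) : ℝ :=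
  1 / 2 * (D.g (D.R i) (D.R k) + D.r2 D.b k i)
    + 1 / 2 * D.g D.b k * (D.bbr i - μ * D.g D.b i) + D.s1 i k

/-- `B_{ik}`. -/
def B (μ : ℝ) (i k : E) : ℝ := D.BTerm μ i k + D.BTerm μ k i

/-- The right-hand side of the equation for the curvature of `α`. -/
def curvRHS (c μ : ℝ) (i y k : E) : ℝ :=
  -c * (D.g y y * D.g i k - D.g i y * D.g k y) - D.B μ y y * D.g i k - D.B μ i k * D.g y y
    + D.B μ y k * D.g i y + D.B μ i y * D.g k y
    + D.g (D.R i) y * D.g (D.R k) y - D.g (D.R y) y * D.g (D.R i) k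

/-- The flag curvature. -/
def flag (c μ : ℝ) (y : E) : ℝ :=
  μ * (D.g D.b y ^ 2 / D.g y y) - 1 / 4 * (c + D.g (D.S D.b) (D.S D.b))
    + D.g D.b y ^ 2 / D.g y y ^ 2 * (3 * D.g D.b y ^ 2 / D.g y y ^ 2 * D.g (D.R y) y ^ 2
      + D.g D.b y / D.g y y * (D.r2 y y y + 6 * D.g (D.R y) y * D.sig y)
      + 3 * D.g (D.R y) (D.S y) + 3 * D.sig y ^ 2 - (D.r2 D.b y y - D.r2 y y D.b))

/-- The deviation from the equation for `s_{ij|k}` on vectors `i`, `j` orthogonal to `b`. -/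
def sDef (i j k : E) : ℝ :=
  D.s2 i j k - (-D.g (D.S D.b) (D.S j) * D.g i k + D.g (D.R i) k * D.sig j
    + D.g (D.S D.b) (D.S i) * D.g j k - D.g (D.R j) k * D.sig i)

/-- The deviation from the equation for `t_{ij}` on vectors orthogonal to `b`. -/
def tDef (c : ℝ) (i j : E) : ℝ :=
  D.g (D.S i) (D.S j) - D.sig i * D.sig j + (c + D.g (D.S D.b) (D.S D.b)) * D.g i j

/-- By `r2_b` the term b^l r_{lk|i} cancels r_{il} r^l_k and leaves −s_{k|i} and a term of type q.
Hence only half of the terms s_{i|k} survive. -/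
lemma B_eq (μ : ℝ) (i k : E) : D.B μ i k =
    1 / 2 * (D.s1 i k + D.s1 k i - D.g (D.R i) (D.S k) - D.g (D.R k) (D.S i))
      + 1 / 2 * D.g D.b k * (D.bbr i - μ * D.g D.b i)
      + 1 / 2 * D.g D.b i * (D.bbr k - μ * D.g D.b k) := by
  simp only [B, BTerm, D.r2_b, s1, map_add, D.g_symm (D.R k) (D.R i)]
  ring

lemma bbr_eq (v : E) : D.bbr v = D.s1 v D.b - D.s1 D.b v + D.g (D.R v) (D.S D.b)
    - D.g (D.R D.b) (D.S v) := by
  simp only [bbr, D.r2_b, s1, map_add, D.g_symm (D.R v) (D.R D.b)]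
  ring

/-- The Ricci identity trades the antisymmetrised derivative of r for a curvature term. This is how
R̄(b, y, b, y) enters the flag curvature. -/
lemma bdr_eq (y : E) : D.r2 D.b y y - D.r2 y y D.b =
    D.s1 y y - D.g (D.S y) (D.R y + D.S y) + D.R4 D.b y D.b y := by
  have h := D.ricci y y D.b
  have h1 := D.s2_skew y y D.b
  have h2 := D.s2_skew y D.b y
  have h3 := D.R4_skew_right D.b y y D.b
  have h4 := D.r2_symm y D.b y
  simp only [s1]
  linarith

/-- Up to a factor, s is the exterior derivative of β and hence closed. Here this comes from the
cyclic sum of the Ricci identity: the derivatives of r cancel by symmetry and the curvature by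
Bianchi. -/
lemma s2_cyclic (i j k : E) : D.s2 i j k + D.s2 j k i + D.s2 k i j = 0 := by
  have h1 := D.ricci i j k
  have h2 := D.ricci j k i
  have h3 := D.ricci k i j
  have h := D.R4_bianchi D.b i j k
  linarith [D.r2_symm i j k, D.r2_symm j k i, D.r2_symm k i j, D.s2_skew i j k, D.s2_skew j k i,
    D.s2_skew k i j, D.s2_skew i k j, D.s2_skew j i k, D.s2_skew k j i]

end PointData


/-! ### Expansion of the curvature of α²/β in terms of the deviations. -/

namespace PointData

variable {E : Type*} [AddCommGroup E] [Module ℝ E] (D : PointData E)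

/-- The terms with r_{00|0}, r_00² and r_00 s_0, which have powers of α² in the denominator, are the
same in `projTerm` and in F² times `flag`. What remains has β as its only denominator and no
derivative of r. -/
lemma projTerm_eq (c μ : ℝ) {y : E} (hβ : D.g D.b y ≠ 0) (hA : D.g y y ≠ 0) :
    D.projTerm y = D.flag c μ y * (D.g y y / D.g D.b y) ^ 2 - μ * D.g y y
      + 1 / 4 * (c + D.g (D.S D.b) (D.S D.b)) * (D.g y y / D.g D.b y) ^ 2
      + (2 * D.s1 y y - 2 * D.phi y * D.sig (D.U y) - 2 * D.g (D.R y) (D.U y)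
        - 2 * D.sig y ^ 2 - 3 * D.g (D.R y) (D.S y)
        - D.g (D.S y) (D.R y + D.S y) + D.R4 D.b y D.b y) := by
  have h := D.bdr_eq y
  simp only [flag, h, projTerm]
  field_simp
  ring

lemma S_S (u v : E) : D.g (D.S (D.S u)) v = -D.g (D.S u) (D.S v) := D.S_skew _ _

lemma S_b_b : D.g (D.S D.b) D.b = 0 := by
  have := D.S_skew D.b D.b
  rw [D.g_symm D.b] at this
  linarith

lemma s2_self (u p : E) : D.s2 u u p = 0 := by linarith [D.s2_skew u u p]

lemma R4_self_left (u k l : E) : D.R4 u u k l = 0 := by linarith [D.R4_skew_left u u k l]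

lemma R4_self_right (i j u : E) : D.R4 i j u u = 0 := by linarith [D.R4_skew_right i j u u]

lemma R4_add_right (u v j : E) : D.R4 j (u + v) = D.R4 j u + D.R4 j v := by
  ext k l
  rw [D.R4_skew_left, D.R4_add_left]
  simp only [LinearMap.add_apply, D.R4_skew_left j]
  ring

lemma R4_smul_right (t : ℝ) (u j : E) : D.R4 j (t • u) = t • D.R4 j u := by
  ext k l
  rw [D.R4_skew_left, D.R4_smul_left]
  simp only [LinearMap.smul_apply, D.R4_skew_left j, smul_eq_mul]
  ring

lemma R4_sub_smul_left (u v y w y' : E) (t : ℝ) :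
    D.R4 (v - t • u) y w y' = D.R4 v y w y' - t * D.R4 u y w y' := by
  rw [sub_eq_add_neg, ← neg_smul, D.R4_add_left, D.R4_smul_left]
  simp [sub_eq_add_neg]

set_option maxHeartbeats 4000000 in
-- The vectors orthogonal to y = βb + z are exactly the v − (g(v,z)/β) b with v orthogonal to b.
-- After all contractions with b are reduced to contractions with S, both sides are rational
-- functions of β in the same independent scalars. The constants c and μ cancel between `flag` and
-- the deviations.
theorem curv_eq (c μ : ℝ) {β : ℝ} {v w z : E} (hβ : β ≠ 0) (hv : D.g D.b v = 0)
    (hw : D.g D.b w = 0) (hz : D.g D.b z = 0) (hA : β ^ 2 + D.g z z ≠ 0) :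
    D.curv (v - (D.g v z / β) • D.b) w (β • D.b + z) =
      (D.R4 v (β • D.b + z) w (β • D.b + z) - D.curvRHS c μ v (β • D.b + z) w)
      + D.g v w * (D.R4 D.b z D.b z - D.curvRHS c μ D.b z D.b)
      + D.flag c μ (β • D.b + z) * ((β ^ 2 + D.g z z) / β) ^ 2 * D.g v w
      + (D.g v z / β * D.sDef w z z + 3 / 2 * D.g v z * D.sDef w z D.b
        - (β ^ 2 + D.g z z) / β * D.sDef v z w + D.g w z / β * D.sDef v z z
        + 3 / 2 * D.g w z * D.sDef v z D.b + (β ^ 2 + D.g z z) / (2 * β) * D.sDef v w z)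
      + (((β ^ 2 + D.g z z) / β) ^ 2 / 4 * D.tDef c v w
        - (β ^ 2 + D.g z z) / (2 * β ^ 2) * (D.g v z * D.tDef c w z + D.g w z * D.tDef c v z)
        + D.g w z * D.g v z / β ^ 2 * D.tDef c z z - (β ^ 2 + D.g z z) * D.tDef c v w
        + D.g v z * D.tDef c w z + D.g w z * D.tDef c v z - D.g v w * D.tDef c z z) := by
  have hv' : D.g v D.b = 0 := by rw [D.g_symm, hv]
  have hw' : D.g w D.b = 0 := by rw [D.g_symm, hw]
  have hz' : D.g z D.b = 0 := by rw [D.g_symm, hz]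
  have hby : D.g D.b (β • D.b + z) = β := by simp [D.b_unit, hz]
  have hyy : D.g (β • D.b + z) (β • D.b + z) = β ^ 2 + D.g z z := by
    simp [D.b_unit, hz, hz']; ring
  have hyw : D.g (β • D.b + z) w = D.g w z := by simp [hw, D.g_symm z w]
  have hphi : D.phi (β • D.b + z) = (β ^ 2 + D.g z z) / (2 * β) := by rw [phi, hyy, hby]
  have hphiW : D.phiW (β • D.b + z) w = D.g w z / β := by rw [phiW, hyw, hby, hw]; ring
  have hproj := D.projTerm_eq c μ (y := β • D.b + z) (by rwa [hby]) (by rwa [hyy])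
  rw [hyy, hby] at hproj
  have hr := D.ricci (β • D.b + z) w (β • D.b + z)
  have hr' : D.R4 D.b (β • D.b + z) w (β • D.b + z)
    = D.r2 (β • D.b + z) w (β • D.b + z) + D.s2 (β • D.b + z) w (β • D.b + z)
      - D.r2 (β • D.b + z) (β • D.b + z) w := by
    rw [← hr, D.s2_self]; ring
  have e1 : D.g D.b (v - (D.g v z / β) • D.b) = -(D.g v z / β) := by simp [hv, D.b_unit]
  have e2 : D.g (v - (D.g v z / β) • D.b) w = D.g v w := by simp [hw]
  rw [curv, hproj, hphi, hphiW, e1, e2, D.R4_sub_smul_left, hr']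
  generalize D.flag c μ (β • D.b + z) = fl
  have s2_vb : D.s2 v D.b = - D.s2 D.b v := by ext p; exact D.s2_skew _ _ _
  have s2_bb : D.s2 D.b D.b = 0 := by ext p; exact D.s2_self _ _
  have s2_zw : D.s2 z w = - D.s2 w z := by ext p; exact D.s2_skew _ _ _
  -- Closedness of s turns its derivative along b into derivatives of s contracted with b.
  have s2_b (i j : E) : D.s2 i j D.b = D.s2 D.b j i - D.s2 D.b i j := by
    linarith [D.s2_cyclic i j D.b, D.s2_skew D.b j i]
  have gSb (x : E) : D.g (D.S D.b) x = -D.g (D.S x) D.b := by rw [D.S_skew, D.g_symm]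
  have gRb (x : E) : D.g (D.R x) D.b = -D.g (D.S x) D.b := by
    rw [D.R_symm, D.R_b, D.g_symm, gSb]
  have gSR (x y : E) : D.g (D.S x) (D.R y) = D.g (D.R y) (D.S x) := D.g_symm _ _
  have hSv (x : E) : D.g v (D.S x) = D.g (D.S x) v := D.g_symm _ _
  have hSb (x : E) : D.g D.b (D.S x) = D.g (D.S x) D.b := D.g_symm _ _
  have hRv (x : E) : D.g v (D.R x) = D.g (D.R x) v := D.g_symm _ _
  have hRb (x : E) : D.g D.b (D.R x) = D.g (D.R x) D.b := D.g_symm _ _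
  have hSS (x y : E) : D.g (D.S x) y = -D.g (D.S y) x := by rw [D.S_skew, D.g_symm]
  have hRR (x y : E) : D.g (D.R x) y = D.g (D.R y) x := by rw [D.R_symm, D.g_symm]
  have R4b : D.R4 D.b (β • D.b + z) D.b (β • D.b + z) = D.R4 D.b z D.b z := by
    rw [D.R4_add_right, D.R4_smul_right]
    simp [D.R4_self_left, D.R4_self_right]
  rw [R4b]
  generalize D.R4 v (β • D.b + z) w (β • D.b + z) = R1
  generalize D.R4 D.b z D.b z = R2
  -- The first call expands everything by linearity. The second picks one representative from each
  -- orbit of scalars under the symmetries of g, R, S and s_{ij|k}, so that `ring` sees equal atoms.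
  simp only [curvRHS, D.B_eq, D.bbr_eq, sDef, tDef, dU, U, T, TW, hphi, hphiW, s1, sig, d, D.R_b,
    map_add, map_sub, map_smul, LinearMap.add_apply, LinearMap.sub_apply, LinearMap.smul_apply,
    smul_eq_mul, s2_vb, s2_bb, s2_zw, D.b_unit, hv, hw, hz, hv', hw', hz',
    LinearMap.neg_apply, LinearMap.zero_apply, D.S_S, D.S_b_b, mul_zero, zero_mul, add_zero,
    zero_add, sub_zero, mul_one, smul_zero]
  simp only [gSR, hSv, hSb, hRv, hRb, gRb, gSb v, gSb w, gSb z,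
    hSS w v, hSS z v, hRR w v, hRR z v, hRR z w, D.g_symm z w,
    D.g_symm (D.S v) (D.S D.b), D.g_symm (D.S w) (D.S D.b), D.g_symm (D.S z) (D.S D.b),
    D.g_symm (D.S w) (D.S v), D.g_symm (D.S z) (D.S v), D.g_symm (D.S z) (D.S w),
    s2_b w z, s2_b v z, s2_b v w, D.S_b_b, D.S_S]
  field_simp
  ring

end PointData


/-! ### From the vanishing for orthogonal vectors to the tensor equations, and back. -/

lemma coeffs_eq_zero {c₀ c₁ c₂ c₃ c₄ : ℝ}
    (h : ∀ β : ℝ, 0 < β → c₀ + c₁ * β + c₂ * β ^ 2 + c₃ * β ^ 3 + c₄ * β ^ 4 = 0) :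
    c₀ = 0 ∧ c₁ = 0 ∧ c₂ = 0 ∧ c₃ = 0 ∧ c₄ = 0 := by
  -- Five distinct positive points determine a polynomial of degree at most four.
  have h1 := h 1 (by norm_num)
  have h2 := h 2 (by norm_num)
  have h3 := h 3 (by norm_num)
  have h4 := h 4 (by norm_num)
  have h5 := h 5 (by norm_num)
  norm_num at h1 h2 h3 h4 h5
  refine ⟨?_, ?_, ?_, ?_, ?_⟩ <;> linarith

namespace PointData

variable {E : Type*} [AddCommGroup E] [Module ℝ E] (D : PointData E)

/-- The equation for `t_{ij}`. -/
def TEq (c : ℝ) : Prop := ∀ i j, -D.g (D.S i) (D.S j) =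
  -D.g D.b i * D.g (D.S D.b) (D.S j) - D.g D.b j * D.g (D.S D.b) (D.S i) - D.sig i * D.sig j
    + (c + D.g (D.S D.b) (D.S D.b)) * D.g i j - c * D.g D.b i * D.g D.b j

/-- The terms of the equation for `s_{ij|k}` before the interchange of indices. -/
def sTerm (c : ℝ) (i j k : E) : ℝ :=
  (-D.g (D.S D.b) (D.S j) - c * D.g D.b j) * D.g i k + D.g (D.R i) k * D.sig j
    + D.g (D.R k) (D.S i) * D.g D.b j + D.s1 j k * D.g D.b i

/-- The equation for `s_{ij|k}`. -/
def SEq (c : ℝ) : Prop := ∀ i j k, D.s2 i j k = D.sTerm c i j k - D.sTerm c j i k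

/-- The equation for `q_{ik}`. -/
def QEq : Prop := ∀ i k, D.g (D.R i) (D.S k) =
  1 / 2 * (D.bbr i * D.g D.b k - D.bbr k * D.g D.b i) - 1 / 2 * (D.r2 D.b k i + D.r2 D.b i k)
    - D.g (D.R i) (D.R k) - D.s1 i k

/-- The equation for the curvature of `α`. -/
def CEq (c μ : ℝ) : Prop := ∀ v y w, D.R4 v y w y = D.curvRHS c μ v y w

/-- The part orthogonal to `b` of a vector. -/
def perp (v : E) : E := v - D.g D.b v • D.b

lemma perp_add (v : E) : D.g D.b v • D.b + D.perp v = v := by simp [perp]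

lemma b_perp (v : E) : D.g D.b (D.perp v) = 0 := by simp [perp, D.b_unit]

lemma g_nonneg (v : E) : 0 ≤ D.g v v := by
  by_cases h : v = 0
  · simp [h]
  · exact (D.g_pos v h).le

/-- A symmetric form which vanishes on orthogonal pairs has a constant ratio f(v,v)/g(v,v): any v is
compared with a fixed e by means of an orthogonal pair in their span. If the complement of b is
zero, the factor is irrelevant. -/
lemma exists_eq_mul_g (f : E → E → ℝ) (hsymm : ∀ u v, f u v = f v u)
    (hlin : ∀ (s : ℝ) u v w, f (s • u + v) w = s * f u w + f v w)
    (h : ∀ v w, D.g D.b v = 0 → D.g D.b w = 0 → D.g v w = 0 → f v w = 0) :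
    ∃ κ : ℝ, ∀ v w, D.g D.b v = 0 → D.g D.b w = 0 → f v w = κ * D.g v w := by
  by_cases he : ∃ e, D.g D.b e = 0 ∧ e ≠ 0
  swap
  · push Not at he
    refine ⟨0, fun v w hv hw => ?_⟩
    rw [he v hv]
    rw [h 0 w (by simp) hw (by simp)]
    simp
  obtain ⟨e, hbe, he⟩ := he
  have hee := D.g_pos e he
  have hlin' (s : ℝ) (u v w : E) : f w (s • u + v) = s * f w u + f w v := by
    rw [hsymm, hlin, hsymm u, hsymm v]
  have hd (v) (hv : D.g D.b v = 0) : f v v = f e e / D.g e e * D.g v v := by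
    obtain ⟨a, v', rfl, hv'⟩ : ∃ (a : ℝ) (v' : E), v = a • e + v' ∧ D.g e v' = 0 :=
      ⟨D.g e v / D.g e e, v - (D.g e v / D.g e e) • e, by simp, by simp; field_simp; ring⟩
    have hbv' : D.g D.b v' = 0 := by simpa [hbe] using hv
    -- The coefficient −|v'|²/|e|² makes this vector orthogonal to e + v'. The cross terms of f
    -- vanish, so f(v',v') = (|v'|²/|e|²) f(e,e).
    have h1 := h (1 • e + v') ((-D.g v' v' / D.g e e) • e + v') (by simp [hbe, hbv'])
      (by simp [hbe, hbv']) (by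
        simp [hv', D.g_symm v' e]; field_simp; ring)
    have h2 := h e v' hbe hbv' hv'
    have h3 := h2
    rw [hsymm] at h3
    have h1' : f ((1 : ℝ) • e + v') ((-D.g v' v' / D.g e e) • e + v') = 0 := by simpa using h1
    rw [hlin, hlin', hlin', h2, h3] at h1'
    rw [hlin, hlin', hlin', h2, h3]
    simp only [map_add, map_smul, LinearMap.add_apply, LinearMap.smul_apply, smul_eq_mul, hv',
      D.g_symm v' e]
    field_simp at h1' ⊢
    linarith
  refine ⟨f e e / D.g e e, fun v w hv hw => ?_⟩
  by_cases hv0 : v = 0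
  · subst hv0
    rw [h 0 w (by simp) hw (by simp)]
    simp
  have hvv := D.g_pos v hv0
  obtain ⟨a, w', rfl, hw'⟩ : ∃ (a : ℝ) (w' : E), w = a • v + w' ∧ D.g v w' = 0 :=
    ⟨D.g v w / D.g v v, w - (D.g v w / D.g v v) • v, by simp, by simp; field_simp; ring⟩
  have hbw' : D.g D.b w' = 0 := by simpa [hv] using hw
  rw [hlin', h v w' hv hbw' hw', hd v hv]
  simp [hw']
  ring

/-- The deviation from the equation for the curvature of `α`, as a four-linear form. -/
def curvDef (c μ : ℝ) (i j k l : E) : ℝ :=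
  D.R4 i j k l - (-c * (D.g j l * D.g i k - D.g i l * D.g j k) - D.B μ j l * D.g i k
    - D.B μ i k * D.g j l + D.B μ j k * D.g i l + D.B μ i l * D.g j k
    + D.g (D.R i) l * D.g (D.R j) k - D.g (D.R j) l * D.g (D.R i) k)

lemma curvDef_diag (c μ : ℝ) (v y w : E) :
    D.curvDef c μ v y w y = D.R4 v y w y - D.curvRHS c μ v y w := by
  have h : D.g (D.R y) w = D.g (D.R w) y := by rw [D.R_symm, D.g_symm]
  simp only [curvDef, curvRHS, h, D.g_symm y w]

lemma B_comm (μ : ℝ) (i k : E) : D.B μ i k = D.B μ k i := add_comm _ _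

lemma B_lin (μ s : ℝ) (u v k : E) : D.B μ (s • u + v) k = s * D.B μ u k + D.B μ v k := by
  simp only [B_eq, bbr_eq, s1, map_add, map_smul, LinearMap.add_apply, LinearMap.smul_apply,
    smul_eq_mul]
  ring

lemma curvDef_lin (c μ s : ℝ) (u v j k l : E) : D.curvDef c μ (s • u + v) j k l =
    s * D.curvDef c μ u j k l + D.curvDef c μ v j k l := by
  simp only [curvDef, B_lin, D.R4_add_left, D.R4_smul_left, map_add, map_smul, LinearMap.add_apply,
    LinearMap.smul_apply, smul_eq_mul]
  ring

lemma curvDef_skew_left (c μ : ℝ) (i j k l : E) :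
    D.curvDef c μ i j k l = -D.curvDef c μ j i k l := by
  simp only [curvDef, D.R4_skew_left i j]
  ring

lemma curvDef_skew_right (c μ : ℝ) (i j k l : E) :
    D.curvDef c μ i j k l = -D.curvDef c μ i j l k := by
  simp only [curvDef, D.R4_skew_right i j k l]
  ring

lemma curvDef_bianchi (c μ : ℝ) (i j k l : E) :
    D.curvDef c μ i j k l + D.curvDef c μ i k l j + D.curvDef c μ i l j k = 0 := by
  have h := D.R4_bianchi i j k l
  have hR (x y : E) : D.g (D.R x) y = D.g (D.R y) x := by rw [D.R_symm, D.g_symm]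
  simp only [curvDef, D.B_comm μ l j, D.B_comm μ k j, D.B_comm μ l k, D.g_symm l j, D.g_symm k j,
    D.g_symm l k, hR l j, hR k j, hR l k]
  linear_combination h

/-- The usual consequence of the two skew-symmetries and four instances of the Bianchi identity. It
transports linearity from the first two slots to the last two. -/
lemma curvDef_pair (c μ : ℝ) (i j k l : E) : D.curvDef c μ i j k l = D.curvDef c μ k l i j := by
  have a := D.curvDef_bianchi c μ i j k l
  have b := D.curvDef_bianchi c μ j k l i
  have e := D.curvDef_bianchi c μ k l i j
  have f := D.curvDef_bianchi c μ l i j k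
  linarith [D.curvDef_skew_left c μ i j k l, D.curvDef_skew_left c μ i k l j,
    D.curvDef_skew_left c μ i l j k, D.curvDef_skew_left c μ j k l i,
    D.curvDef_skew_left c μ j l i k, D.curvDef_skew_left c μ k l i j,
    D.curvDef_skew_right c μ i j k l, D.curvDef_skew_right c μ j i k l,
    D.curvDef_skew_right c μ i k l j, D.curvDef_skew_right c μ k i l j,
    D.curvDef_skew_right c μ i l j k, D.curvDef_skew_right c μ l i j k,
    D.curvDef_skew_right c μ j k l i, D.curvDef_skew_right c μ k j l i,
    D.curvDef_skew_right c μ j l i k, D.curvDef_skew_right c μ l j i k,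
    D.curvDef_skew_right c μ k l i j, D.curvDef_skew_right c μ l k i j]

lemma curvDef_lin₂ (c μ s : ℝ) (u v j k l : E) : D.curvDef c μ j (s • u + v) k l =
    s * D.curvDef c μ j u k l + D.curvDef c μ j v k l := by
  rw [D.curvDef_skew_left, curvDef_lin, D.curvDef_skew_left c μ u, D.curvDef_skew_left c μ v]
  ring

lemma curvDef_lin₃ (c μ s : ℝ) (u v j k l : E) : D.curvDef c μ j k (s • u + v) l =
    s * D.curvDef c μ j k u l + D.curvDef c μ j k v l := by
  rw [D.curvDef_pair, curvDef_lin, D.curvDef_pair c μ u, D.curvDef_pair c μ v]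

lemma curvDef_lin₄ (c μ s : ℝ) (u v j k l : E) : D.curvDef c μ j k l (s • u + v) =
    s * D.curvDef c μ j k l u + D.curvDef c μ j k l v := by
  rw [D.curvDef_pair, curvDef_lin₂, D.curvDef_pair c μ l, D.curvDef_pair c μ l]

lemma curvDef_self_left (c μ : ℝ) (i k l : E) : D.curvDef c μ i i k l = 0 := by
  linarith [D.curvDef_skew_left c μ i i k l]

lemma curvDef_self_right (c μ : ℝ) (i k l : E) : D.curvDef c μ k l i i = 0 := by
  linarith [D.curvDef_skew_right c μ k l i i]

lemma exists_orth {v : E} (hv : D.g D.b v = 0) (w : E) (hw : D.g D.b w = 0) :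
    ∃ (a : ℝ) (w' : E), w = a • v + w' ∧ D.g D.b w' = 0 ∧ D.g v w' = 0 := by
  by_cases h : v = 0
  · exact ⟨0, w, by simp, hw, by simp [h]⟩
  · have := D.g_pos v h
    exact ⟨D.g v w / D.g v v, w - (D.g v w / D.g v v) • v, by simp, by simp [hv, hw],
      by simp; field_simp; ring⟩

/-- An algebraic curvature tensor is determined by its values on (v, y, v, y). Splitting v and y
along b leaves components with none, one or two pairs containing b; `h0`, `h1` and `h2` kill these
in turn. -/
lemma curvDef_eq_zero (c μ : ℝ)
    (h0 : ∀ v w z, D.g D.b v = 0 → D.g D.b w = 0 → D.g D.b z = 0 → D.g v w = 0 →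
      D.curvDef c μ v z w z = 0)
    (h1 : ∀ v w z, D.g D.b v = 0 → D.g D.b w = 0 → D.g D.b z = 0 → D.g v w = 0 →
      D.curvDef c μ v D.b w z + D.curvDef c μ v z w D.b = 0)
    (h2 : ∀ v, D.g D.b v = 0 → D.curvDef c μ v D.b v D.b = 0) (v y w : E) :
    D.curvDef c μ v y w y = 0 := by
  have hV (v z) (hv : D.g D.b v = 0) (hz : D.g D.b z = 0) : D.curvDef c μ v z v z = 0 := by
    obtain ⟨a, z', rfl, hz', hvz'⟩ := D.exists_orth hv z hz
    -- For the orthogonal pair v, z' and third vector v + z', skew-symmetry leaves only the value on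
    -- (v, z', z', v), which is minus the sectional value.
    have h := h0 v z' ((1 : ℝ) • v + z') hv hz' (by simp [hv, hz']) hvz'
    simp only [curvDef_lin₂, curvDef_lin₄, curvDef_self_left, curvDef_self_right] at h ⊢
    linarith [D.curvDef_skew_right c μ v z' z' v]
  have hM1 (v w) (hv : D.g D.b v = 0) (hw : D.g D.b w = 0) : D.curvDef c μ v D.b w v = 0 := by
    obtain ⟨a, w', rfl, hw', hvw'⟩ := D.exists_orth hv w hw
    have h := h1 v w' v hv hw' hv hvw'
    simp only [curvDef_lin₃, curvDef_self_left, curvDef_self_right] at h ⊢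
    linarith
  have hM2 (v w z) (hv : D.g D.b v = 0) (hw : D.g D.b w = 0) (hz : D.g D.b z = 0) :
      D.curvDef c μ v D.b w z = -D.curvDef c μ z D.b w v := by
    have h := hM1 ((1 : ℝ) • v + z) w (by simp [hv, hz]) hw
    simp only [curvDef_lin, curvDef_lin₄, hM1 v w hv hw, hM1 z w hz hw] at h
    linarith
  have hM (v w z) (hv : D.g D.b v = 0) (hw : D.g D.b w = 0) (hz : D.g D.b z = 0) :
      D.curvDef c μ D.b v w z = 0 := by
    -- The values with a single b are skew in the slots paired by `hM2` and in the last two slots,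
    -- hence totally skew. Bianchi then makes three times the value vanish.
    have h := D.curvDef_bianchi c μ D.b v w z
    linarith [D.curvDef_skew_left c μ D.b v w z, D.curvDef_skew_left c μ D.b w z v,
      D.curvDef_skew_left c μ D.b z v w, hM2 v w z hv hw hz, hM2 w z v hw hz hv,
      hM2 z v w hz hv hw, D.curvDef_skew_right c μ v D.b w z, D.curvDef_skew_right c μ w D.b z v,
      D.curvDef_skew_right c μ z D.b v w]
  have hd (v y) : D.curvDef c μ v y v y = 0 := by
    rw [← D.perp_add v, ← D.perp_add y]
    have hv := D.b_perp v
    have hy := D.b_perp y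
    generalize D.perp v = v' at hv ⊢
    generalize D.perp y = y' at hy ⊢
    have e1 := h2 v' hv
    have e2 := h2 y' hy
    have e3 : D.curvDef c μ v' D.b y' D.b = 0 := by
      have := h2 ((1 : ℝ) • v' + y') (by simp [hv, hy])
      simp only [curvDef_lin, curvDef_lin₃, e1, e2] at this
      linarith [D.curvDef_pair c μ v' D.b y' D.b]
    simp only [curvDef_lin, curvDef_lin₂, curvDef_lin₃, curvDef_lin₄, curvDef_self_left,
      curvDef_self_right, hV v' y' hv hy, hM v' v' y' hv hv hy, hM y' v' y' hy hv hy,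
      D.curvDef_skew_left c μ v' D.b, D.curvDef_skew_left c μ y' D.b,
      D.curvDef_pair c μ D.b y' D.b v', D.curvDef_pair c μ v' y' D.b, D.curvDef_pair c μ v' y' _ D.b,
      D.curvDef_skew_right c μ D.b _ _ D.b] at e1 e2 e3 ⊢
    linear_combination (D.g D.b v) ^ 2 * e2 - 2 * D.g D.b v * D.g D.b y * e3
      + (D.g D.b y) ^ 2 * e1
  have h := hd ((1 : ℝ) • v + w) y
  simp only [curvDef_lin, curvDef_lin₃, hd v y, hd w y] at h
  linarith [D.curvDef_pair c μ v y w y]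

/-- The tensor whose vanishing for orthogonal `v` and `w` expresses scalar flag curvature. -/
def WeylVanishes : Prop := ∀ v w z, D.g D.b v = 0 → D.g D.b w = 0 → D.g D.b z = 0 → D.g v w = 0 →
  ∀ β : ℝ, 0 < β → D.curv (v - (D.g v z / β) • D.b) w (β • D.b + z) = 0

/-- For orthogonal v and w the flag term of `curv_eq` drops out. The rest times β² is a polynomial
of degree four in β, and the five identities are its coefficients in increasing order. -/
lemma WeylVanishes.coeffs {D : PointData E} (h : D.WeylVanishes) (c μ : ℝ) {v w z : E}
    (hv : D.g D.b v = 0) (hw : D.g D.b w = 0) (hz : D.g D.b z = 0) (hvw : D.g v w = 0) :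
    1 / 4 * D.g z z ^ 2 * D.tDef c v w
        - 1 / 2 * D.g z z * (D.g v z * D.tDef c w z + D.g w z * D.tDef c v z)
        + D.g w z * D.g v z * D.tDef c z z = 0 ∧
      D.g v z * D.sDef w z z - D.g z z * D.sDef v z w + D.g w z * D.sDef v z z
        + 1 / 2 * D.g z z * D.sDef v w z = 0 ∧
      D.curvDef c μ v z w z + 3 / 2 * (D.g v z * D.sDef w z D.b + D.g w z * D.sDef v z D.b)
        - 1 / 2 * D.g z z * D.tDef c v w
        + 1 / 2 * (D.g v z * D.tDef c w z + D.g w z * D.tDef c v z) = 0 ∧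
      D.curvDef c μ v D.b w z + D.curvDef c μ v z w D.b - D.sDef v z w
        + 1 / 2 * D.sDef v w z = 0 ∧
      D.curvDef c μ v D.b w D.b - 3 / 4 * D.tDef c v w = 0 := by
  apply coeffs_eq_zero
  intro β hβ
  have hA : β ^ 2 + D.g z z ≠ 0 := by have := D.g_nonneg z; positivity
  have e := D.curv_eq c μ hβ.ne' hv hw hz hA
  rw [h v w z hv hw hz hvw β hβ, ← D.curvDef_diag, curvDef_lin₂, curvDef_lin₄, curvDef_lin₄, hvw]
    at e
  field_simp at e
  linear_combination -e / 8

lemma tDef_symm (c : ℝ) (u v : E) : D.tDef c u v = D.tDef c v u := by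
  simp only [tDef, D.g_symm (D.S u), D.g_symm u v]; ring

lemma tDef_lin (c s : ℝ) (u v w : E) :
    D.tDef c (s • u + v) w = s * D.tDef c u w + D.tDef c v w := by
  simp only [tDef, sig, map_add, map_smul, LinearMap.add_apply, LinearMap.smul_apply, smul_eq_mul]
  ring

/-- If one of the indices is contracted with b, the equation for t_{ij} is an identity, because b is
a unit vector and s(b,b) = 0. -/
lemma TEq_of_tDef {c : ℝ} (h : ∀ v w, D.g D.b v = 0 → D.g D.b w = 0 → D.tDef c v w = 0) :
    D.TEq c := by
  intro i j
  have e := h _ _ (D.b_perp i) (D.b_perp j)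
  simp only [tDef, sig, perp, map_sub, map_smul, LinearMap.sub_apply, LinearMap.smul_apply,
    smul_eq_mul, D.b_unit, D.S_b_b, D.g_symm i D.b, D.g_symm (D.S i) (D.S D.b)] at e
  simp only [sig]
  linear_combination -e

lemma WeylVanishes.exists_TEq {D : PointData E} (h : D.WeylVanishes) : ∃ c, D.TEq c := by
  obtain ⟨κ, hκ⟩ := D.exists_eq_mul_g (D.tDef 0) (D.tDef_symm 0) (D.tDef_lin 0)
    (fun v w hv hw hvw => by
      by_cases h0 : v = 0
      · simp [h0, tDef, sig]
      have hpos := D.g_pos v h0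
      -- With z = v the lowest coefficient is −¼|v|⁴ times the deviation. The choice c = 0 is
      -- harmless: changing c adds a multiple of g, which vanishes on the pair.
      have e := (h.coeffs 0 0 hv hw hv hvw).1
      rw [D.g_symm w v, hvw, D.tDef_symm 0 w v] at e
      have : D.g v v ^ 2 * D.tDef 0 v w = 0 := by linear_combination -4 * e
      simpa [hpos.ne'] using this)
  refine ⟨-κ, D.TEq_of_tDef fun v w hv hw => ?_⟩
  have := hκ v w hv hw
  simp only [tDef] at this ⊢
  linear_combination this

lemma tDef_of_TEq {c : ℝ} (h : D.TEq c) {v w : E} (hv : D.g D.b v = 0) (hw : D.g D.b w = 0) :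
    D.tDef c v w = 0 := by
  have := h v w
  rw [hv, hw] at this
  rw [tDef]
  linear_combination -this

lemma sDef_of_SEq {c : ℝ} (h : D.SEq c) {v w : E} (hv : D.g D.b v = 0) (hw : D.g D.b w = 0)
    (k : E) : D.sDef v w k = 0 := by
  have := h v w k
  simp only [sTerm, hv, hw] at this
  rw [sDef]
  linear_combination this

/-- The equations determine the contractions of the curvature of `α²/β`. -/
theorem curv_of_equations {c μ : ℝ} (hT : D.TEq c) (hS : D.SEq c) (hC : D.CEq c μ) {v w y : E}
    (hv : D.g D.b v = 0) (hw : D.g D.b w = 0) (hy : 0 < D.g D.b y) :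
    D.curv (v - (D.g v y / D.g D.b y) • D.b) w y =
      D.flag c μ y * (D.g y y / D.g D.b y) ^ 2 * D.g v w := by
  obtain ⟨β, z, hβ, hz, rfl⟩ : ∃ (β : ℝ) (z : E), 0 < β ∧ D.g D.b z = 0 ∧ y = β • D.b + z :=
    ⟨_, _, hy, D.b_perp y, (D.perp_add y).symm⟩
  -- With y split along b, `curv_eq` applies; all deviations vanish and only the flag term is left.
  have hv' : D.g v D.b = 0 := by rw [D.g_symm, hv]
  have hz' : D.g z D.b = 0 := by rw [D.g_symm, hz]
  have hby : D.g D.b (β • D.b + z) = β := by simp [D.b_unit, hz]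
  have hyy : D.g (β • D.b + z) (β • D.b + z) = β ^ 2 + D.g z z := by
    simp [D.b_unit, hz, hz']; ring
  have hvy : D.g v (β • D.b + z) = D.g v z := by simp [hv']
  have hA : β ^ 2 + D.g z z ≠ 0 := by have := D.g_nonneg z; positivity
  rw [hvy, hby, hyy, D.curv_eq c μ hβ.ne' hv hw hz hA]
  simp only [D.sDef_of_SEq hS hw hz, D.sDef_of_SEq hS hv hz, D.sDef_of_SEq hS hv hw,
    D.tDef_of_TEq hT hv hw, D.tDef_of_TEq hT hw hz, D.tDef_of_TEq hT hv hz, D.tDef_of_TEq hT hz hz]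
  rw [hC v _ w, hC D.b z D.b]
  ring

lemma sDef_skew (i j k : E) : D.sDef i j k = -D.sDef j i k := by
  rw [sDef, sDef, D.s2_skew]; ring

lemma sDef_lin₂ (s : ℝ) (u v i k : E) : D.sDef i (s • u + v) k = s * D.sDef i u k + D.sDef i v k := by
  simp only [sDef, sig, map_add, map_smul, LinearMap.add_apply, LinearMap.smul_apply, smul_eq_mul]
  ring

lemma sDef_lin₃ (s : ℝ) (u v i j : E) : D.sDef i j (s • u + v) = s * D.sDef i j u + D.sDef i j v := by
  simp only [sDef, sig, map_add, map_smul, smul_eq_mul]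
  ring

lemma sDef_cyclic (i j k : E) : D.sDef i j k + D.sDef j k i + D.sDef k i j = 0 := by
  have h := D.s2_cyclic i j k
  have hR (x y : E) : D.g (D.R x) y = D.g (D.R y) x := by rw [D.R_symm, D.g_symm]
  simp only [sDef, D.g_symm k i, D.g_symm k j, D.g_symm j i, hR k i, hR k j, hR j i]
  linear_combination h

/-- On vectors orthogonal to b, the coefficient of β with z = v makes the deviation skew in its last
two slots. It is also skew in the first two and has zero cyclic sum, so it vanishes. The derivative
direction b is handled by the coefficient of β². -/
lemma WeylVanishes.sDef_eq_zero {D : PointData E} (h : D.WeylVanishes) {c : ℝ} (hT : D.TEq c)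
    {i j : E} (hi : D.g D.b i = 0) (hj : D.g D.b j = 0) (k : E) : D.sDef i j k = 0 := by
  have h1 (w v) (hw : D.g D.b w = 0) (hv : D.g D.b v = 0) : D.sDef w v v = 0 := by
    obtain ⟨a, w', rfl, hw', hvw'⟩ := D.exists_orth hv w hw
    rw [sDef_skew, sDef_lin₂]
    have hvv : D.sDef v v v = 0 := by linarith [D.sDef_skew v v v]
    by_cases h0 : v = 0
    · simp [h0, sDef, sig]
    have hpos := D.g_pos v h0
    -- With z = v only the second and the last term of this coefficient can differ from zero besides
    -- the first; together they leave −½|v|² times the deviation on (v, w', v).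
    have e := (h.coeffs c 0 hv hw' hv hvw').2.1
    rw [D.g_symm w' v, hvw', D.sDef_skew w' v v] at e
    have : D.g v v * D.sDef v w' v = 0 := by
      have h2 : D.sDef v v w' = 0 := by linarith [D.sDef_skew v v w']
      rw [h2] at e
      linear_combination -2 * e
    have : D.sDef v w' v = 0 := by simpa [hpos.ne'] using this
    rw [hvv, this]
    simp
  have hV (i j k) (hi : D.g D.b i = 0) (hj : D.g D.b j = 0) (hk : D.g D.b k = 0) :
      D.sDef i j k = 0 := by
    have key (u v w) (hu : D.g D.b u = 0) (hv : D.g D.b v = 0) (hw : D.g D.b w = 0) :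
        D.sDef u v w = -D.sDef u w v := by
      have e := h1 u ((1 : ℝ) • v + w) hu (by simp [hv, hw])
      simp only [sDef_lin₂, sDef_lin₃, h1 u v hu hv, h1 u w hu hw] at e
      linarith
    linarith [D.sDef_cyclic i j k, key i j k hi hj hk, key j k i hj hk hi, key k i j hk hi hj,
      D.sDef_skew i j k, D.sDef_skew j k i, D.sDef_skew k i j]
  have hb (w v) (hw : D.g D.b w = 0) (hv : D.g D.b v = 0) : D.sDef w v D.b = 0 := by
    obtain ⟨a, w', rfl, hw', hvw'⟩ := D.exists_orth hv w hw
    rw [sDef_skew, sDef_lin₂]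
    have hvv : D.sDef v v D.b = 0 := by linarith [D.sDef_skew v v D.b]
    by_cases h0 : v = 0
    · simp [h0, sDef, sig]
    have hpos := D.g_pos v h0
    -- With z = v the curvature term has a repeated first pair and the terms in t vanish by `hT`.
    -- Only the deviation in the direction b remains.
    have e := (h.coeffs c 0 hv hw' hv hvw').2.2.1
    simp only [D.g_symm w' v, hvw', curvDef_self_left, D.tDef_of_TEq hT hv hw',
      D.tDef_of_TEq hT hw' hv, D.sDef_skew w' v] at e
    have : D.g v v * D.sDef v w' D.b = 0 := by linear_combination -2 / 3 * e
    have : D.sDef v w' D.b = 0 := by simpa [hpos.ne'] using this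
    rw [hvv, this]
    simp
  rw [← D.perp_add k, sDef_lin₃, hb i j hi hj, hV i j _ hi hj (D.b_perp k)]
  simp

/-- With i = b the terms s_{j|k} contain the derivative of b, and the equation for s_{ij|k} turns
into the equation for t_{jk}. Together with skew-symmetry this extends the equation from the
complement of b to all vectors. -/
lemma SEq_of_sDef {c : ℝ} (hT : D.TEq c)
    (h : ∀ i j, D.g D.b i = 0 → D.g D.b j = 0 → ∀ k, D.sDef i j k = 0) : D.SEq c := by
  have gSb (x : E) : D.g (D.S D.b) x = -D.g (D.S x) D.b := by rw [D.S_skew, D.g_symm]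
  have hb (j k : E) : D.s2 D.b j k = D.sTerm c D.b j k - D.sTerm c j D.b k := by
    have e := hT j k
    simp only [sTerm, D.R_b, s1, sig, D.b_unit, D.S_b_b, D.s2_self, map_add, gSb k,
      D.g_symm (D.S j) (D.R k), D.g_symm (D.S D.b) (D.R k)] at e ⊢
    linear_combination e
  have hlin (s : ℝ) (u v j k : E) : D.s2 (s • u + v) j k
      - (D.sTerm c (s • u + v) j k - D.sTerm c j (s • u + v) k) =
      s * (D.s2 u j k - (D.sTerm c u j k - D.sTerm c j u k))
        + (D.s2 v j k - (D.sTerm c v j k - D.sTerm c j v k)) := by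
    simp only [sTerm, s1, sig, map_add, map_smul, LinearMap.add_apply, LinearMap.smul_apply,
      smul_eq_mul]
    ring
  have hperp (i j k : E) (hi : D.g D.b i = 0) (hj : D.g D.b j = 0) :
      D.s2 i j k = D.sTerm c i j k - D.sTerm c j i k := by
    have e := h i j hi hj k
    simp only [sDef, sTerm, hi, hj] at e ⊢
    linear_combination e
  have hhalf (i j k : E) (hi : D.g D.b i = 0) :
      D.s2 j i k = D.sTerm c j i k - D.sTerm c i j k := by
    have e := hlin (D.g D.b j) D.b (D.perp j) i k
    rw [D.perp_add] at e
    linear_combination e + D.g D.b j * hb i k + hperp _ i k (D.b_perp j) hi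
  intro i j k
  have e := hlin (D.g D.b i) D.b (D.perp i) j k
  rw [D.perp_add] at e
  have e2 := hhalf (D.perp i) j k (D.b_perp i)
  linear_combination e + D.g D.b i * hb j k - e2 + D.s2_skew (D.perp i) j k

/-- After `r2_b` the symmetric part of the equation for q_{ik} is an identity, so only the skew part
has content. On the complement of b it is the vanishing of `sDef` in the direction b combined with
the closedness of s; the components along b hold by `bbr_eq`. -/
lemma QEq_of_sDef (h : ∀ i j, D.g D.b i = 0 → D.g D.b j = 0 → ∀ k, D.sDef i j k = 0) : D.QEq := by
  have key (i k : E) (hi : D.g D.b i = 0) (hk : D.g D.b k = 0) :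
      D.s1 i k + D.g (D.R i) (D.S k) = D.s1 k i + D.g (D.R k) (D.S i) := by
    have e := h i k hi hk D.b
    have e' := D.s2_cyclic i k D.b
    have hRb (x : E) : D.g (D.R x) D.b = -D.sig x := by
      rw [D.R_symm, D.R_b, D.g_symm, D.S_skew, D.g_symm, sig]
    simp only [sDef, D.g_symm i D.b, D.g_symm k D.b, hi, hk, hRb] at e
    simp only [s1, map_add, D.g_symm (D.S i) (D.R k), D.g_symm (D.S k) (D.R i),
      D.g_symm (D.S k) (D.S i)]
    linear_combination e' - e - D.s2_skew k D.b i
  intro i k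
  have e := key _ _ (D.b_perp i) (D.b_perp k)
  have hlin (i k : E) : D.s1 (D.perp i) (D.perp k) = D.s1 i k - D.g D.b i * D.s1 D.b k
      - D.g D.b k * D.s1 i D.b + D.g D.b i * D.g D.b k * D.s1 D.b D.b := by
    simp only [s1, perp, map_sub, map_smul, map_add, LinearMap.sub_apply, LinearMap.smul_apply,
      smul_eq_mul]
    ring
  rw [hlin, hlin] at e
  simp only [D.r2_b, D.bbr_eq]
  change _ = _ - 1 / 2 * (-(D.s1 k i) - _ + (-(D.s1 i k) - _)) - _ - _
  simp only [perp, map_sub, map_smul, LinearMap.sub_apply, LinearMap.smul_apply, smul_eq_mul,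
    map_add, D.R_b] at e ⊢
  simp only [D.g_symm (D.S D.b) (D.S _), D.g_symm (D.R k) (D.R i)] at e ⊢
  linear_combination 1 / 2 * e

/-- If the Weyl-type tensor vanishes, then the equations hold. -/
theorem WeylVanishes.equations {D : PointData E} (h : D.WeylVanishes) {c : ℝ} (hT : D.TEq c) :
    D.SEq c ∧ D.QEq ∧ ∃ μ, D.CEq c μ := by
  have hs : ∀ i j, D.g D.b i = 0 → D.g D.b j = 0 → ∀ k, D.sDef i j k = 0 :=
    fun i j hi hj => h.sDef_eq_zero hT hi hj
  refine ⟨D.SEq_of_sDef hT hs, D.QEq_of_sDef hs, ?_⟩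
  -- The constant μ is the proportionality factor of this form, computed with μ = 0 in the
  -- deviation.
  obtain ⟨μ, hμ⟩ := D.exists_eq_mul_g (fun v w => D.curvDef c 0 v D.b w D.b)
    (fun u v => D.curvDef_pair c 0 u D.b v D.b) (fun s u v w => D.curvDef_lin c 0 s u v _ w _)
    (fun v w hv hw hvw => by
      have e := (h.coeffs c 0 hv hw (z := 0) (by simp) hvw).2.2.2.2
      rw [D.tDef_of_TEq hT hv hw] at e
      simpa using e)
  refine ⟨μ, fun v y w => ?_⟩
  rw [← sub_eq_zero, ← D.curvDef_diag]
  refine D.curvDef_eq_zero c μ ?_ ?_ ?_ v y w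
  · intro v w z hv hw hz hvw
    have e := (h.coeffs c μ hv hw hz hvw).2.2.1
    simpa [hs w z hw hz, hs v z hv hz, D.tDef_of_TEq hT hv hw, D.tDef_of_TEq hT hw hz,
      D.tDef_of_TEq hT hv hz] using e
  · intro v w z hv hw hz hvw
    have e := (h.coeffs c μ hv hw hz hvw).2.2.2.1
    simpa [hs v w hv hw, hs v z hv hz] using e
  · intro v hv
    have e := hμ v v hv hv
    -- Replacing 0 by μ changes B(b,b) by −μ, and hence the deviation on (v, b, v, b) by −μ g(v,v).
    simp only [curvDef, B, BTerm, D.b_unit, D.g_symm v D.b, hv] at e ⊢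
    linear_combination e

end PointData


/-! ### Sprays, horizontal constancy and the Riemann curvature in coordinate-free form. -/

section SprayCalculus

open Topology

variable {n : ℕ}

lemma sum_smul_single (v : Coord n) : ∑ j, v j • (EuclideanSpace.single j (1 : ℝ)) = v := by
  ext i
  simp [Finset.sum_apply, Pi.single_apply]

lemma sum_mul_pd (f : Coord n → ℝ) (v x : Coord n) : ∑ j, pd f j x * v j = fderiv ℝ f x v := by
  conv_rhs => rw [← sum_smul_single v]
  simp [pd, mul_comm]

lemma pd_congr {f f' : Coord n → ℝ} {x : Coord n} (h : f =ᶠ[𝓝 x] f') (i : Fin n) :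
    pd f i x = pd f' i x := by
  rw [pd, pd, h.fderiv_eq]

lemma fderiv_fst_eq {V : Type*} [NormedAddCommGroup V] [NormedSpace ℝ V] {f : Coord n × Coord n → V}
    {x y : Coord n} (h : DifferentiableAt ℝ f (x, y)) (v : Coord n) :
    fderiv ℝ (fun z => f (z, y)) x v = fderiv ℝ f (x, y) (v, 0) := by
  have h1 : HasFDerivAt (fun z : Coord n => (z, y))
      ((ContinuousLinearMap.id ℝ (Coord n)).prod (0 : Coord n →L[ℝ] Coord n)) x :=
    (hasFDerivAt_id x).prodMk (hasFDerivAt_const y x)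
  have h2 := HasFDerivAt.comp x (g := f) h.hasFDerivAt h1
  have h3 : fderiv ℝ (fun z => f (z, y)) x = _ := h2.fderiv
  rw [h3]
  simp

lemma fderiv_snd_eq {V : Type*} [NormedAddCommGroup V] [NormedSpace ℝ V] {f : Coord n × Coord n → V}
    {x y : Coord n} (h : DifferentiableAt ℝ f (x, y)) (v : Coord n) :
    fderiv ℝ (fun w => f (x, w)) y v = fderiv ℝ f (x, y) (0, v) := by
  have h1 : HasFDerivAt (fun w : Coord n => (x, w))
      ((0 : Coord n →L[ℝ] Coord n).prod (ContinuousLinearMap.id ℝ (Coord n))) y :=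
    (hasFDerivAt_const x y).prodMk (hasFDerivAt_id y)
  have h2 := HasFDerivAt.comp y (g := f) h.hasFDerivAt h1
  have h3 : fderiv ℝ (fun w => f (x, w)) y = _ := h2.fderiv
  rw [h3]
  simp

/-- Smoothness at all points of a set. -/
def Sm {V : Type*} [NormedAddCommGroup V] [NormedSpace ℝ V] (W : Set (Coord n × Coord n))
    (f : Coord n × Coord n → V) : Prop := ∀ X ∈ W, ContDiffAt ℝ ∞ f X

variable {V : Type*} [NormedAddCommGroup V] [NormedSpace ℝ V] {W : Set (Coord n × Coord n)}
  {f : Coord n × Coord n → V} {X : Coord n × Coord n}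

lemma Sm.differentiableAt (hf : Sm W f) (hX : X ∈ W) : DifferentiableAt ℝ f X :=
  (hf X hX).differentiableAt (by simp)

lemma Sm.smooth_fderiv (hf : Sm W f) : Sm W (fderiv ℝ f) := fun X hX =>
  (hf X hX).fderiv_right (m := ∞) (by simp)

lemma Sm.smooth_fderiv_apply (hf : Sm W f) (v : Coord n × Coord n) : Sm W (fun X => fderiv ℝ f X v) :=
  fun X hX => (hf.smooth_fderiv X hX).clm_apply contDiffAt_const

lemma Sm.symm (hf : Sm W f) (hX : X ∈ W) (u v : Coord n × Coord n) :
    fderiv ℝ (fderiv ℝ f) X u v = fderiv ℝ (fderiv ℝ f) X v u :=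
  ((hf X hX).isSymmSndFDerivAt (by
    simp only [minSmoothness_of_isRCLikeNormedField]
    exact WithTop.coe_le_coe.2 (le_top : (2 : ℕ∞) ≤ ⊤))) u v

lemma Sm.hasFDerivAt_fderiv_apply (hf : Sm W f) (hX : X ∈ W) (v : Coord n × Coord n) :
    fderiv ℝ (fun Z => fderiv ℝ f Z v) X = (fderiv ℝ (fderiv ℝ f) X).flip v := by
  have h := (hf.smooth_fderiv.differentiableAt hX).hasFDerivAt.clm_apply (hasFDerivAt_const v X)
  rw [h.fderiv]
  ext u <;> simp

lemma pd_pd_fst_snd {f : Coord n × Coord n → ℝ} (hW : IsOpen W) (hf : Sm W f) {x y : Coord n}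
    (h : (x, y) ∈ W) (j k : Fin n) :
    pd (fun w => pd (fun z => f (z, w)) j x) k y =
      fderiv ℝ (fderiv ℝ f) (x, y) (0, EuclideanSpace.single k 1)
        (EuclideanSpace.single j 1, 0) := by
  have h1 : (fun w => pd (fun z => f (z, w)) j x) =ᶠ[𝓝 y]
      fun w => (fun Z => fderiv ℝ f Z (EuclideanSpace.single j 1, 0)) (x, w) := by
    have : {w | (x, w) ∈ W} ∈ 𝓝 y := (hW.preimage (by fun_prop)).mem_nhds h
    filter_upwards [this] with w hw
    exact fderiv_fst_eq (hf.differentiableAt hw) _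
  rw [pd_congr h1, pd, fderiv_snd_eq (f := fun Z => fderiv ℝ f Z _)
    ((hf.smooth_fderiv_apply _).differentiableAt h),
    hf.hasFDerivAt_fderiv_apply h]
  rfl

lemma pd_pd_snd_snd {f : Coord n × Coord n → ℝ} (hW : IsOpen W) (hf : Sm W f) {x y : Coord n}
    (h : (x, y) ∈ W) (j k : Fin n) :
    pd (fun w => pd (fun w' => f (x, w')) j w) k y =
      fderiv ℝ (fderiv ℝ f) (x, y) (0, EuclideanSpace.single k 1)
        (0, EuclideanSpace.single j 1) := by
  have h1 : (fun w => pd (fun w' => f (x, w')) j w) =ᶠ[𝓝 y]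
      fun w => (fun Z => fderiv ℝ f Z (0, EuclideanSpace.single j 1)) (x, w) := by
    have : {w | (x, w) ∈ W} ∈ 𝓝 y := (hW.preimage (by fun_prop)).mem_nhds h
    filter_upwards [this] with w hw
    exact fderiv_snd_eq (hf.differentiableAt hw) _
  rw [pd_congr h1, pd, fderiv_snd_eq (f := fun Z => fderiv ℝ f Z _)
    ((hf.smooth_fderiv_apply _).differentiableAt h),
    hf.hasFDerivAt_fderiv_apply h]
  rfl

/-- The vector `(y, -2 G)` of the spray with coefficients `G`. -/
def sprayVec (G : Coord n × Coord n → Coord n) (X : Coord n × Coord n) : Coord n × Coord n :=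
  (X.2, -(2 : ℝ) • G X)

/-- The Riemann curvature of the spray with coefficients `G` as an endomorphism. -/
def curvVec (G : Coord n × Coord n → Coord n) (X : Coord n × Coord n) (w : Coord n) : Coord n :=
  (2 : ℝ) • fderiv ℝ G X (w, 0) - fderiv ℝ (fderiv ℝ G) X (0, w) (sprayVec G X)
    - fderiv ℝ G X (0, fderiv ℝ G X (0, w))

variable {G : Coord n × Coord n → Coord n}

lemma Sm.coord (hG : Sm W G) (i : Fin n) : Sm W (fun X => G X i) := fun X hX =>
  (EuclideanSpace.proj (𝕜 := ℝ) i).contDiff.contDiffAt.comp X (hG X hX)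

lemma Sm.fderiv_coord (hG : Sm W G) (hX : X ∈ W) (i : Fin n) (v : Coord n × Coord n) :
    fderiv ℝ (fun Z => G Z i) X v = fderiv ℝ G X v i := by
  have h := (EuclideanSpace.proj i : Coord n →L[ℝ] ℝ).hasFDerivAt.comp X
    (hG.differentiableAt hX).hasFDerivAt
  have h' : fderiv ℝ (fun Z => G Z i) X = _ := h.fderiv
  rw [h']
  rfl

lemma Sm.fderiv_fderiv_coord (hW : IsOpen W) (hG : Sm W G) (hX : X ∈ W) (i : Fin n)
    (u v : Coord n × Coord n) :
    fderiv ℝ (fderiv ℝ (fun Z => G Z i)) X u v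
      = fderiv ℝ (fderiv ℝ G) X u v i := by
  have h1 : (fun Z => fderiv ℝ (fun Z => G Z i) Z v) =ᶠ[𝓝 X]
      fun Z => (fun Z => fderiv ℝ G Z v) Z i := by
    filter_upwards [hW.mem_nhds hX] with Z hZ
    exact hG.fderiv_coord hZ i v
  have h2 := h1.fderiv_eq (𝕜 := ℝ)
  rw [(hG.coord i).hasFDerivAt_fderiv_apply hX] at h2
  have h3 : fderiv ℝ (fderiv ℝ (fun Z => G Z i)) X u v
      = fderiv ℝ (fun Z => (fun Z => fderiv ℝ G Z v) Z i) X u :=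
    congrArg (fun L : Coord n × Coord n →L[ℝ] ℝ => L u) h2
  rw [h3, (hG.smooth_fderiv_apply v).fderiv_coord hX, hG.hasFDerivAt_fderiv_apply hX]
  rfl

lemma prod_sum_fst (v : Coord n) :
    ((v, 0) : Coord n × Coord n) = ∑ j, v j • (EuclideanSpace.single j (1 : ℝ), (0 : Coord n)) := by
  rw [Prod.ext_iff]
  simp [Prod.fst_sum, Prod.snd_sum, sum_smul_single]

lemma prod_sum_snd (v : Coord n) :
    ((0, v) : Coord n × Coord n) = ∑ j, v j • ((0 : Coord n), EuclideanSpace.single j (1 : ℝ)) := by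
  rw [Prod.ext_iff]
  simp [Prod.fst_sum, Prod.snd_sum, sum_smul_single]

/-- The two sums with second derivatives are the single contraction of D²G with (0, w) and the spray
vector (y, −2G). Equality of the spray with G is needed near the point because it is differentiated
twice; this is why W is open. -/
theorem riemann_eq_curvVec {F : Coord n → Coord n → ℝ} (hW : IsOpen W) (hG : Sm W G)
    (hF : ∀ z y, (z, y) ∈ W → ∀ i, spray F i z y = G (z, y) i) {x y : Coord n} (h : (x, y) ∈ W)
    (i k : Fin n) : riemann F i k x y = curvVec G (x, y) (EuclideanSpace.single k 1) i := by
  have hy : ∀ᶠ w in 𝓝 y, (x, w) ∈ W := (hW.preimage (by fun_prop)).mem_nhds h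
  have hx : ∀ᶠ z in 𝓝 x, (z, y) ∈ W :=
    (hW.preimage (f := fun z : Coord n => (z, y)) (by fun_prop)).mem_nhds h
  have e1 : pd (fun z => spray F i z y) k x = fderiv ℝ G (x, y) (EuclideanSpace.single k 1, 0) i := by
    rw [pd_congr (f' := fun z => (fun X => G X i) (z, y)) (hx.mono fun z hz => hF z y hz i), pd,
      fderiv_fst_eq ((hG.coord i).differentiableAt h), hG.fderiv_coord h]
  have e2 (i j) : pd (fun w => spray F i x w) j y =
      fderiv ℝ G (x, y) (0, EuclideanSpace.single j 1) i := by
    rw [pd_congr (f' := fun w => (fun X => G X i) (x, w)) (hy.mono fun w hw => hF x w hw i), pd,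
      fderiv_snd_eq ((hG.coord i).differentiableAt h), hG.fderiv_coord h]
  have e3 (j) : pd (fun w => pd (fun z => spray F i z w) j x) k y =
      fderiv ℝ (fderiv ℝ G) (x, y) (0, EuclideanSpace.single k 1)
        (EuclideanSpace.single j 1, 0) i := by
    rw [pd_congr (f' := fun w => pd (fun z => (fun X => G X i) (z, w)) j x), 
      pd_pd_fst_snd hW (hG.coord i) h, hG.fderiv_fderiv_coord hW h]
    filter_upwards [hy] with w hw
    refine pd_congr ?_ j
    have : ∀ᶠ z in 𝓝 x, (z, w) ∈ W :=
      (hW.preimage (f := fun z : Coord n => (z, w)) (by fun_prop)).mem_nhds hw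
    exact this.mono fun z hz => hF z w hz i
  have e4 (j) : pd (fun w => pd (fun w' => spray F i x w') j w) k y =
      fderiv ℝ (fderiv ℝ G) (x, y) (0, EuclideanSpace.single k 1)
        (0, EuclideanSpace.single j 1) i := by
    rw [pd_congr (f' := fun w => pd (fun w' => (fun X => G X i) (x, w')) j w), 
      pd_pd_snd_snd hW (hG.coord i) h, hG.fderiv_fderiv_coord hW h]
    filter_upwards [hy.eventually_nhds] with w hw
    exact pd_congr (hw.mono fun w' hw' => hF x w' hw' i) j
  have hsv : sprayVec G (x, y) = (y, 0) + (0, -(2 : ℝ) • G (x, y)) := by simp [sprayVec]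
  rw [riemann, e1]
  simp only [e2, e3, e4, hF x y h]
  rw [curvVec, hsv, map_add, prod_sum_fst y, prod_sum_snd (-(2 : ℝ) • G (x, y)),
    prod_sum_snd (fderiv ℝ G (x, y) (0, EuclideanSpace.single k 1))]
  simp only [map_sum, map_smul, PiLp.sub_apply, PiLp.add_apply, PiLp.smul_apply, smul_eq_mul,
    WithLp.ofLp_sum, Finset.sum_apply]
  simp only [mul_comm (fderiv ℝ G (x, y) (0, EuclideanSpace.single _ 1) i), neg_mul,
    Finset.sum_neg_distrib, mul_assoc, ← Finset.mul_sum]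
  ring

lemma fundTensor_eq {F : Coord n → Coord n → ℝ} {L : Coord n × Coord n → ℝ} (hW : IsOpen W)
    (hL : Sm W L) {x y : Coord n} (h : (x, y) ∈ W) (hF : ∀ z y, (z, y) ∈ W → F z y ^ 2 = L (z, y))
    (j k : Fin n) : fundTensor F x y j k = 1 / 2 *
      fderiv ℝ (fderiv ℝ L) (x, y) (0, EuclideanSpace.single k 1) (0, EuclideanSpace.single j 1) := by
  have hy : ∀ᶠ w in 𝓝 y, (x, w) ∈ W := (hW.preimage (by fun_prop)).mem_nhds h
  rw [fundTensor, Matrix.of_apply, pd_congr (f' := fun w => pd (fun w' => L (x, w')) j w),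
    pd_pd_snd_snd hW hL h]
  filter_upwards [hy.eventually_nhds] with w hw
  exact pd_congr (hw.mono fun w' hw' => hF x w' hw') j

/-- The Euler–Lagrange equation `hv` says that the bracket in the definition of the spray is 4
g_{il} vⁱ. Nondegeneracy of g_{il} then gives v, so a candidate can be verified without computing
the inverse matrix. -/
theorem spray_eq {F : Coord n → Coord n → ℝ} {L : Coord n × Coord n → ℝ} (hW : IsOpen W)
    (hL : Sm W L) {x y : Coord n} (h : (x, y) ∈ W) (hF : ∀ z y, (z, y) ∈ W → F z y ^ 2 = L (z, y))
    (v : Coord n) (hdet : IsUnit (fundTensor F x y).det)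
    (hv : ∀ w, fderiv ℝ (fderiv ℝ L) (x, y) (0, w) (y, -(2 : ℝ) • v) = fderiv ℝ L (x, y) (w, 0))
    (i : Fin n) : spray F i x y = v i := by
  have hy : ∀ᶠ w in 𝓝 y, (x, w) ∈ W := (hW.preimage (by fun_prop)).mem_nhds h
  have hx : ∀ w, (x, w) ∈ W → ∀ᶠ z in 𝓝 x, (z, w) ∈ W := fun w hw =>
    (hW.preimage (f := fun z : Coord n => (z, w)) (by fun_prop)).mem_nhds hw
  have e1 (l) : pd (fun z => F z y ^ 2) l x = fderiv ℝ L (x, y) (EuclideanSpace.single l 1, 0) := by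
    rw [pd_congr (f' := fun z => L (z, y)) ((hx y h).mono fun z hz => hF z y hz), pd,
      fderiv_fst_eq (hL.differentiableAt h)]
  have e2 (k l) : pd (fun w => pd (fun z => F z w ^ 2) k x) l y =
      fderiv ℝ (fderiv ℝ L) (x, y) (0, EuclideanSpace.single l 1) (EuclideanSpace.single k 1, 0) := by
    rw [pd_congr (f' := fun w => pd (fun z => L (z, w)) k x), pd_pd_fst_snd hW hL h]
    filter_upwards [hy] with w hw
    exact pd_congr ((hx w hw).mono fun z hz => hF z w hz) k
  have e3 := fundTensor_eq hW hL h hF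
  have e4 (l) : (∑ k, pd (fun w => pd (fun z => F z w ^ 2) k x) l y * y k) - pd (fun z => F z y ^ 2) l x
      = 4 * (Matrix.mulVec (fundTensor F x y) v) l := by
    have hs : ((y, -(2 : ℝ) • v) : Coord n × Coord n) = (y, 0) - (2 : ℝ) • (0, v) := by simp
    have h1 := hv (EuclideanSpace.single l 1)
    rw [hs, map_sub, map_smul, prod_sum_fst y, prod_sum_snd v, map_sum, map_sum] at h1
    simp only [e1, e2, Matrix.mulVec, dotProduct, e3]
    rw [← h1]
    simp only [map_smul, smul_eq_mul, Finset.mul_sum]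
    rw [sub_sub_eq_add_sub, add_sub_right_comm]
    simp only [mul_comm (y.ofLp _)]
    rw [sub_self, zero_add]
    refine Finset.sum_congr rfl fun j _ => ?_
    rw [hL.symm h]
    ring
  rw [spray]
  simp only [e4]
  have h2 : ∑ l, (fundTensor F x y)⁻¹ i l * (4 * (Matrix.mulVec (fundTensor F x y) v) l)
      = 4 * Matrix.mulVec (fundTensor F x y)⁻¹ (Matrix.mulVec (fundTensor F x y) v) i := by
    conv_rhs => rw [Matrix.mulVec, dotProduct, Finset.mul_sum]
    exact Finset.sum_congr rfl fun l _ => by ring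
  rw [h2, Matrix.mulVec_mulVec, Matrix.nonsing_inv_mul _ hdet, Matrix.one_mulVec]
  ring

/-- The spray is homogeneous of degree two. -/
def Homog (W : Set (Coord n × Coord n)) (G : Coord n × Coord n → Coord n) : Prop :=
  ∀ X ∈ W, fderiv ℝ G X (0, X.2) = (2 : ℝ) • G X

/-- The function `f` is constant along the horizontal directions of the spray. -/
def HorConst (W : Set (Coord n × Coord n)) (G : Coord n × Coord n → Coord n)
    (f : Coord n × Coord n → ℝ) : Prop :=
  ∀ X ∈ W, ∀ w, fderiv ℝ f X (w, 0) = fderiv ℝ f X (0, fderiv ℝ G X (0, w))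

lemma Sm.hasFDerivAt_sprayVec (hG : Sm W G) (hX : X ∈ W) :
    HasFDerivAt (sprayVec G) ((ContinuousLinearMap.snd ℝ (Coord n) (Coord n)).prod
      (-(2 : ℝ) • fderiv ℝ G X)) X :=
  hasFDerivAt_snd.prodMk ((hG.differentiableAt hX).hasFDerivAt.const_smul (-(2 : ℝ)))

/-- Differentiating Euler's relation for G along the spray vector expresses the second derivative in
the curvature through first derivatives, and these cancel. -/
theorem curvVec_self (hW : IsOpen W) (hG : Sm W G) (hh : Homog W G) (hX : X ∈ W) :
    curvVec G X X.2 = 0 := by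
  have h1 : (fun Z => fderiv ℝ G Z (0, Z.2)) =ᶠ[𝓝 X] (2 : ℝ) • G := by
    filter_upwards [hW.mem_nhds hX] with Z hZ using hh Z hZ
  have h2 := (hG.smooth_fderiv.differentiableAt hX).hasFDerivAt.clm_apply
    ((hasFDerivAt_const (0 : Coord n) X).prodMk (hasFDerivAt_snd (𝕜 := ℝ) (E := Coord n) (F := Coord n) (p := X)))
  have h3 := congrArg (fun A : Coord n × Coord n →L[ℝ] Coord n => A (sprayVec G X)) (h1.fderiv_eq)
  rw [h2.fderiv, ((hG.differentiableAt hX).hasFDerivAt.const_smul (2 : ℝ)).fderiv] at h3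
  simp only [_root_.add_apply, ContinuousLinearMap.comp_apply,
    ContinuousLinearMap.flip_apply, ContinuousLinearMap.prod_apply, ContinuousLinearMap.coe_snd',
    _root_.zero_apply, _root_.smul_apply] at h3
  rw [curvVec, hG.symm hX, hh X hX]
  have h4 : sprayVec G X = (X.2, 0) - (2 : ℝ) • (0, G X) := by simp [sprayVec]
  have h5 : ((0, (sprayVec G X).2) : Coord n × Coord n) = -(2 : ℝ) • (0, G X) := by simp [sprayVec]
  have h6 : ((0, (2 : ℝ) • G X) : Coord n × Coord n) = (2 : ℝ) • (0, G X) := by simp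
  rw [h5] at h3
  rw [h6]
  have h7 : fderiv ℝ G X (sprayVec G X) = fderiv ℝ G X (X.2, 0) - (2 : ℝ) • fderiv ℝ G X (0, G X) := by
    rw [h4, map_sub, map_smul]
  rw [h7, map_smul] at h3
  rw [map_smul]
  generalize fderiv ℝ (fderiv ℝ G) X (sprayVec G X) (0, X.2) = a at h3 ⊢
  generalize fderiv ℝ G X (X.2, 0) = p at h3 ⊢
  generalize fderiv ℝ G X (0, G X) = q at h3 ⊢
  have h8 : a = (2 : ℝ) • (p - (2 : ℝ) • q) + (2 : ℝ) • q := by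
    rw [← h3]; module
  rw [h8]
  module

variable {φ : Coord n × Coord n → ℝ}

/-- By homogeneity the spray vector is itself the horizontal lift of y. -/
theorem HorConst.fderiv_spray (hh : Homog W G) (hc : HorConst W G φ) (hX : X ∈ W) :
    fderiv ℝ φ X (sprayVec G X) = 0 := by
  have h4 : sprayVec G X = (X.2, 0) - (0, (2 : ℝ) • G X) := by simp [sprayVec]
  rw [h4, map_sub, hc X hX, hh X hX, sub_self]

lemma HorConst.fderiv_sprayVec (hW : IsOpen W) (hG : Sm W G) (hφ : Sm W φ) (hh : Homog W G)
    (hc : HorConst W G φ) (hX : X ∈ W) (u : Coord n × Coord n) :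
    fderiv ℝ (fderiv ℝ φ) X u (sprayVec G X)
      = fderiv ℝ φ X (0, (2 : ℝ) • fderiv ℝ G X u) - fderiv ℝ φ X (u.2, 0) := by
  have h1 : (fun Z => fderiv ℝ φ Z (sprayVec G Z)) =ᶠ[𝓝 X] fun _ => (0 : ℝ) := by
    filter_upwards [hW.mem_nhds hX] with Z hZ using hc.fderiv_spray hh hZ
  have h2 := (hφ.smooth_fderiv.differentiableAt hX).hasFDerivAt.clm_apply (hG.hasFDerivAt_sprayVec hX)
  have h3 := congrArg (fun A : Coord n × Coord n →L[ℝ] ℝ => A u) (h1.fderiv_eq)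
  rw [h2.fderiv] at h3
  simp only [_root_.add_apply, ContinuousLinearMap.comp_apply,
    ContinuousLinearMap.flip_apply, ContinuousLinearMap.prod_apply, ContinuousLinearMap.coe_snd',
    _root_.smul_apply, fderiv_fun_const, Pi.zero_apply,
    _root_.zero_apply] at h3
  have h4 : ((u.2, -(2 : ℝ) • fderiv ℝ G X u) : Coord n × Coord n)
      = (u.2, 0) - (0, (2 : ℝ) • fderiv ℝ G X u) := by simp
  rw [h4, map_sub] at h3
  linarith

/-- This is the Euler–Lagrange equation required by `spray_eq`: it is the vertical derivative of the
vanishing of φ along the spray. -/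
theorem HorConst.fderiv_vertical_sprayVec (hW : IsOpen W) (hG : Sm W G) (hφ : Sm W φ)
    (hh : Homog W G) (hc : HorConst W G φ) (hX : X ∈ W) (w : Coord n) :
    fderiv ℝ (fderiv ℝ φ) X (0, w) (sprayVec G X) = fderiv ℝ φ X (w, 0) := by
  rw [hc.fderiv_sprayVec hW hG hφ hh hX]
  have h6 : ((0, (2 : ℝ) • fderiv ℝ G X (0, w)) : Coord n × Coord n)
    = (2 : ℝ) • (0, fderiv ℝ G X (0, w)) := by simp
  rw [h6, map_smul, ← hc X hX]
  simp only [smul_eq_mul]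
  ring

/-- The curvature measures the vertical part of the bracket of the spray with a horizontal field.
Since φ is killed by both, it is killed by that part. In the proof the horizontal constancy is
differentiated along the spray. -/
theorem HorConst.fderiv_curvVec (hW : IsOpen W) (hG : Sm W G) (hφ : Sm W φ)
    (hh : Homog W G) (hc : HorConst W G φ) (hX : X ∈ W) (w : Coord n) :
    fderiv ℝ φ X (0, curvVec G X w) = 0 := by
  have h1 : (fun Z => fderiv ℝ φ Z (w, 0)) =ᶠ[𝓝 X]
      fun Z => fderiv ℝ φ Z (0, fderiv ℝ G Z (0, w)) := by
    filter_upwards [hW.mem_nhds hX] with Z hZ using hc Z hZ w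
  have h2 := (hφ.smooth_fderiv.differentiableAt hX).hasFDerivAt.clm_apply
    ((hasFDerivAt_const (0 : Coord n) X).prodMk
      ((hG.smooth_fderiv_apply (0, w)).differentiableAt hX).hasFDerivAt)
  have h3 := congrArg (fun A : Coord n × Coord n →L[ℝ] ℝ => A (sprayVec G X)) (h1.fderiv_eq)
  rw [h2.fderiv, hφ.hasFDerivAt_fderiv_apply hX, hG.hasFDerivAt_fderiv_apply hX] at h3
  simp only [_root_.add_apply, ContinuousLinearMap.comp_apply,
    ContinuousLinearMap.flip_apply, ContinuousLinearMap.prod_apply,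
    _root_.zero_apply] at h3
  have a1 := hc.fderiv_sprayVec hW hG hφ hh hX (w, 0)
  have a2 := hc.fderiv_vertical_sprayVec hW hG hφ hh hX (fderiv ℝ G X (0, w))
  rw [hc X hX] at a2
  have h4 : ((0, curvVec G X w) : Coord n × Coord n) = (0, (2 : ℝ) • fderiv ℝ G X (w, 0))
      - (0, fderiv ℝ (fderiv ℝ G) X (0, w) (sprayVec G X))
      - (0, fderiv ℝ G X (0, fderiv ℝ G X (0, w))) := by simp [curvVec]
  rw [h4, map_sub, map_sub]
  rw [hφ.symm hX, hφ.symm hX (sprayVec G X), hG.symm hX] at h3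
  rw [hφ.symm hX] at h3
  simp only [Prod.mk_zero_zero, map_zero, sub_zero] at a1
  linarith [hφ.symm hX (w, 0) (sprayVec G X)]

end SprayCalculus


/-! ### Index expressions as multilinear maps, and their derivatives. -/

section Contractions

open Topology

variable {n : ℕ}

/-- The contraction `T_i vⁱ`. -/
def lin (T : Fin n → ℝ) : Coord n →ₗ[ℝ] ℝ where
  toFun v := ∑ i, T i * v i
  map_add' u v := by simp [mul_add, Finset.sum_add_distrib]
  map_smul' c v := by
    simp only [PiLp.smul_apply, smul_eq_mul, RingHom.id_apply, Finset.mul_sum]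
    exact Finset.sum_congr rfl fun i _ => by ring

lemma lin_add_left (T T' : Fin n → ℝ) (v : Coord n) :
    lin (fun i => T i + T' i) v = lin T v + lin T' v := by
  simp [lin, add_mul, Finset.sum_add_distrib]

lemma lin_smul_left (c : ℝ) (T : Fin n → ℝ) (v : Coord n) :
    lin (fun i => c * T i) v = c * lin T v := by
  simp [lin, mul_assoc, Finset.mul_sum]

/-- The contraction `T_{ij} uⁱ vʲ`. -/
def bil (T : Fin n → Fin n → ℝ) : Coord n →ₗ[ℝ] Coord n →ₗ[ℝ] ℝ where
  toFun u := lin fun j => lin (fun i => T i j) u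
  map_add' u v := by
    refine LinearMap.ext fun w => ?_
    simp only [map_add, LinearMap.add_apply, lin_add_left]
  map_smul' c v := by
    refine LinearMap.ext fun w => ?_
    simp only [map_smul, smul_eq_mul, RingHom.id_apply, LinearMap.smul_apply, lin_smul_left]

lemma bil_add_left (T T' : Fin n → Fin n → ℝ) (u v : Coord n) :
    bil (fun i j => T i j + T' i j) u v = bil T u v + bil T' u v := by
  simp only [bil, LinearMap.coe_mk, AddHom.coe_mk, lin_add_left]

lemma bil_smul_left (c : ℝ) (T : Fin n → Fin n → ℝ) (u v : Coord n) :
    bil (fun i j => c * T i j) u v = c * bil T u v := by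
  simp only [bil, LinearMap.coe_mk, AddHom.coe_mk, lin_smul_left]

/-- The contraction `T_{ijk} uⁱ vʲ wᵏ`. -/
def tri (T : Fin n → Fin n → Fin n → ℝ) : Coord n →ₗ[ℝ] Coord n →ₗ[ℝ] Coord n →ₗ[ℝ] ℝ where
  toFun u := bil fun j k => lin (fun i => T i j k) u
  map_add' u v := by
    refine LinearMap.ext fun w => LinearMap.ext fun z => ?_
    simp only [map_add, LinearMap.add_apply, bil_add_left]
  map_smul' c v := by
    refine LinearMap.ext fun w => LinearMap.ext fun z => ?_
    simp only [map_smul, smul_eq_mul, RingHom.id_apply, LinearMap.smul_apply, bil_smul_left]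

/-- The vector with given components. -/
def vec (f : Fin n → ℝ) : Coord n := WithLp.toLp 2 f

@[simp] lemma vec_apply (f : Fin n → ℝ) (i : Fin n) : vec f i = f i := rfl

/-- The endomorphism `Tⁱ_j vʲ`. -/
def vecLin (T : Fin n → Fin n → ℝ) : Coord n →ₗ[ℝ] Coord n where
  toFun v := vec fun i => lin (T i) v
  map_add' u v := by ext i; simp
  map_smul' c v := by ext i; simp

/-- The bilinear map `Tˡ_{ij} uⁱ vʲ`. -/
def vecBil (T : Fin n → Fin n → Fin n → ℝ) : Coord n →ₗ[ℝ] Coord n →ₗ[ℝ] Coord n :=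
  LinearMap.mk₂ ℝ (fun u v => vec fun l => bil (T l) u v)
    (by intros; ext; simp) (by intros; ext; simp) (by intros; ext; simp) (by intros; ext; simp)

lemma lin_apply (T : Fin n → ℝ) (v : Coord n) : lin T v = ∑ i, T i * v i := rfl

lemma bil_apply (T : Fin n → Fin n → ℝ) (u v : Coord n) :
    bil T u v = ∑ i, ∑ j, T i j * u i * v j := by
  rw [Finset.sum_comm]
  simp only [bil, lin, LinearMap.coe_mk, AddHom.coe_mk, Finset.sum_mul]

lemma tri_apply (T : Fin n → Fin n → Fin n → ℝ) (u v w : Coord n) :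
    tri T u v w = ∑ i, ∑ j, ∑ k, T i j k * u i * v j * w k := by
  have h : tri T u v w = ∑ j, ∑ k, (∑ i, T i j k * u i) * v j * w k := by
    simp only [tri, LinearMap.coe_mk, AddHom.coe_mk, bil_apply]
    rfl
  rw [h]
  simp only [Finset.sum_mul]
  conv_lhs => enter [2, j]; rw [Finset.sum_comm]
  rw [Finset.sum_comm]

@[simp] lemma vecLin_apply (T : Fin n → Fin n → ℝ) (v : Coord n) (i : Fin n) :
    vecLin T v i = lin (T i) v := rfl

@[simp] lemma vecBil_apply (T : Fin n → Fin n → Fin n → ℝ) (u v : Coord n) (l : Fin n) :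
    vecBil T u v l = bil (T l) u v := rfl

@[simp] lemma lin_single (T : Fin n → ℝ) (i : Fin n) :
    lin T (EuclideanSpace.single i 1) = T i := by
  simp [lin_apply]

@[simp] lemma bil_single (T : Fin n → Fin n → ℝ) (i j : Fin n) :
    bil T (EuclideanSpace.single i 1) (EuclideanSpace.single j 1) = T i j := by
  simp [bil_apply]

@[simp] lemma tri_single (T : Fin n → Fin n → Fin n → ℝ) (i j k : Fin n) :
    tri T (EuclideanSpace.single i 1) (EuclideanSpace.single j 1) (EuclideanSpace.single k 1)
      = T i j k := by
  simp [tri_apply]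

lemma lin_hom_ext {V : Type*} [AddCommGroup V] [Module ℝ V] {f f' : Coord n →ₗ[ℝ] V}
    (h : ∀ i, f (EuclideanSpace.single i 1) = f' (EuclideanSpace.single i 1)) : f = f' := by
  ext v
  rw [← sum_smul_single v]
  simp [h]

lemma bil_hom_ext {V : Type*} [AddCommGroup V] [Module ℝ V] {f f' : Coord n →ₗ[ℝ] Coord n →ₗ[ℝ] V}
    (h : ∀ i j, f (EuclideanSpace.single i 1) (EuclideanSpace.single j 1)
      = f' (EuclideanSpace.single i 1) (EuclideanSpace.single j 1)) : f = f' :=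
  lin_hom_ext fun i => lin_hom_ext fun j => h i j

variable {B : Type*} [NormedAddCommGroup B] [NormedSpace ℝ B]

lemma hasFDerivAt_coord {V : B → Coord n} {V' : B →L[ℝ] Coord n} {X : B} (h : HasFDerivAt V V' X)
    (i : Fin n) : HasFDerivAt (fun Z => V Z i) ((EuclideanSpace.proj i : Coord n →L[ℝ] ℝ).comp V') X :=
  (EuclideanSpace.proj i : Coord n →L[ℝ] ℝ).hasFDerivAt.comp X h

lemma differentiableAt_vec {f : Fin n → B → ℝ} {X : B} (h : ∀ i, DifferentiableAt ℝ (f i) X) :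
    DifferentiableAt ℝ (fun Z => vec fun i => f i Z) X :=
  (differentiableAt_euclidean).2 h

lemma fderiv_vec {f : Fin n → B → ℝ} {X : B} (h : ∀ i, DifferentiableAt ℝ (f i) X) (q : B) :
    fderiv ℝ (fun Z => vec fun i => f i Z) X q = vec fun i => fderiv ℝ (f i) X q := by
  ext i
  have h1 := hasFDerivAt_coord (differentiableAt_vec h).hasFDerivAt i
  have h2 := (h i).hasFDerivAt.unique h1
  rw [vec_apply, h2]
  rfl

lemma fderiv_lin {T : Fin n → B → ℝ} {V : B → Coord n} {X : B}
    (hT : ∀ i, DifferentiableAt ℝ (T i) X) (hV : DifferentiableAt ℝ V X) (q : B) :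
    fderiv ℝ (fun Z => lin (fun i => T i Z) (V Z)) X q =
      lin (fun i => fderiv ℝ (T i) X q) (V X) + lin (fun i => T i X) (fderiv ℝ V X q) := by
  have h := HasFDerivAt.fun_sum (u := Finset.univ) fun i _ =>
    (hT i).hasFDerivAt.mul (hasFDerivAt_coord hV.hasFDerivAt i)
  have h' : fderiv ℝ (fun Z => lin (fun i => T i Z) (V Z)) X = _ := h.fderiv
  rw [h']
  simp [lin_apply, Finset.sum_add_distrib, mul_comm, add_comm]

lemma fderiv_bil {T : Fin n → Fin n → B → ℝ} {V W : B → Coord n} {X : B}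
    (hT : ∀ i j, DifferentiableAt ℝ (T i j) X) (hV : DifferentiableAt ℝ V X)
    (hW : DifferentiableAt ℝ W X) (q : B) :
    fderiv ℝ (fun Z => bil (fun i j => T i j Z) (V Z) (W Z)) X q =
      bil (fun i j => fderiv ℝ (T i j) X q) (V X) (W X)
        + bil (fun i j => T i j X) (fderiv ℝ V X q) (W X)
        + bil (fun i j => T i j X) (V X) (fderiv ℝ W X q) := by
  have h1 (j) : DifferentiableAt ℝ (fun Z => lin (fun i => T i j Z) (V Z)) X := by
    have h := HasFDerivAt.fun_sum (u := Finset.univ) fun i _ =>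
      (hT i j).hasFDerivAt.mul (hasFDerivAt_coord hV.hasFDerivAt i)
    exact h.differentiableAt
  have h2 := fderiv_lin h1 hW q
  have h3 (T : Fin n → Fin n → ℝ) (u v : Coord n) : bil T u v = lin (fun j => lin (fun i => T i j) u) v := rfl
  simp only [h3]
  rw [h2]
  simp only [fderiv_lin (fun i => hT i _) hV]
  simp only [lin_apply, add_mul, Finset.sum_add_distrib]

lemma contDiffAt_lin {T : Fin n → B → ℝ} {V : B → Coord n} {X : B}
    (hT : ∀ i, ContDiffAt ℝ ∞ (T i) X) (hV : ContDiffAt ℝ ∞ V X) :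
    ContDiffAt ℝ ∞ (fun Z => lin (fun i => T i Z) (V Z)) X := by
  simp only [lin_apply]
  exact ContDiffAt.sum fun i _ => (hT i).mul (contDiffAt_euclidean.1 hV i)

lemma contDiffAt_bil {T : Fin n → Fin n → B → ℝ} {V W : B → Coord n} {X : B}
    (hT : ∀ i j, ContDiffAt ℝ ∞ (T i j) X) (hV : ContDiffAt ℝ ∞ V X) (hW : ContDiffAt ℝ ∞ W X) :
    ContDiffAt ℝ ∞ (fun Z => bil (fun i j => T i j Z) (V Z) (W Z)) X := by
  simp only [bil_apply]
  exact ContDiffAt.sum fun i _ => ContDiffAt.sum fun j _ =>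
    ((hT i j).mul (contDiffAt_euclidean.1 hV i)).mul (contDiffAt_euclidean.1 hW j)

lemma contDiffAt_vec {f : Fin n → B → ℝ} {X : B} (h : ∀ i, ContDiffAt ℝ ∞ (f i) X) :
    ContDiffAt ℝ ∞ (fun Z => vec fun i => f i Z) X :=
  contDiffAt_euclidean.2 h

end Contractions


/-! ### The Levi-Civita connection in coordinates. -/

section Tensors

open Topology

variable {n : ℕ}

lemma eq_zero_of_single {f : Coord n → ℝ} (ha : ∀ u v, f (u + v) = f u + f v)
    (hs : ∀ (c : ℝ) u, f (c • u) = c * f u)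
    (h0 : ∀ i, f (EuclideanSpace.single i 1) = 0) (u : Coord n) : f u = 0 := by
  let F : Coord n →ₗ[ℝ] ℝ := ⟨⟨f, ha⟩, hs⟩
  have : F = 0 := lin_hom_ext fun i => h0 i
  exact LinearMap.congr_fun this u

lemma lin_fderiv {T : Fin n → Coord n → ℝ} (x p u : Coord n) :
    lin (fun i => fderiv ℝ (T i) x p) u = bil (fun i k => pd (T i) k x) u p := by
  simp only [lin_apply, bil_apply, ← sum_mul_pd, Finset.sum_mul]
  exact Finset.sum_congr rfl fun i _ => Finset.sum_congr rfl fun j _ => by ring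

lemma bil_fderiv {T : Fin n → Fin n → Coord n → ℝ} (x p u v : Coord n) :
    bil (fun i j => fderiv ℝ (T i j) x p) u v = tri (fun i j k => pd (T i j) k x) u v p := by
  simp only [tri_apply, bil_apply, ← sum_mul_pd, Finset.sum_mul]
  exact Finset.sum_congr rfl fun i _ => Finset.sum_congr rfl fun j _ =>
    Finset.sum_congr rfl fun k _ => by ring

variable (a : Coord n → Matrix (Fin n) (Fin n) ℝ) (b : Fin n → Coord n → ℝ)

/-- The metric as a bilinear form. -/
def met (z : Coord n) : Coord n →ₗ[ℝ] Coord n →ₗ[ℝ] ℝ := bil fun i j => a z i j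

/-- The Christoffel symbols as a bilinear map. -/
def Gam (z : Coord n) : Coord n →ₗ[ℝ] Coord n →ₗ[ℝ] Coord n :=
  vecBil fun l i j => christoffel a l i j z

/-- The derivative of the Christoffel symbols in the direction `p`. -/
def dGam (z p : Coord n) : Coord n →ₗ[ℝ] Coord n →ₗ[ℝ] Coord n :=
  vecBil fun l i j => fderiv ℝ (christoffel a l i j) z p

/-- The vector dual to the one-form. -/
def bv (z : Coord n) : Coord n := vec fun i => bUp a b i z

/-- The endomorphism `sⁱ_j`. -/
def Sop (z : Coord n) : Coord n →ₗ[ℝ] Coord n := vecLin fun i j => sUp a b i j z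

/-- The endomorphism `rⁱ_j`. -/
def Rop (z : Coord n) : Coord n →ₗ[ℝ] Coord n := vecLin fun i j => rUp a b i j z

/-- A smooth Riemannian metric and a smooth one-form of unit length on an open set of the coordinate
space. -/
structure LocalData (U : Set (Coord n)) : Prop where
  isOpen : IsOpen U
  a_smooth : ∀ z ∈ U, ∀ i j, ContDiffAt ℝ ∞ (fun z => a z i j) z
  b_smooth : ∀ z ∈ U, ∀ i, ContDiffAt ℝ ∞ (b i) z
  posDef : ∀ z ∈ U, (a z).PosDef
  unit : ∀ z ∈ U, ∑ i, bUp a b i z * b i z = 1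

variable {a b}

/-- Lowering an index undoes raising it. Every endomorphism below with a raised index is handled
through this contraction, so the inverse matrix is never differentiated explicitly. -/
lemma bil_inv {A : Matrix (Fin n) (Fin n) ℝ} (hA : IsUnit A.det) (c : Fin n → ℝ) (u : Coord n) :
    bil (fun i j => A i j) u (vec fun i => ∑ j, A⁻¹ i j * c j) = lin c u := by
  have h : A.mulVec (A⁻¹.mulVec c) = c := by
    rw [Matrix.mulVec_mulVec, Matrix.mul_nonsing_inv _ hA, Matrix.one_mulVec]
  rw [bil_apply, lin_apply]
  refine Finset.sum_congr rfl fun i _ => ?_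
  conv_rhs => rw [← h]
  simp only [Matrix.mulVec, dotProduct, vec_apply, Finset.sum_mul]
  exact Finset.sum_congr rfl fun j _ => by ring

lemma contDiffAt_det {m : ℕ} {A : Coord n → Matrix (Fin m) (Fin m) ℝ} {z : Coord n}
    (h : ∀ i j, ContDiffAt ℝ ∞ (fun z => A z i j) z) : ContDiffAt ℝ ∞ (fun z => (A z).det) z := by
  simp only [Matrix.det_apply]
  refine ContDiffAt.sum fun σ _ => ContDiffAt.const_smul _ ?_
  exact contDiffAt_prod fun i _ => h _ _

lemma contDiffAt_inv {A : Coord n → Matrix (Fin n) (Fin n) ℝ} {z : Coord n}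
    (h : ∀ i j, ContDiffAt ℝ ∞ (fun z => A z i j) z) (hd : (A z).det ≠ 0) (i j : Fin n) :
    ContDiffAt ℝ ∞ (fun z => (A z)⁻¹ i j) z := by
  simp only [Matrix.inv_def, Matrix.smul_apply, smul_eq_mul, Ring.inverse_eq_inv',
    Matrix.adjugate_apply]
  refine ((contDiffAt_det h).inv hd).mul (contDiffAt_det fun k l => ?_)
  by_cases hk : k = j
  · subst hk
    simp only [Matrix.updateRow_self]
    exact contDiffAt_const
  · simp only [Matrix.updateRow_ne hk]
    exact h k l

lemma contDiffAt_pd {f : Coord n → ℝ} {z : Coord n} (h : ContDiffAt ℝ ∞ f z) (i : Fin n) :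
    ContDiffAt ℝ ∞ (pd f i) z :=
  (h.fderiv_right (m := ∞) (by simp)).clm_apply contDiffAt_const

namespace LocalData

variable {U : Set (Coord n)} (h : LocalData a b U) {z : Coord n} (hz : z ∈ U)

include h hz

lemma a_symm (i j : Fin n) : a z i j = a z j i := by
  simpa using (h.posDef z hz).isHermitian.apply j i

lemma isUnit_det : IsUnit (a z).det := (h.posDef z hz).det_pos.ne'.isUnit

lemma inv_smooth (i j : Fin n) : ContDiffAt ℝ ∞ (fun z => (a z)⁻¹ i j) z :=
  contDiffAt_inv (h.a_smooth z hz) (h.posDef z hz).det_pos.ne' i j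

lemma christoffel_smooth (l i j : Fin n) : ContDiffAt ℝ ∞ (christoffel a l i j) z := by
  refine contDiffAt_const.mul (ContDiffAt.sum fun m _ => (h.inv_smooth hz l m).mul ?_)
  exact ((contDiffAt_pd (h.a_smooth z hz m j) i).add (contDiffAt_pd (h.a_smooth z hz m i) j)).sub
    (contDiffAt_pd (h.a_smooth z hz i j) m)

lemma cov1_smooth {T : Fin n → Coord n → ℝ} (hT : ∀ i, ContDiffAt ℝ ∞ (T i) z) (i k : Fin n) :
    ContDiffAt ℝ ∞ (cov1 a T i k) z :=
  (contDiffAt_pd (hT i) k).sub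
    (ContDiffAt.sum fun l _ => (h.christoffel_smooth hz l i k).mul (hT l))

lemma r_smooth (i j : Fin n) : ContDiffAt ℝ ∞ (r a b i j) z :=
  contDiffAt_const.mul ((h.cov1_smooth hz (h.b_smooth z hz) i j).add
    (h.cov1_smooth hz (h.b_smooth z hz) j i))

lemma s_smooth (i j : Fin n) : ContDiffAt ℝ ∞ (s a b i j) z :=
  contDiffAt_const.mul ((h.cov1_smooth hz (h.b_smooth z hz) i j).sub
    (h.cov1_smooth hz (h.b_smooth z hz) j i))

lemma bUp_smooth (i : Fin n) : ContDiffAt ℝ ∞ (bUp a b i) z :=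
  ContDiffAt.sum fun j _ => (h.inv_smooth hz i j).mul (h.b_smooth z hz j)

lemma sUp_smooth (i j : Fin n) : ContDiffAt ℝ ∞ (sUp a b i j) z :=
  ContDiffAt.sum fun k _ => (h.inv_smooth hz i k).mul (h.s_smooth hz k j)

lemma sVec_smooth (j : Fin n) : ContDiffAt ℝ ∞ (sVec a b j) z :=
  ContDiffAt.sum fun i _ => (h.bUp_smooth hz i).mul (h.s_smooth hz i j)

lemma met_symm (u v : Coord n) : met a z u v = met a z v u := by
  simp only [met, bil_apply]
  rw [Finset.sum_comm]
  exact Finset.sum_congr rfl fun i _ => Finset.sum_congr rfl fun j _ => by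
    rw [h.a_symm hz j i]; ring

lemma met_pos (v : Coord n) (hv : v ≠ 0) : 0 < met a z v v := by
  have h1 := (h.posDef z hz).dotProduct_mulVec_pos (x := v.ofLp) (by simpa using hv)
  have h2 : met a z v v = star v.ofLp ⬝ᵥ (a z).mulVec v.ofLp := by
    simp only [met, bil_apply, Matrix.mulVec, dotProduct, Finset.mul_sum, star_trivial]
    exact Finset.sum_congr rfl fun i _ => Finset.sum_congr rfl fun j _ => by ring
  rwa [h2]

lemma met_ext {u v : Coord n} (huv : ∀ w, met a z w u = met a z w v) : u = v := by
  by_contra hne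
  have h1 := h.met_pos hz (u - v) (sub_ne_zero.2 hne)
  rw [map_sub, huv, sub_self] at h1
  exact h1.false

lemma met_bv (u : Coord n) : met a z u (bv a b z) = lin (fun i => b i z) u :=
  bil_inv (h.isUnit_det hz) _ u

lemma met_Sop (u v : Coord n) : met a z u (Sop a b z v) = bil (fun i j => s a b i j z) u v := by
  have h1 : Sop a b z v = vec fun i => ∑ j, (a z)⁻¹ i j * lin (fun k => s a b j k z) v := by
    ext i
    simp only [Sop, vecLin_apply, vec_apply, lin_apply, sUp, Finset.sum_mul, Finset.mul_sum]
    rw [Finset.sum_comm]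
    exact Finset.sum_congr rfl fun i _ => Finset.sum_congr rfl fun j _ => by ring
  rw [h1, met, bil_inv (h.isUnit_det hz), lin_apply, bil_apply]
  simp only [lin_apply, Finset.sum_mul]
  exact Finset.sum_congr rfl fun i _ => Finset.sum_congr rfl fun j _ => by ring

lemma met_Rop (u v : Coord n) : met a z u (Rop a b z v) = bil (fun i j => r a b i j z) u v := by
  have h1 : Rop a b z v = vec fun i => ∑ j, (a z)⁻¹ i j * lin (fun k => r a b j k z) v := by
    ext i
    simp only [Rop, vecLin_apply, vec_apply, lin_apply, rUp, Finset.sum_mul, Finset.mul_sum]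
    rw [Finset.sum_comm]
    exact Finset.sum_congr rfl fun i _ => Finset.sum_congr rfl fun j _ => by ring
  rw [h1, met, bil_inv (h.isUnit_det hz), lin_apply, bil_apply]
  simp only [lin_apply, Finset.sum_mul]
  exact Finset.sum_congr rfl fun i _ => Finset.sum_congr rfl fun j _ => by ring

lemma christoffel_symm (l i j : Fin n) : christoffel a l i j z = christoffel a l j i z := by
  simp only [christoffel]
  congr 1
  refine Finset.sum_congr rfl fun m _ => ?_
  have h1 : pd (fun z => a z i j) m z = pd (fun z => a z j i) m z :=
    pd_congr (by filter_upwards [h.isOpen.mem_nhds hz] with y hy using h.a_symm hy i j) m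
  rw [h1]
  ring

lemma Gam_symm (u v : Coord n) : Gam a z u v = Gam a z v u := by
  ext l
  simp only [Gam, vecBil_apply, bil_apply]
  rw [Finset.sum_comm]
  exact Finset.sum_congr rfl fun i _ => Finset.sum_congr rfl fun j _ => by
    rw [h.christoffel_symm hz l j i]; ring

lemma dGam_symm (p u v : Coord n) : dGam a z p u v = dGam a z p v u := by
  ext l
  simp only [dGam, vecBil_apply, bil_apply]
  rw [Finset.sum_comm]
  refine Finset.sum_congr rfl fun i _ => Finset.sum_congr rfl fun j _ => ?_
  have h1 : christoffel a l j i =ᶠ[𝓝 z] christoffel a l i j := by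
    filter_upwards [h.isOpen.mem_nhds hz] with y hy using h.christoffel_symm hy l j i
  rw [h1.fderiv_eq]
  ring

lemma met_Gam_single (m i j : Fin n) :
    met a z (EuclideanSpace.single m 1) (Gam a z (EuclideanSpace.single i 1)
      (EuclideanSpace.single j 1)) =
    1 / 2 * (pd (fun z => a z m j) i z + pd (fun z => a z m i) j z - pd (fun z => a z i j) m z) := by
  have h1 : Gam a z (EuclideanSpace.single i 1) (EuclideanSpace.single j 1) =
      vec fun l => ∑ m, (a z)⁻¹ l m * (1 / 2 * (pd (fun z => a z m j) i z
        + pd (fun z => a z m i) j z - pd (fun z => a z i j) m z)) := by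
    ext l
    simp only [Gam, vecBil_apply, bil_single, vec_apply, christoffel, Finset.mul_sum]
    exact Finset.sum_congr rfl fun j _ => by ring
  rw [h1, met, bil_inv (h.isUnit_det hz), lin_single]

/-- This is a_{ij|k} = 0. By trilinearity it suffices to take basis vectors, where it is the formula
for the Christoffel symbols. -/
lemma fderiv_met (p u v : Coord n) :
    bil (fun i j => fderiv ℝ (fun z => a z i j) z p) u v =
      met a z (Gam a z u p) v + met a z u (Gam a z v p) := by
  rw [bil_fderiv, ← sub_eq_zero]
  refine eq_zero_of_single (f := fun u => tri (fun i j k => pd (fun z => a z i j) k z) u v p -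
    (met a z (Gam a z u p) v + met a z u (Gam a z v p))) (by intros; simp; ring)
    (by intros; simp; ring) (fun i => ?_) u
  refine eq_zero_of_single (f := fun v => tri (fun i j k => pd (fun z => a z i j) k z) _ v p -
    (met a z (Gam a z _ p) v + met a z _ (Gam a z v p))) (by intros; simp; ring)
    (by intros; simp; ring) (fun j => ?_) v
  refine eq_zero_of_single (f := fun p => tri (fun i j k => pd (fun z => a z i j) k z) _ _ p -
    (met a z (Gam a z _ p) _ + met a z _ (Gam a z _ p))) (by intros; simp; ring)
    (by intros; simp; ring) (fun k => ?_) p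
  have h1 : pd (fun z => a z i j) k z = pd (fun z => a z j i) k z :=
    pd_congr (by filter_upwards [h.isOpen.mem_nhds hz] with y hy using h.a_symm hy i j) k
  simp only [tri_single]
  rw [h.met_symm hz (Gam a z _ _), h.met_Gam_single hz, h.met_Gam_single hz]
  linarith

omit h hz

lemma fderiv_cov1 (T : Fin n → Coord n → ℝ) (z p u : Coord n) :
    lin (fun i => fderiv ℝ (T i) z p) u =
      bil (fun i k => cov1 a T i k z) u p + lin (fun i => T i z) (Gam a z u p) := by
  rw [lin_fderiv, ← sub_eq_zero]
  refine eq_zero_of_single (f := fun u => bil (fun i k => pd (T i) k z) u p -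
    (bil (fun i k => cov1 a T i k z) u p + lin (fun i => T i z) (Gam a z u p)))
    (by intros; simp; ring) (by intros; simp; ring) (fun i => ?_) u
  refine eq_zero_of_single (f := fun p => bil (fun i k => pd (T i) k z) _ p -
    (bil (fun i k => cov1 a T i k z) _ p + lin (fun i => T i z) (Gam a z _ p)))
    (by intros; simp; ring) (by intros; simp; ring) (fun k => ?_) p
  simp only [bil_single, cov1, lin_apply, Gam, vecBil_apply]
  simp only [mul_comm (T _ z)]
  ring

lemma fderiv_cov2 (T : Fin n → Fin n → Coord n → ℝ) (z p u v : Coord n) :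
    bil (fun i j => fderiv ℝ (T i j) z p) u v =
      tri (fun i j k => cov2 a T i j k z) u v p + bil (fun i j => T i j z) (Gam a z u p) v
        + bil (fun i j => T i j z) u (Gam a z v p) := by
  rw [bil_fderiv, ← sub_eq_zero]
  refine eq_zero_of_single (f := fun u => tri (fun i j k => pd (T i j) k z) u v p -
    (tri (fun i j k => cov2 a T i j k z) u v p + bil (fun i j => T i j z) (Gam a z u p) v
        + bil (fun i j => T i j z) u (Gam a z v p))) (by intros; simp; ring)
    (by intros; simp; ring) (fun i => ?_) u
  refine eq_zero_of_single (f := fun v => tri (fun i j k => pd (T i j) k z) _ v p -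
    (tri (fun i j k => cov2 a T i j k z) _ v p + bil (fun i j => T i j z) (Gam a z _ p) v
        + bil (fun i j => T i j z) _ (Gam a z v p))) (by intros; simp; ring)
    (by intros; simp; ring) (fun j => ?_) v
  refine eq_zero_of_single (f := fun p => tri (fun i j k => pd (T i j) k z) _ _ p -
    (tri (fun i j k => cov2 a T i j k z) _ _ p + bil (fun i j => T i j z) (Gam a z _ p) _
        + bil (fun i j => T i j z) _ (Gam a z _ p))) (by intros; simp; ring)
    (by intros; simp; ring) (fun k => ?_) p
  have h1 (w : Coord n) : bil (fun i j => T i j z) w (EuclideanSpace.single j 1)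
      = ∑ l, w l * T l j z := by
    rw [bil_apply]
    simp [mul_comm]
  have h2 (w : Coord n) : bil (fun i j => T i j z) (EuclideanSpace.single i 1) w
      = ∑ l, w l * T i l z := by
    rw [bil_apply]
    simp [mul_comm]
  simp only [tri_single, cov2, h1, h2, Gam, vecBil_apply, bil_single]
  ring

end LocalData

end Tensors


/-! ### The identities of `PointData` for a metric and a unit form on an open set. -/

section PointDataOfLocal

open Topology

variable {n : ℕ} {a : Coord n → Matrix (Fin n) (Fin n) ℝ} {b : Fin n → Coord n → ℝ}

lemma fderiv_fderiv_comm {f : Coord n → ℝ} {z : Coord n} (hf : ContDiffAt ℝ ∞ f z)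
    (p q : Coord n) :
    fderiv ℝ (fun y => fderiv ℝ f y p) z q = fderiv ℝ (fun y => fderiv ℝ f y q) z p := by
  have h1 (p : Coord n) : fderiv ℝ (fun y => fderiv ℝ f y p) z = (fderiv ℝ (fderiv ℝ f) z).flip p := by
    have h := ((hf.fderiv_right (m := ∞) (by simp)).differentiableAt
      (by simp)).hasFDerivAt.clm_apply (hasFDerivAt_const p z)
    rw [h.fderiv]
    ext u
    simp
  rw [h1, h1]
  exact (hf.isSymmSndFDerivAt (by
    simp only [minSmoothness_of_isRCLikeNormedField]
    exact WithTop.coe_le_coe.2 (le_top : (2 : ℕ∞) ≤ ⊤))) q p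

lemma cov1_eq (i k : Fin n) (z : Coord n) : cov1 a b i k z = r a b i k z + s a b i k z := by
  simp only [r, s]; ring

lemma bil_cov1 (u p z : Coord n) : bil (fun i k => cov1 a b i k z) u p =
    bil (fun i k => r a b i k z) u p + bil (fun i k => s a b i k z) u p := by
  simp only [cov1_eq, bil_add_left]

variable (a) in
/-- The vector `R̄ⁱ_{jkl}` for given `j`, `k`, `l`. -/
def Rvec (z j k l : Coord n) : Coord n :=
  dGam a z k j l - dGam a z l j k + Gam a z k (Gam a z j l) - Gam a z l (Gam a z j k)

lemma vecBil_add (T T' : Fin n → Fin n → Fin n → ℝ) (u v : Coord n) :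
    vecBil (fun l i j => T l i j + T' l i j) u v = vecBil T u v + vecBil T' u v := by
  ext l; simp [bil_add_left]

lemma vecBil_smul (c : ℝ) (T : Fin n → Fin n → Fin n → ℝ) (u v : Coord n) :
    vecBil (fun l i j => c * T l i j) u v = c • vecBil T u v := by
  ext l; simp [bil_smul_left]

lemma dGam_add (z p q u v : Coord n) :
    dGam a z (p + q) u v = dGam a z p u v + dGam a z q u v := by
  simp only [dGam, map_add, vecBil_add]

lemma dGam_smul (z p u v : Coord n) (c : ℝ) : dGam a z (c • p) u v = c • dGam a z p u v := by
  simp only [dGam, map_smul, smul_eq_mul, vecBil_smul]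

variable (a) in
/-- The curvature tensor `R̄_{ijkl}`. -/
def Rie (z i j : Coord n) : Coord n →ₗ[ℝ] Coord n →ₗ[ℝ] ℝ :=
  LinearMap.mk₂ ℝ (fun k l => met a z i (Rvec a z j k l))
    (by intros; simp only [Rvec, dGam_add, map_add, map_sub, LinearMap.add_apply]; ring)
    (by intros; simp only [Rvec, dGam_smul, map_smul, map_add, map_sub, LinearMap.smul_apply,
          smul_eq_mul]; ring)
    (by intros; simp only [Rvec, dGam_add, map_add, map_sub, LinearMap.add_apply]; ring)
    (by intros; simp only [Rvec, dGam_smul, map_smul, map_add, map_sub, LinearMap.smul_apply,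
          smul_eq_mul]; ring)

@[simp] lemma Rie_apply (z i j k l : Coord n) : Rie a z i j k l = met a z i (Rvec a z j k l) := rfl

namespace LocalData

variable {U : Set (Coord n)} (h : LocalData a b U) {z : Coord n} (hz : z ∈ U)

include h hz

lemma lin_b (u : Coord n) : lin (fun i => b i z) u = met a z (bv a b z) u := by
  rw [h.met_symm hz, h.met_bv hz]

lemma bil_s (u v : Coord n) : bil (fun i j => s a b i j z) u v = met a z u (Sop a b z v) :=
  (h.met_Sop hz u v).symm

lemma bil_r (u v : Coord n) : bil (fun i j => r a b i j z) u v = met a z u (Rop a b z v) :=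
  (h.met_Rop hz u v).symm

lemma Sop_skew (u v : Coord n) : met a z (Sop a b z u) v = -met a z u (Sop a b z v) := by
  rw [h.met_symm hz, ← h.bil_s hz, ← h.bil_s hz, bil_apply, bil_apply, Finset.sum_comm,
    ← Finset.sum_neg_distrib]
  refine Finset.sum_congr rfl fun i _ => ?_
  rw [← Finset.sum_neg_distrib]
  refine Finset.sum_congr rfl fun j _ => ?_
  simp only [s]
  ring

lemma Rop_symm (u v : Coord n) : met a z (Rop a b z u) v = met a z u (Rop a b z v) := by
  rw [h.met_symm hz, ← h.bil_r hz, ← h.bil_r hz, bil_apply, bil_apply, Finset.sum_comm]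
  refine Finset.sum_congr rfl fun i _ => Finset.sum_congr rfl fun j _ => ?_
  simp only [r]
  ring

lemma fderiv_b (p u : Coord n) : lin (fun i => fderiv ℝ (b i) z p) u =
    met a z u (Rop a b z p + Sop a b z p) + met a z (bv a b z) (Gam a z u p) := by
  rw [fderiv_cov1 (a := a), bil_cov1, h.bil_r hz, h.bil_s hz, h.lin_b hz, map_add]

lemma bv_smooth : ContDiffAt ℝ ∞ (bv a b) z := contDiffAt_vec fun i => h.bUp_smooth hz i

lemma bv_differentiableAt : DifferentiableAt ℝ (bv a b) z :=
  (h.bv_smooth hz).differentiableAt (by simp)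

lemma a_differentiableAt (i j : Fin n) : DifferentiableAt ℝ (fun z => a z i j) z :=
  (h.a_smooth z hz i j).differentiableAt (by simp)

/-- Obtained by differentiating the relation a(u, b) = β(u) for constant u and cancelling a. -/
lemma fderiv_bv (p : Coord n) : fderiv ℝ (bv a b) z p =
    Rop a b z p + Sop a b z p - Gam a z (bv a b z) p := by
  refine h.met_ext hz fun u => ?_
  have h1 : (fun z => bil (fun i j => a z i j) u (bv a b z)) =ᶠ[𝓝 z]
      fun z => lin (fun i => b i z) u := by
    filter_upwards [h.isOpen.mem_nhds hz] with y hy using h.met_bv hy u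
  have h2 := congrArg (fun A : Coord n →L[ℝ] ℝ => A p) h1.fderiv_eq
  rw [fderiv_bil (h.a_differentiableAt hz) (differentiableAt_const _) (h.bv_differentiableAt hz),
    fderiv_lin (fun i => (h.b_smooth z hz i).differentiableAt (by simp)) (differentiableAt_const _),
    h.fderiv_met hz, h.fderiv_b hz] at h2
  simp only [fderiv_fun_const, Pi.zero_apply, _root_.zero_apply, map_zero, LinearMap.zero_apply,
    add_zero] at h2
  change _ + met a z u _ = _ at h2
  rw [map_sub]
  rw [h.met_symm hz (bv a b z)] at h2
  linarith

lemma Sop_smooth (v : Coord n) : ContDiffAt ℝ ∞ (fun z => Sop a b z v) z :=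
  contDiffAt_vec fun i => contDiffAt_lin (fun j => h.sUp_smooth hz i j) contDiffAt_const

lemma s_differentiableAt (i j : Fin n) : DifferentiableAt ℝ (s a b i j) z :=
  (h.s_smooth hz i j).differentiableAt (by simp)

lemma r_differentiableAt (i j : Fin n) : DifferentiableAt ℝ (r a b i j) z :=
  (h.r_smooth hz i j).differentiableAt (by simp)

lemma fderiv_s (p u v : Coord n) : bil (fun i j => fderiv ℝ (s a b i j) z p) u v =
    tri (fun i j k => sCov a b i j k z) u v p + met a z (Gam a z u p) (Sop a b z v)
      + met a z u (Sop a b z (Gam a z v p)) := by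
  rw [fderiv_cov2 (a := a), h.bil_s hz, h.bil_s hz]
  rfl

lemma fderiv_r (p u v : Coord n) : bil (fun i j => fderiv ℝ (r a b i j) z p) u v =
    tri (fun i j k => rCov a b i j k z) u v p + met a z (Gam a z u p) (Rop a b z v)
      + met a z u (Rop a b z (Gam a z v p)) := by
  rw [fderiv_cov2 (a := a), h.bil_r hz, h.bil_r hz]
  rfl

lemma fderiv_Sop (p u v : Coord n) : met a z u (fderiv ℝ (fun z => Sop a b z v) z p) =
    tri (fun i j k => sCov a b i j k z) u v p + met a z u (Sop a b z (Gam a z v p))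
      - met a z u (Gam a z (Sop a b z v) p) := by
  have h1 : (fun z => bil (fun i j => a z i j) u (Sop a b z v)) =ᶠ[𝓝 z]
      fun z => bil (fun i j => s a b i j z) u v := by
    filter_upwards [h.isOpen.mem_nhds hz] with y hy using h.met_Sop hy u v
  have h2 := congrArg (fun A : Coord n →L[ℝ] ℝ => A p) h1.fderiv_eq
  rw [fderiv_bil (h.a_differentiableAt hz) (differentiableAt_const _)
      ((h.Sop_smooth hz v).differentiableAt (by simp)),
    fderiv_bil (h.s_differentiableAt hz) (differentiableAt_const _) (differentiableAt_const _),
    h.fderiv_met hz, h.fderiv_s hz] at h2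
  simp only [fderiv_fun_const, Pi.zero_apply, _root_.zero_apply, map_zero, LinearMap.zero_apply,
    add_zero] at h2
  change _ + met a z u _ = _ at h2
  linarith

lemma met_bv_bv : met a z (bv a b z) (bv a b z) = 1 := by
  rw [h.met_bv hz, lin_apply, ← h.unit z hz]
  exact Finset.sum_congr rfl fun i _ => mul_comm _ _

/-- The derivative of |b|² = 1 gives b^i b_{i|j} = 0, that is, r(b, ·) = −s(b, ·). The sign
disappears when S is moved to b. -/
lemma Rop_bv : Rop a b z (bv a b z) = Sop a b z (bv a b z) := by
  refine h.met_ext hz fun p => ?_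
  have h1 : (fun z => lin (fun i => b i z) (bv a b z)) =ᶠ[𝓝 z] fun _ => (1 : ℝ) := by
    filter_upwards [h.isOpen.mem_nhds hz] with y hy
    rw [h.lin_b hy, h.met_bv_bv hy]
  have h2 := congrArg (fun A : Coord n →L[ℝ] ℝ => A p) h1.fderiv_eq
  rw [fderiv_lin (fun i => (h.b_smooth z hz i).differentiableAt (by simp))
    (h.bv_differentiableAt hz), h.fderiv_b hz, h.fderiv_bv hz, h.lin_b hz] at h2
  simp only [fderiv_fun_const, Pi.zero_apply, _root_.zero_apply, map_add, map_sub] at h2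
  rw [← h.Rop_symm hz, ← neg_eq_iff_eq_neg.2 (h.Sop_skew hz _ p)] at h2
  rw [h.met_symm hz p, h.met_symm hz p]
  linarith

lemma met_bv_Rop (v : Coord n) : met a z (bv a b z) (Rop a b z v) =
    -met a z (bv a b z) (Sop a b z v) := by
  rw [← h.Rop_symm hz, h.Rop_bv hz, h.Sop_skew hz]

/-- The covariant derivative of r(b, v) = −s(b, v), including the terms in which b is
differentiated. -/
lemma rCov_bv (v p : Coord n) : tri (fun i j k => rCov a b i j k z) (bv a b z) v p =
    -(tri (fun i j k => sCov a b i j k z) (bv a b z) v p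
      + met a z (Sop a b z v) (Rop a b z p + Sop a b z p))
      - met a z (Rop a b z v) (Rop a b z p + Sop a b z p) := by
  have h1 : (fun z => bil (fun i j => r a b i j z) (bv a b z) v) =ᶠ[𝓝 z]
      fun z => -bil (fun i j => s a b i j z) (bv a b z) v := by
    filter_upwards [h.isOpen.mem_nhds hz] with y hy
    rw [h.bil_r hy, h.bil_s hy, h.met_bv_Rop hy]
  have h2 := congrArg (fun A : Coord n →L[ℝ] ℝ => A p) h1.fderiv_eq
  simp only [fderiv_fun_neg, _root_.neg_apply] at h2
  rw [fderiv_bil (h.r_differentiableAt hz) (h.bv_differentiableAt hz) (differentiableAt_const _),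
    fderiv_bil (h.s_differentiableAt hz) (h.bv_differentiableAt hz) (differentiableAt_const _),
    h.fderiv_s hz, h.fderiv_r hz, h.fderiv_bv hz] at h2
  simp only [fderiv_fun_const, Pi.zero_apply, _root_.zero_apply, map_zero, h.bil_r hz, h.bil_s hz,
    add_zero, map_sub, LinearMap.sub_apply, h.met_bv_Rop hz] at h2
  rw [h.met_symm hz (Sop a b z v), h.met_symm hz (Rop a b z v)]
  linarith

lemma lin_sVec (v : Coord n) : lin (fun i => sVec a b i z) v = met a z (bv a b z) (Sop a b z v) := by
  rw [← h.bil_s hz, lin_apply, bil_apply, Finset.sum_comm]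
  refine Finset.sum_congr rfl fun i _ => ?_
  simp only [sVec, Finset.sum_mul, bv, vec_apply]
  exact Finset.sum_congr rfl fun j _ => by ring

lemma fderiv_sVec (p v : Coord n) : lin (fun i => fderiv ℝ (sVec a b i) z p) v =
    tri (fun i j k => sCov a b i j k z) (bv a b z) v p
      + met a z (Sop a b z v) (Rop a b z p + Sop a b z p)
      + met a z (bv a b z) (Sop a b z (Gam a z v p)) := by
  have h1 : (fun z => lin (fun i => sVec a b i z) v) =ᶠ[𝓝 z]
      fun z => bil (fun i j => s a b i j z) (bv a b z) v := by
    filter_upwards [h.isOpen.mem_nhds hz] with y hy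
    rw [h.bil_s hy, h.lin_sVec hy]
  have h2 := congrArg (fun A : Coord n →L[ℝ] ℝ => A p) h1.fderiv_eq
  rw [fderiv_lin (fun i => (h.sVec_smooth hz i).differentiableAt (by simp))
      (differentiableAt_const _),
    fderiv_bil (h.s_differentiableAt hz) (h.bv_differentiableAt hz) (differentiableAt_const _),
    h.fderiv_s hz, h.fderiv_bv hz] at h2
  simp only [fderiv_fun_const, Pi.zero_apply, _root_.zero_apply, map_zero, h.bil_s hz,
    add_zero, map_sub, LinearMap.sub_apply] at h2
  rw [h.met_symm hz (Sop a b z v)]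
  linarith

lemma bil_sVecCov (v p : Coord n) : bil (fun i k => sVecCov a b i k z) v p =
    tri (fun i j k => sCov a b i j k z) (bv a b z) v p
      + met a z (Sop a b z v) (Rop a b z p + Sop a b z p) := by
  have h1 := fderiv_cov1 (a := a) (sVec a b) z p v
  rw [h.fderiv_sVec hz, h.lin_sVec hz] at h1
  simp only [sVecCov]
  linarith

lemma christoffel_differentiableAt (l i j : Fin n) : DifferentiableAt ℝ (christoffel a l i j) z :=
  (h.christoffel_smooth hz l i j).differentiableAt (by simp)

lemma Gam_differentiableAt (u v : Coord n) : DifferentiableAt ℝ (fun z => Gam a z u v) z :=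
  differentiableAt_vec fun l => (contDiffAt_bil (fun i j => h.christoffel_smooth hz l i j)
    contDiffAt_const contDiffAt_const).differentiableAt (by simp)

lemma fderiv_Gam (p u v : Coord n) :
    fderiv ℝ (fun z => Gam a z u v) z p = dGam a z p u v := by
  have h1 (l) : DifferentiableAt ℝ (fun z => bil (fun i j => christoffel a l i j z) u v) z :=
    (contDiffAt_bil (fun i j => h.christoffel_smooth hz l i j)
      contDiffAt_const contDiffAt_const).differentiableAt (by simp)
  have h2 := fderiv_vec h1 p
  refine Eq.trans h2 ?_
  ext l
  rw [vec_apply, fderiv_bil (h.christoffel_differentiableAt hz l) (differentiableAt_const _)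
    (differentiableAt_const _)]
  simp [dGam]

/-- The second derivatives of β(u), for constant u, commute. Expanded by the connection, the
difference of the two orders is the Ricci identity for b_i. -/
lemma ricci (u p q : Coord n) : tri (fun i j k => rCov a b i j k z) u p q
      + tri (fun i j k => sCov a b i j k z) u p q
      - (tri (fun i j k => rCov a b i j k z) u q p + tri (fun i j k => sCov a b i j k z) u q p)
    = Rie a z (bv a b z) u p q := by
  have h1 (p) : (fun z => fderiv ℝ (fun z => lin (fun i => b i z) u) z p) =ᶠ[𝓝 z]
      fun z => bil (fun i j => r a b i j z) u p + bil (fun i j => s a b i j z) u p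
        + lin (fun i => b i z) (Gam a z u p) := by
    filter_upwards [h.isOpen.mem_nhds hz] with y hy
    rw [fderiv_lin (fun i => (h.b_smooth y hy i).differentiableAt (by simp))
      (differentiableAt_const _), h.fderiv_b hy, h.bil_r hy, h.bil_s hy, h.lin_b hy, h.lin_b hy]
    simp
  have h2 (p q) : fderiv ℝ (fun z => fderiv ℝ (fun z => lin (fun i => b i z) u) z p) z q =
      (tri (fun i j k => rCov a b i j k z) u p q + met a z (Gam a z u q) (Rop a b z p)
        + met a z u (Rop a b z (Gam a z p q)))
      + (tri (fun i j k => sCov a b i j k z) u p q + met a z (Gam a z u q) (Sop a b z p)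
        + met a z u (Sop a b z (Gam a z p q)))
      + (met a z (Gam a z u p) (Rop a b z q + Sop a b z q)
        + met a z (bv a b z) (Gam a z (Gam a z u p) q) + met a z (bv a b z) (dGam a z q u p)) := by
    rw [(h1 p).fderiv_eq]
    have d1 : DifferentiableAt ℝ (fun z => bil (fun i j => r a b i j z) u p) z :=
      (contDiffAt_bil (h.r_smooth hz) contDiffAt_const contDiffAt_const).differentiableAt (by simp)
    have d2 : DifferentiableAt ℝ (fun z => bil (fun i j => s a b i j z) u p) z :=
      (contDiffAt_bil (h.s_smooth hz) contDiffAt_const contDiffAt_const).differentiableAt (by simp)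
    have d3 : DifferentiableAt ℝ (fun z => lin (fun i => b i z) (Gam a z u p)) z :=
      (contDiffAt_lin (h.b_smooth z hz) (contDiffAt_vec fun l => contDiffAt_bil
        (fun i j => h.christoffel_smooth hz l i j) contDiffAt_const
          contDiffAt_const)).differentiableAt (by simp)
    rw [fderiv_fun_add (d1.fun_add d2) d3, fderiv_fun_add d1 d2]
    simp only [_root_.add_apply]
    rw [fderiv_bil (h.r_differentiableAt hz) (differentiableAt_const _) (differentiableAt_const _),
      fderiv_bil (h.s_differentiableAt hz) (differentiableAt_const _) (differentiableAt_const _),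
      fderiv_lin (fun i => (h.b_smooth z hz i).differentiableAt (by simp))
        (h.Gam_differentiableAt hz u p),
      h.fderiv_s hz, h.fderiv_r hz, h.fderiv_b hz, h.lin_b hz, h.fderiv_Gam hz]
    simp
  have h3 := fderiv_fderiv_comm (f := fun z => lin (fun i => b i z) u) (z := z)
    (contDiffAt_lin (h.b_smooth z hz) contDiffAt_const) p q
  rw [h2, h2, h.Gam_symm hz q p] at h3
  simp only [Rie_apply, Rvec, map_add, map_sub] at h3 ⊢
  rw [h.Gam_symm hz p, h.Gam_symm hz q]
  linarith

/-- The second derivatives of a(u, v), for constant u and v, commute. By metric compatibility the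
difference of the two orders is the sum of the two curvature terms. -/
lemma Rie_skew_left (u v p q : Coord n) : Rie a z u v p q = -Rie a z v u p q := by
  have h1 (p) : (fun z => fderiv ℝ (fun z => bil (fun i j => a z i j) u v) z p) =ᶠ[𝓝 z]
      fun z => bil (fun i j => a z i j) (Gam a z u p) v
        + bil (fun i j => a z i j) u (Gam a z v p) := by
    filter_upwards [h.isOpen.mem_nhds hz] with y hy
    rw [fderiv_bil (h.a_differentiableAt hy) (differentiableAt_const _)
      (differentiableAt_const _), h.fderiv_met hy]
    simp [met]
  have h2 (p q) : fderiv ℝ (fun z => fderiv ℝ (fun z => bil (fun i j => a z i j) u v) z p) z q =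
      (met a z (Gam a z (Gam a z u p) q) v + met a z (Gam a z u p) (Gam a z v q)
        + met a z (dGam a z q u p) v)
      + (met a z (Gam a z u q) (Gam a z v p) + met a z u (Gam a z (Gam a z v p) q)
        + met a z u (dGam a z q v p)) := by
    rw [(h1 p).fderiv_eq]
    have d1 (u v) : DifferentiableAt ℝ (fun z => bil (fun i j => a z i j) (Gam a z u p) v) z :=
      (contDiffAt_bil (h.a_smooth z hz) (contDiffAt_vec fun l => contDiffAt_bil
        (fun i j => h.christoffel_smooth hz l i j) contDiffAt_const
          contDiffAt_const) contDiffAt_const).differentiableAt (by simp)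
    have d2 : DifferentiableAt ℝ (fun z => bil (fun i j => a z i j) u (Gam a z v p)) z :=
      (contDiffAt_bil (h.a_smooth z hz) contDiffAt_const (contDiffAt_vec fun l => contDiffAt_bil
        (fun i j => h.christoffel_smooth hz l i j) contDiffAt_const
          contDiffAt_const)).differentiableAt (by simp)
    rw [fderiv_fun_add (d1 u v) d2]
    simp only [_root_.add_apply]
    rw [fderiv_bil (h.a_differentiableAt hz) (h.Gam_differentiableAt hz u p)
        (differentiableAt_const _),
      fderiv_bil (h.a_differentiableAt hz) (differentiableAt_const _)
        (h.Gam_differentiableAt hz v p), h.fderiv_met hz, h.fderiv_met hz, h.fderiv_Gam hz,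
      h.fderiv_Gam hz]
    simp [met]
  have h3 := fderiv_fderiv_comm (f := fun z => bil (fun i j => a z i j) u v) (z := z)
    (contDiffAt_bil (h.a_smooth z hz) contDiffAt_const contDiffAt_const) p q
  rw [h2, h2] at h3
  simp only [Rie_apply, Rvec, map_add, map_sub] at h3 ⊢
  rw [h.Gam_symm hz p, h.Gam_symm hz q, h.Gam_symm hz p, h.Gam_symm hz q]
  simp only [h.met_symm hz _ v] at h3
  linarith

omit hz in
/-- The tensors at a point of the coordinate space. -/
def point (hz : z ∈ U) : PointData (Coord n) where
  g := met a z
  b := bv a b z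
  S := Sop a b z
  R := Rop a b z
  s2 := tri fun i j k => sCov a b i j k z
  r2 := tri fun i j k => rCov a b i j k z
  R4 := Rie a z
  g_symm := h.met_symm hz
  g_pos := h.met_pos hz
  b_unit := h.met_bv_bv hz
  S_skew := h.Sop_skew hz
  R_symm := h.Rop_symm hz
  R_b := h.Rop_bv hz
  s2_skew u v p := by
    have h1 (i j k) : sCov a b i j k z = -sCov a b j i k z := by
      have h2 (i j) : s a b i j = -s a b j i := by
        ext y
        simp only [s, Pi.neg_apply]
        ring
      have h3 (i j) : pd (-s a b i j) k z = -pd (s a b i j) k z := by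
        rw [pd, fderiv_neg]; rfl
      simp only [sCov, cov2]
      rw [h2 i j, h3]
      have h4 (l) : s a b l j z = -s a b j l z := congrFun (h2 l j) z
      have h5 (l) : s a b l i z = -s a b i l z := congrFun (h2 l i) z
      simp only [h4, h5, mul_neg, Finset.sum_neg_distrib]
      ring
    rw [tri_apply, tri_apply, Finset.sum_comm, ← Finset.sum_neg_distrib]
    refine Finset.sum_congr rfl fun i _ => ?_
    rw [← Finset.sum_neg_distrib]
    refine Finset.sum_congr rfl fun j _ => ?_
    rw [← Finset.sum_neg_distrib]
    exact Finset.sum_congr rfl fun k _ => by rw [h1 j i]; ring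
  r2_symm u v p := by
    have h1 (i j k) : rCov a b i j k z = rCov a b j i k z := by
      have h2 (i j) : r a b i j = r a b j i := by
        ext y
        simp only [r]
        ring
      simp only [rCov, cov2]
      rw [h2 i j]
      have h3 (i j) : ∑ l, christoffel a l i k z * r a b l j z
          = ∑ l, christoffel a l i k z * r a b j l z :=
        Finset.sum_congr rfl fun l _ => by rw [h2 l j]
      rw [h3, h3]
      ring
    rw [tri_apply, tri_apply, Finset.sum_comm]
    exact Finset.sum_congr rfl fun i _ => Finset.sum_congr rfl fun j _ =>
      Finset.sum_congr rfl fun k _ => by rw [h1 j i]; ring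
  r2_b := h.rCov_bv hz
  ricci := h.ricci hz
  R4_add_left u v j := by
    refine LinearMap.ext fun k => LinearMap.ext fun l => ?_
    simp
  R4_smul_left t u j := by
    refine LinearMap.ext fun k => LinearMap.ext fun l => ?_
    simp
  R4_skew_left := h.Rie_skew_left hz
  R4_skew_right i j k l := by
    simp only [Rie_apply, Rvec, map_add, map_sub]
    ring
  R4_bianchi i j k l := by
    simp only [Rie_apply, Rvec, map_add, map_sub, h.dGam_symm hz _ k j, h.dGam_symm hz _ l j,
      h.dGam_symm hz _ l k, h.Gam_symm hz k j, h.Gam_symm hz l j, h.Gam_symm hz l k]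
    ring

end LocalData

end PointDataOfLocal


/-! ### Leibniz rules on the tangent bundle for the curvature of a spray. -/

section FiberCalculus

open Topology

variable {n : ℕ} {V : Type*} [NormedAddCommGroup V] [NormedSpace ℝ V]

lemma contDiffAt_fiberLin {L : Coord n → Coord n →ₗ[ℝ] V} {X : Coord n × Coord n}
    (hL : ∀ v, ContDiffAt ℝ ∞ (fun z => L z v) X.1) :
    ContDiffAt ℝ ∞ (fun Z : Coord n × Coord n => L Z.1 Z.2) X := by
  have h1 : (fun Z : Coord n × Coord n => L Z.1 Z.2) =
      fun Z => ∑ i, Z.2 i • L Z.1 (EuclideanSpace.single i 1) := by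
    funext Z
    conv_lhs => rw [← sum_smul_single Z.2]
    simp
  rw [h1]
  exact ContDiffAt.sum fun i _ => (contDiffAt_euclidean.1 contDiffAt_snd i).smul
    ((hL (EuclideanSpace.single i 1)).comp X contDiffAt_fst)

lemma contDiffAt_fiberBil {Q : Coord n → Coord n →ₗ[ℝ] Coord n →ₗ[ℝ] V} {X : Coord n × Coord n}
    (hQ : ∀ u v, ContDiffAt ℝ ∞ (fun z => Q z u v) X.1) :
    ContDiffAt ℝ ∞ (fun Z : Coord n × Coord n => Q Z.1 Z.2 Z.2) X := by
  have h1 : (fun Z : Coord n × Coord n => Q Z.1 Z.2 Z.2) =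
      fun Z => ∑ i, Z.2 i • Q Z.1 (EuclideanSpace.single i 1) Z.2 := by
    funext Z
    have h := congrArg (fun v => Q Z.1 v Z.2) (sum_smul_single Z.2).symm
    simp only [map_sum, map_smul, LinearMap.sum_apply, LinearMap.smul_apply] at h
    exact h
  rw [h1]
  exact ContDiffAt.sum fun i _ => (contDiffAt_euclidean.1 contDiffAt_snd i).smul
    (contDiffAt_fiberLin fun v => hQ _ v)

lemma fderiv_fiberLin {L : Coord n → Coord n →ₗ[ℝ] V} {x y : Coord n}
    (hL : ∀ v, ContDiffAt ℝ ∞ (fun z => L z v) x) (p q : Coord n) :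
    fderiv ℝ (fun Z : Coord n × Coord n => L Z.1 Z.2) (x, y) (p, q) =
      fderiv ℝ (fun z => L z y) x p + L x q := by
  have hd : DifferentiableAt ℝ (fun Z : Coord n × Coord n => L Z.1 Z.2) (x, y) :=
    (contDiffAt_fiberLin (X := (x, y)) hL).differentiableAt (by simp)
  have h1 : ((p, q) : Coord n × Coord n) = (p, 0) + (0, q) := by simp
  rw [h1, map_add, ← fderiv_fst_eq hd, ← fderiv_snd_eq hd]
  congr 1
  change fderiv ℝ (fun w => L x w) y q = L x q
  have h2 : (fun w => L x w) = LinearMap.toContinuousLinearMap (L x) := rfl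
  rw [h2, ContinuousLinearMap.fderiv]
  rfl

lemma fderiv_fiberBil {Q : Coord n → Coord n →ₗ[ℝ] Coord n →ₗ[ℝ] V} {x y : Coord n}
    (hQ : ∀ u v, ContDiffAt ℝ ∞ (fun z => Q z u v) x) (p q : Coord n) :
    fderiv ℝ (fun Z : Coord n × Coord n => Q Z.1 Z.2 Z.2) (x, y) (p, q) =
      fderiv ℝ (fun z => Q z y y) x p + Q x q y + Q x y q := by
  have hd : DifferentiableAt ℝ (fun Z : Coord n × Coord n => Q Z.1 Z.2 Z.2) (x, y) :=
    (contDiffAt_fiberBil (X := (x, y)) hQ).differentiableAt (by simp)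
  have h1 : ((p, q) : Coord n × Coord n) = (p, 0) + (0, q) := by simp
  rw [h1, map_add, ← fderiv_fst_eq hd, ← fderiv_snd_eq hd, add_assoc]
  congr 1
  change fderiv ℝ (fun w => Q x w w) y q = _
  let Qc : Coord n →L[ℝ] Coord n →L[ℝ] V := LinearMap.toContinuousLinearMap
    ((LinearMap.toContinuousLinearMap : (Coord n →ₗ[ℝ] V) ≃ₗ[ℝ] (Coord n →L[ℝ] V)).toLinearMap
      ∘ₗ Q x)
  have h3 := (Qc.hasFDerivAt (x := y)).clm_apply (hasFDerivAt_id y)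
  have h2 : (fun w => Q x w w) = fun w => Qc w w := rfl
  rw [h2]
  have h4 : fderiv ℝ (fun w => Qc w w) y = _ := h3.fderiv
  rw [h4]
  simp only [_root_.add_apply, ContinuousLinearMap.comp_apply, ContinuousLinearMap.flip_apply]
  rw [add_comm]
  rfl

variable {W : Set (Coord n × Coord n)} {X : Coord n × Coord n}

/-- The second-order operator whose value on the coefficients of a spray is the curvature. -/
def cOp (f : Coord n × Coord n → ℝ) (X : Coord n × Coord n) (w : Coord n) (ξ : Coord n × Coord n)
    (Y : Coord n) : ℝ :=
  2 * fderiv ℝ f X (w, 0) - fderiv ℝ (fun Z => fderiv ℝ f Z (0, w)) X ξ - fderiv ℝ f X (0, Y)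

/-- With the spray vector and the vector D_yG(w) frozen, the curvature becomes a linear operator in
a scalar function. It can be evaluated summand by summand and factor by factor. -/
lemma curvVec_eq_cOp {G : Coord n × Coord n → Coord n} (hW : IsOpen W) (hG : Sm W G) (hX : X ∈ W)
    (ϖ : Coord n →L[ℝ] ℝ) (w : Coord n) :
    ϖ (curvVec G X w) = cOp (fun Z => ϖ (G Z)) X w (sprayVec G X) (fderiv ℝ G X (0, w)) := by
  have h1 (Z) (hZ : Z ∈ W) (v) : fderiv ℝ (fun Z => ϖ (G Z)) Z v = ϖ (fderiv ℝ G Z v) := by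
    have h := ϖ.hasFDerivAt.comp Z (hG.differentiableAt hZ).hasFDerivAt
    have h' : fderiv ℝ (fun Z => ϖ (G Z)) Z = _ := h.fderiv
    rw [h']
    rfl
  have h2 : (fun Z => fderiv ℝ (fun Z => ϖ (G Z)) Z (0, w)) =ᶠ[𝓝 X]
      fun Z => ϖ (fderiv ℝ G Z (0, w)) := by
    filter_upwards [hW.mem_nhds hX] with Z hZ using h1 Z hZ _
  have h3 := ϖ.hasFDerivAt.comp X ((hG.smooth_fderiv_apply (0, w)).differentiableAt hX).hasFDerivAt
  have h4 : fderiv ℝ (fun Z => ϖ (fderiv ℝ G Z (0, w))) X = _ := h3.fderiv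
  rw [cOp, h2.fderiv_eq, h4, h1 X hX, h1 X hX, ContinuousLinearMap.comp_apply,
    hG.hasFDerivAt_fderiv_apply hX, ContinuousLinearMap.flip_apply, hG.symm hX, curvVec]
  simp only [map_sub, map_smul, smul_eq_mul]

lemma fderiv_mul_apply {f h : Coord n × Coord n → ℝ} (hf : DifferentiableAt ℝ f X)
    (hh : DifferentiableAt ℝ h X) (v : Coord n × Coord n) :
    fderiv ℝ (fun Z => f Z * h Z) X v = f X * fderiv ℝ h X v + h X * fderiv ℝ f X v := by
  rw [fderiv_fun_mul hf hh]
  rfl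

lemma cOp_add {f h : Coord n × Coord n → ℝ} (hW : IsOpen W) (hf : Sm W f) (hh : Sm W h)
    (hX : X ∈ W) (w : Coord n) (ξ : Coord n × Coord n) (Y : Coord n) :
    cOp (fun Z => f Z + h Z) X w ξ Y = cOp f X w ξ Y + cOp h X w ξ Y := by
  have h2 : (fun Z => fderiv ℝ (fun Z => f Z + h Z) Z (0, w)) =ᶠ[𝓝 X]
      fun Z => fderiv ℝ f Z (0, w) + fderiv ℝ h Z (0, w) := by
    filter_upwards [hW.mem_nhds hX] with Z hZ
    rw [fderiv_fun_add (hf.differentiableAt hZ) (hh.differentiableAt hZ)]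
    rfl
  rw [cOp, h2.fderiv_eq, fderiv_fun_add (hf.differentiableAt hX) (hh.differentiableAt hX),
    fderiv_fun_add ((hf.smooth_fderiv_apply _).differentiableAt hX)
      ((hh.smooth_fderiv_apply _).differentiableAt hX)]
  simp only [cOp, _root_.add_apply]
  ring

lemma cOp_mul {f h : Coord n × Coord n → ℝ} (hW : IsOpen W) (hf : Sm W f) (hh : Sm W h)
    (hX : X ∈ W) (w : Coord n) (ξ : Coord n × Coord n) (Y : Coord n) :
    cOp (fun Z => f Z * h Z) X w ξ Y = f X * cOp h X w ξ Y + h X * cOp f X w ξ Y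
      - fderiv ℝ f X (0, w) * fderiv ℝ h X ξ - fderiv ℝ f X ξ * fderiv ℝ h X (0, w) := by
  have h2 : (fun Z => fderiv ℝ (fun Z => f Z * h Z) Z (0, w)) =ᶠ[𝓝 X]
      fun Z => f Z * fderiv ℝ h Z (0, w) + h Z * fderiv ℝ f Z (0, w) := by
    filter_upwards [hW.mem_nhds hX] with Z hZ
    exact fderiv_mul_apply (hf.differentiableAt hZ) (hh.differentiableAt hZ) _
  have f1 := hf.differentiableAt hX
  have f2 := hh.differentiableAt hX
  have f3 := (hf.smooth_fderiv_apply (0, w)).differentiableAt hX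
  have f4 := (hh.smooth_fderiv_apply (0, w)).differentiableAt hX
  rw [cOp, h2.fderiv_eq, fderiv_fun_add (f1.fun_mul f4) (f2.fun_mul f3), _root_.add_apply,
    fderiv_mul_apply f1 f4, fderiv_mul_apply f2 f3, fderiv_mul_apply f1 f2, fderiv_mul_apply f1 f2]
  simp only [cOp]
  ring

/-- The Euler–Lagrange equation and horizontal constancy cancel the three terms. Hence no second
derivative of φ has to be computed for the Kropina spray. -/
lemma HorConst.cOp_eq_zero {G : Coord n × Coord n → Coord n} {φ : Coord n × Coord n → ℝ}
    (hW : IsOpen W) (hG : Sm W G) (hφ : Sm W φ) (hh : Homog W G) (hc : HorConst W G φ) (hX : X ∈ W)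
    (w : Coord n) : cOp φ X w (sprayVec G X) (fderiv ℝ G X (0, w)) = 0 := by
  rw [cOp, hφ.hasFDerivAt_fderiv_apply hX, ContinuousLinearMap.flip_apply, hφ.symm hX,
    hc.fderiv_vertical_sprayVec hW hG hφ hh hX, ← hc X hX]
  ring

lemma cOp_fiberLin {L : Coord n → Coord n →ₗ[ℝ] ℝ} (hW : IsOpen W) (hX : X ∈ W)
    (hL : ∀ Z ∈ W, ∀ v, ContDiffAt ℝ ∞ (fun z => L z v) Z.1) (w : Coord n)
    (ξ : Coord n × Coord n) (Y : Coord n) :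
    cOp (fun Z => L Z.1 Z.2) X w ξ Y = 2 * fderiv ℝ (fun z => L z X.2) X.1 w
      - fderiv ℝ (fun z => L z w) X.1 ξ.1 - L X.1 Y := by
  obtain ⟨x, y⟩ := X
  obtain ⟨p, q⟩ := ξ
  have h2 : (fun Z : Coord n × Coord n => fderiv ℝ (fun Z : Coord n × Coord n => L Z.1 Z.2) Z (0, w))
      =ᶠ[𝓝 (x, y)] fun Z => (fun z => L z w) Z.1 := by
    filter_upwards [hW.mem_nhds hX] with Z hZ
    rw [fderiv_fiberLin (hL Z hZ)]
    simp
  have h4 : fderiv ℝ (fun Z : Coord n × Coord n => (fun z => L z w) Z.1) (x, y) (p, q)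
      = fderiv ℝ (fun z => L z w) x p := by
    have h5 := HasFDerivAt.comp (x, y) (g := fun z => L z w) (f := Prod.fst)
      ((hL _ hX w).differentiableAt (by simp)).hasFDerivAt
      (hasFDerivAt_fst (𝕜 := ℝ) (E := Coord n) (F := Coord n) (p := (x, y)))
    have h6 : fderiv ℝ (fun Z : Coord n × Coord n => (fun z => L z w) Z.1) (x, y) = _ := h5.fderiv
    rw [h6]
    rfl
  rw [cOp, h2.fderiv_eq, h4, fderiv_fiberLin (hL _ hX), fderiv_fiberLin (hL _ hX)]
  simp

lemma cOp_fiberBil {Q : Coord n → Coord n →ₗ[ℝ] Coord n →ₗ[ℝ] ℝ} (hW : IsOpen W) (hX : X ∈ W)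
    (hQ : ∀ Z ∈ W, ∀ u v, ContDiffAt ℝ ∞ (fun z => Q z u v) Z.1)
    (hs : ∀ Z ∈ W, ∀ u v, Q Z.1 u v = Q Z.1 v u) (w : Coord n)
    (ξ : Coord n × Coord n) (Y : Coord n) :
    cOp (fun Z => Q Z.1 Z.2 Z.2) X w ξ Y = 2 * (fderiv ℝ (fun z => Q z X.2 X.2) X.1 w
      - fderiv ℝ (fun z => Q z w X.2) X.1 ξ.1 - Q X.1 w ξ.2 - Q X.1 X.2 Y) := by
  have h2 : (fun Z : Coord n × Coord n =>
        fderiv ℝ (fun Z : Coord n × Coord n => Q Z.1 Z.2 Z.2) Z (0, w))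
      =ᶠ[𝓝 X] fun Z => 2 * (fun z => Q z w) Z.1 Z.2 := by
    filter_upwards [hW.mem_nhds hX] with Z hZ
    rw [fderiv_fiberBil (hQ Z hZ), hs Z hZ _ w]
    simp
    ring
  obtain ⟨x, y⟩ := X
  obtain ⟨p, q⟩ := ξ
  have h3 : DifferentiableAt ℝ (fun Z : Coord n × Coord n => (fun z => Q z w) Z.1 Z.2) (x, y) :=
    (contDiffAt_fiberLin (X := (x, y)) (hQ _ hX w)).differentiableAt (by simp)
  have h4 := hs _ hX Y y
  rw [cOp, h2.fderiv_eq, fderiv_const_mul h3, fderiv_fiberBil (hQ _ hX), fderiv_fiberBil (hQ _ hX)]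
  simp only [_root_.smul_apply, smul_eq_mul]
  rw [fderiv_fiberLin (L := fun z => Q z w) (hQ _ hX w)]
  simp only at h4
  simp only [map_zero, LinearMap.zero_apply, h4]
  ring

lemma cOp_fst {f : Coord n → ℝ} (hW : IsOpen W) (hX : X ∈ W)
    (hf : ∀ Z ∈ W, ContDiffAt ℝ ∞ f Z.1) (w : Coord n) (ξ : Coord n × Coord n) (Y : Coord n) :
    cOp (fun Z => f Z.1) X w ξ Y = 2 * fderiv ℝ f X.1 w := by
  have h1 (Z) (hZ : Z ∈ W) (v) : fderiv ℝ (fun Z : Coord n × Coord n => f Z.1) Z v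
      = fderiv ℝ f Z.1 v.1 := by
    have h5 := HasFDerivAt.comp Z (g := f) (f := Prod.fst)
      ((hf _ hZ).differentiableAt (by simp)).hasFDerivAt
      (hasFDerivAt_fst (𝕜 := ℝ) (E := Coord n) (F := Coord n) (p := Z))
    have h6 : fderiv ℝ (fun Z : Coord n × Coord n => f Z.1) Z = _ := h5.fderiv
    rw [h6]
    rfl
  have h2 : (fun Z : Coord n × Coord n => fderiv ℝ (fun Z : Coord n × Coord n => f Z.1) Z (0, w))
      =ᶠ[𝓝 X] fun Z => (0 : ℝ) := by
    filter_upwards [hW.mem_nhds hX] with Z hZ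
    rw [h1 Z hZ]
    simp
  rw [cOp, h2.fderiv_eq, h1 X hX, h1 X hX]
  simp

end FiberCalculus


/-! ### The candidate for the spray of α²/β and its derivatives. -/

section KropinaSpray

open Topology

variable {n : ℕ} (a : Coord n → Matrix (Fin n) (Fin n) ℝ) (b : Fin n → Coord n → ℝ)

/-- The domain `β > 0`. -/
def kDom (U : Set (Coord n)) : Set (Coord n × Coord n) :=
  {X | X.1 ∈ U ∧ 0 < lin (fun i => b i X.1) X.2}

/-- `U v = (s_i vⁱ) b - S v`. -/
def Uop (z : Coord n) : Coord n →ₗ[ℝ] Coord n :=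
  (lin fun i => sVec a b i z).smulRight (bv a b z) - Sop a b z

/-- `φ = α²/(2β)`. -/
def kphi (X : Coord n × Coord n) : ℝ :=
  met a X.1 X.2 X.2 / (2 * lin (fun i => b i X.1) X.2)

/-- The projective factor `-(s_0 + r_00/(2φ))`. -/
def kproj (X : Coord n × Coord n) : ℝ :=
  -(lin (fun i => sVec a b i X.1) X.2
    + bil (fun i j => r a b i j X.1) X.2 X.2 / (2 * kphi a b X))

/-- The spray coefficients of `α²/β`. -/
def kspray (X : Coord n × Coord n) : Coord n :=
  (1 / 2 : ℝ) • Gam a X.1 X.2 X.2 + kphi a b X • Uop a b X.1 X.2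
    + (1 / 2 * bil (fun i j => r a b i j X.1) X.2 X.2) • bv a b X.1 + kproj a b X • X.2

variable {a b}

lemma fderiv_linear_comp {B V : Type*} [NormedAddCommGroup B] [NormedSpace ℝ B]
    [NormedAddCommGroup V] [NormedSpace ℝ V] [FiniteDimensional ℝ V] (l : V →ₗ[ℝ] ℝ) {f : B → V}
    {x : B} (hf : DifferentiableAt ℝ f x) (p : B) :
    fderiv ℝ (fun z => l (f z)) x p = l (fderiv ℝ f x p) := by
  have h := (LinearMap.toContinuousLinearMap l).hasFDerivAt.comp x hf.hasFDerivAt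
  have h' : fderiv ℝ (fun z => l (f z)) x = _ := h.fderiv
  rw [h']
  rfl

namespace LocalData

variable {U : Set (Coord n)} (h : LocalData a b U)

include h

section Base

variable {x : Coord n} (hx : x ∈ U)

include hx

lemma met_smooth (u v : Coord n) : ContDiffAt ℝ ∞ (fun z => met a z u v) x :=
  contDiffAt_bil (h.a_smooth x hx) contDiffAt_const contDiffAt_const

lemma linb_smooth (v : Coord n) : ContDiffAt ℝ ∞ (fun z => lin (fun i => b i z) v) x :=
  contDiffAt_lin (h.b_smooth x hx) contDiffAt_const

lemma linsVec_smooth (v : Coord n) : ContDiffAt ℝ ∞ (fun z => lin (fun i => sVec a b i z) v) x :=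
  contDiffAt_lin (h.sVec_smooth hx) contDiffAt_const

lemma bilr_smooth (u v : Coord n) :
    ContDiffAt ℝ ∞ (fun z => bil (fun i j => r a b i j z) u v) x :=
  contDiffAt_bil (h.r_smooth hx) contDiffAt_const contDiffAt_const

lemma Gam_smooth (u v : Coord n) : ContDiffAt ℝ ∞ (fun z => Gam a z u v) x :=
  contDiffAt_vec fun l => contDiffAt_bil (fun i j => h.christoffel_smooth hx l i j)
    contDiffAt_const contDiffAt_const

lemma Uop_smooth (v : Coord n) : ContDiffAt ℝ ∞ (fun z => Uop a b z v) x :=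
  ((h.linsVec_smooth hx v).smul (h.bv_smooth hx)).sub (h.Sop_smooth hx v)

lemma fderiv_met_const (u v p : Coord n) : fderiv ℝ (fun z => met a z u v) x p =
    (h.point hx).g (Gam a x u p) v + (h.point hx).g u (Gam a x v p) := by
  have h1 := fderiv_bil (h.a_differentiableAt hx) (differentiableAt_const u)
    (differentiableAt_const v) p
  rw [h.fderiv_met hx] at h1
  refine Eq.trans h1 ?_
  simp only [fderiv_fun_const, Pi.zero_apply, _root_.zero_apply, map_zero, LinearMap.zero_apply,
    add_zero]
  rfl

lemma fderiv_b_const (v p : Coord n) : fderiv ℝ (fun z => lin (fun i => b i z) v) x p =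
    (h.point hx).d v p + (h.point hx).g (h.point hx).b (Gam a x v p) := by
  rw [fderiv_lin (fun i => (h.b_smooth x hx i).differentiableAt (by simp))
    (differentiableAt_const v), h.fderiv_b hx]
  simp only [fderiv_fun_const, Pi.zero_apply, _root_.zero_apply, map_zero, add_zero]
  rfl

lemma lin_sVec_eq (v : Coord n) : lin (fun i => sVec a b i x) v = (h.point hx).sig v := by
  rw [h.lin_sVec hx]
  exact h.met_symm hx _ _

lemma bil_r_eq (u v : Coord n) :
    bil (fun i j => r a b i j x) u v = (h.point hx).g ((h.point hx).R u) v := by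
  rw [h.bil_r hx]
  exact (h.Rop_symm hx u v).symm

lemma Uop_eq (v : Coord n) : Uop a b x v = (h.point hx).U v := by
  simp only [Uop, LinearMap.sub_apply, LinearMap.smulRight_apply, h.lin_sVec_eq hx]
  rfl

lemma fderiv_sVec_const (v p : Coord n) : fderiv ℝ (fun z => lin (fun i => sVec a b i z) v) x p =
    (h.point hx).s1 v p + (h.point hx).sig (Gam a x v p) := by
  rw [fderiv_lin (fun i => (h.sVec_smooth hx i).differentiableAt (by simp))
    (differentiableAt_const v), h.fderiv_sVec hx, h.met_symm hx (bv a b x)]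
  simp only [fderiv_fun_const, Pi.zero_apply, _root_.zero_apply, map_zero, add_zero]
  rfl

lemma fderiv_r_const (u v p : Coord n) :
    fderiv ℝ (fun z => bil (fun i j => r a b i j z) u v) x p =
    (h.point hx).r2 u v p + (h.point hx).g ((h.point hx).R v) (Gam a x u p)
      + (h.point hx).g ((h.point hx).R u) (Gam a x v p) := by
  rw [fderiv_bil (h.r_differentiableAt hx) (differentiableAt_const u) (differentiableAt_const v),
    h.fderiv_r hx, h.met_symm hx (Gam a x u p), ← h.Rop_symm hx]
  simp only [fderiv_fun_const, Pi.zero_apply, _root_.zero_apply, map_zero, LinearMap.zero_apply,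
    add_zero]
  rfl

lemma fderiv_bv_const (κ p : Coord n) : fderiv ℝ (fun z => met a x κ (bv a b z)) x p =
    (h.point hx).d κ p - (h.point hx).g κ (Gam a x (h.point hx).b p) := by
  rw [fderiv_linear_comp _ (h.bv_differentiableAt hx), h.fderiv_bv hx, map_sub]
  rfl

lemma fderiv_Gam_const (κ u v p : Coord n) : fderiv ℝ (fun z => met a x κ (Gam a z u v)) x p =
    (h.point hx).g κ (dGam a x p u v) := by
  rw [fderiv_linear_comp _ (h.Gam_differentiableAt hx u v), h.fderiv_Gam hx]
  rfl

lemma fderiv_Uop_const (κ v p : Coord n) : fderiv ℝ (fun z => met a x κ (Uop a b z v)) x p =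
    (h.point hx).dU κ v p + (h.point hx).g κ ((h.point hx).U (Gam a x v p))
      - (h.point hx).g κ (Gam a x ((h.point hx).U v) p) := by
  have d1 := (h.linsVec_smooth hx v).differentiableAt (by simp)
  have d2 := h.bv_differentiableAt hx
  have d3 := (h.Sop_smooth hx v).differentiableAt (by simp)
  have h1 := ((d1.hasFDerivAt.smul d2.hasFDerivAt).sub d3.hasFDerivAt).fderiv
  have h2 : fderiv ℝ (fun z => Uop a b z v) x = _ := h1
  rw [fderiv_linear_comp _ ((h.Uop_smooth hx v).differentiableAt (by simp)), h2]
  simp only [_root_.sub_apply, _root_.add_apply, _root_.smul_apply,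
    ContinuousLinearMap.smulRight_apply, map_sub, map_add, map_smul, smul_eq_mul]
  rw [h.fderiv_Sop hx, h.fderiv_bv hx, h.fderiv_sVec_const hx, h.lin_sVec_eq hx]
  simp only [PointData.dU, PointData.U, map_sub, map_smul, smul_eq_mul, LinearMap.sub_apply,
    LinearMap.smul_apply, (h.point hx).g_symm (h.point hx).b κ]
  change _ = _ + ((h.point hx).sig _ * met a x κ (bv a b x) - met a x κ (Sop a b x _))
    - ((h.point hx).sig _ * met a x κ (Gam a x (bv a b x) p) - met a x κ (Gam a x (Sop a b x v) p))
  change _ + (((h.point hx).s1 v p + _) * met a x κ (bv a b x)) - _ =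
    ((h.point hx).s1 v p * met a x κ (bv a b x)
      + (h.point hx).sig v * (met a x κ (Rop a b x p + Sop a b x p)) - _) + _ - _
  simp only [map_add]
  change _ = _ - tri (fun i j k => sCov a b i j k x) κ v p + _ - _
  ring

end Base

lemma isOpen_kDom : IsOpen (kDom b U) := by
  rw [isOpen_iff_mem_nhds]
  rintro X ⟨h1, h2⟩
  have h3 : ContinuousAt (fun Z : Coord n × Coord n => lin (fun i => b i Z.1) Z.2) X :=
    (contDiffAt_fiberLin fun v => h.linb_smooth h1 v).continuousAt
  filter_upwards [(h.isOpen.preimage continuous_fst).mem_nhds h1,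
    h3.eventually (lt_mem_nhds h2)] with Z hZ1 hZ2 using ⟨hZ1, hZ2⟩

section Total

variable {x y : Coord n} (hx : x ∈ U) (hX : (x, y) ∈ kDom b U)

include hx hX

lemma g_b_pos : 0 < (h.point hx).g (h.point hx).b y :=
  lt_of_lt_of_eq hX.2 (h.lin_b hx y)

lemma g_self_pos : 0 < (h.point hx).g y y := by
  refine (h.point hx).g_pos y ?_
  rintro rfl
  simpa using h.g_b_pos hx hX

omit hX in
lemma kphi_eq : kphi a b (x, y) = (h.point hx).phi y := by
  simp only [kphi, h.lin_b hx]
  rfl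

lemma phi_pos : 0 < (h.point hx).phi y :=
  div_pos (h.g_self_pos hx hX) (mul_pos two_pos (h.g_b_pos hx hX))

end Total

lemma sm_met : Sm (kDom b U) fun X => met a X.1 X.2 X.2 :=
  fun _ hX => contDiffAt_fiberBil fun u v => h.met_smooth hX.1 u v

lemma sm_b : Sm (kDom b U) fun X => lin (fun i => b i X.1) X.2 :=
  fun _ hX => contDiffAt_fiberLin fun v => h.linb_smooth hX.1 v

lemma sm_r : Sm (kDom b U) fun X => bil (fun i j => r a b i j X.1) X.2 X.2 :=
  fun _ hX => contDiffAt_fiberBil fun u v => h.bilr_smooth hX.1 u v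

lemma sm_sVec : Sm (kDom b U) fun X => lin (fun i => sVec a b i X.1) X.2 :=
  fun _ hX => contDiffAt_fiberLin fun v => h.linsVec_smooth hX.1 v

lemma sm_kphi : Sm (kDom b U) (kphi a b) := fun X hX =>
  (h.sm_met X hX).div (contDiffAt_const.mul (h.sm_b X hX)) (mul_pos two_pos hX.2).ne'

lemma kphi_pos {X : Coord n × Coord n} (hX : X ∈ kDom b U) : 0 < kphi a b X := by
  obtain ⟨x, y⟩ := X
  rw [h.kphi_eq hX.1]
  exact h.phi_pos hX.1 hX

lemma sm_kproj : Sm (kDom b U) (kproj a b) := fun X hX =>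
  ((h.sm_sVec X hX).add ((h.sm_r X hX).div (contDiffAt_const.mul (h.sm_kphi X hX))
    (mul_pos two_pos (h.kphi_pos hX)).ne')).neg

lemma sm_Gam : Sm (kDom b U) fun X => Gam a X.1 X.2 X.2 :=
  fun _ hX => contDiffAt_fiberBil fun u v => h.Gam_smooth hX.1 u v

lemma sm_Uop : Sm (kDom b U) fun X => Uop a b X.1 X.2 :=
  fun _ hX => contDiffAt_fiberLin fun v => h.Uop_smooth hX.1 v

lemma sm_bv : Sm (kDom b U) fun X => bv a b X.1 :=
  fun X hX => (h.bv_smooth hX.1).comp X contDiffAt_fst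

lemma sm_kspray : Sm (kDom b U) (kspray a b) := by
  intro X hX
  have h1 : ContDiffAt ℝ ∞ (fun X : Coord n × Coord n => (1 / 2 : ℝ) • Gam a X.1 X.2 X.2) X :=
    (h.sm_Gam X hX).const_smul (1 / 2 : ℝ)
  have h2 : ContDiffAt ℝ ∞ (fun X : Coord n × Coord n => kphi a b X • Uop a b X.1 X.2) X :=
    (h.sm_kphi X hX).smul (h.sm_Uop X hX)
  have h3 : ContDiffAt ℝ ∞ (fun X : Coord n × Coord n =>
      (1 / 2 * bil (fun i j => r a b i j X.1) X.2 X.2) • bv a b X.1) X :=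
    (contDiffAt_const.mul (h.sm_r X hX)).smul (h.sm_bv X hX)
  have h4 : ContDiffAt ℝ ∞ (fun X : Coord n × Coord n => kproj a b X • X.2) X :=
    (h.sm_kproj X hX).smul contDiffAt_snd
  exact ((h1.add h2).add h3).add h4

section Derivatives

variable {x y : Coord n} (hx : x ∈ U) (hX : (x, y) ∈ kDom b U) (p q : Coord n)

include hx hX

omit hX in
lemma fderiv_met_total : fderiv ℝ (fun X : Coord n × Coord n => met a X.1 X.2 X.2) (x, y) (p, q) =
    2 * (h.point hx).g y (Gam a x y p + q) := by
  rw [fderiv_fiberBil (Q := met a) (fun u v => h.met_smooth hx u v), h.fderiv_met_const hx,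
    (h.point hx).g_symm (Gam a x y p), h.met_symm hx q, map_add]
  change _ + (h.point hx).g y q + (h.point hx).g y q = _
  ring

omit hX in
lemma fderiv_b_total :
    fderiv ℝ (fun X : Coord n × Coord n => lin (fun i => b i X.1) X.2) (x, y) (p, q) =
    (h.point hx).d y p + (h.point hx).g (h.point hx).b (Gam a x y p + q) := by
  rw [fderiv_fiberLin (L := fun z => lin fun i => b i z) (fun v => h.linb_smooth hx v),
    h.fderiv_b_const hx, h.lin_b hx, map_add, add_assoc]
  rfl

omit hX in
lemma fderiv_sVec_total :
    fderiv ℝ (fun X : Coord n × Coord n => lin (fun i => sVec a b i X.1) X.2) (x, y) (p, q) =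
    (h.point hx).s1 y p + (h.point hx).sig (Gam a x y p + q) := by
  rw [fderiv_fiberLin (L := fun z => lin fun i => sVec a b i z) (fun v => h.linsVec_smooth hx v),
    h.fderiv_sVec_const hx, h.lin_sVec_eq hx]
  simp only [PointData.sig, map_add, LinearMap.add_apply, add_assoc]

omit hX in
lemma fderiv_r_total :
    fderiv ℝ (fun X : Coord n × Coord n => bil (fun i j => r a b i j X.1) X.2 X.2) (x, y) (p, q) =
    (h.point hx).r2 y y p + 2 * (h.point hx).g ((h.point hx).R y) (Gam a x y p + q) := by
  rw [fderiv_fiberBil (Q := fun z => bil fun i j => r a b i j z)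
      (fun u v => h.bilr_smooth hx u v), h.fderiv_r_const hx, h.bil_r_eq hx, h.bil_r_eq hx,
    (h.point hx).R_symm q, (h.point hx).g_symm q, map_add]
  ring

/-- Obtained from the product α² = 2βφ. The connection terms combine with q, so only the derivative
of b contributes outside `phiW`. -/
lemma fderiv_kphi : fderiv ℝ (kphi a b) (x, y) (p, q) =
    (h.point hx).phiW y (Gam a x y p + q)
      - (h.point hx).phi y * (h.point hx).d y p / (h.point hx).g (h.point hx).b y := by
  have h1 : (fun X : Coord n × Coord n => met a X.1 X.2 X.2) =ᶠ[𝓝 (x, y)]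
      fun X => kphi a b X * (2 * lin (fun i => b i X.1) X.2) := by
    filter_upwards [h.isOpen_kDom.mem_nhds hX] with Z hZ
    rw [kphi, div_mul_cancel₀ _ (mul_pos two_pos hZ.2).ne']
  have h2 := congrArg (fun A : Coord n × Coord n →L[ℝ] ℝ => A (p, q)) h1.fderiv_eq
  rw [fderiv_mul_apply (h.sm_kphi.differentiableAt hX)
      ((h.sm_b.differentiableAt hX).const_mul 2), fderiv_const_mul (h.sm_b.differentiableAt hX),
    h.fderiv_met_total hx, _root_.smul_apply, h.fderiv_b_total hx, h.kphi_eq hx] at h2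
  simp only [smul_eq_mul, h.lin_b hx] at h2
  change _ = _ + 2 * (h.point hx).g (h.point hx).b y * _ at h2
  have hb := (h.g_b_pos hx hX).ne'
  rw [PointData.phiW]
  field_simp
  linarith

lemma phi_mul_kproj : (h.point hx).phi y * kproj a b (x, y) =
    -((h.point hx).phi y * (h.point hx).sig y
      + (h.point hx).g ((h.point hx).R y) y / 2) := by
  have h1 := (h.phi_pos hx hX).ne'
  simp only [kproj, h.kphi_eq hx, h.lin_sVec_eq hx, h.bil_r_eq hx]
  field_simp

/-- The derivative of φ(P + s_0) = −½ r_00, left in product form so that no quotient by φ is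
differentiated. -/
lemma fderiv_kproj : fderiv ℝ (kphi a b) (x, y) (p, q)
      * (kproj a b (x, y) + (h.point hx).sig y)
      + (h.point hx).phi y * (fderiv ℝ (kproj a b) (x, y) (p, q)
        + ((h.point hx).s1 y p + (h.point hx).sig (Gam a x y p + q))) =
    -((h.point hx).r2 y y p / 2 + (h.point hx).g ((h.point hx).R y) (Gam a x y p + q)) := by
  have h1 : (fun X : Coord n × Coord n =>
      kphi a b X * (kproj a b X + lin (fun i => sVec a b i X.1) X.2)) =ᶠ[𝓝 (x, y)]
      fun X => (-1 / 2) * bil (fun i j => r a b i j X.1) X.2 X.2 := by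
    filter_upwards [h.isOpen_kDom.mem_nhds hX] with Z hZ
    have := (h.kphi_pos hZ).ne'
    rw [kproj]
    field_simp
    ring
  have h2 := congrArg (fun A : Coord n × Coord n →L[ℝ] ℝ => A (p, q)) h1.fderiv_eq
  rw [fderiv_mul_apply (h.sm_kphi.differentiableAt hX)
      ((h.sm_kproj.differentiableAt hX).fun_add (h.sm_sVec.differentiableAt hX)),
    fderiv_fun_add (h.sm_kproj.differentiableAt hX) (h.sm_sVec.differentiableAt hX),
    fderiv_const_mul (h.sm_r.differentiableAt hX), _root_.smul_apply, h.fderiv_r_total hx,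
    _root_.add_apply, h.fderiv_sVec_total hx, h.kphi_eq hx] at h2
  simp only [smul_eq_mul, h.lin_sVec_eq hx] at h2
  linarith

lemma fderiv_kspray (w : Coord n) : fderiv ℝ (kspray a b) (x, y) (0, w) =
    Gam a x y w + (h.point hx).TW y w + fderiv ℝ (kproj a b) (x, y) (0, w) • y
      + kproj a b (x, y) • w := by
  have h1 := (((h.sm_Gam.differentiableAt hX).hasFDerivAt.const_smul (1 / 2 : ℝ)).add
    ((h.sm_kphi.differentiableAt hX).hasFDerivAt.smul (h.sm_Uop.differentiableAt hX).hasFDerivAt)).add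
    (((h.sm_r.differentiableAt hX).hasFDerivAt.const_mul (1 / 2 : ℝ)).smul
      (h.sm_bv.differentiableAt hX).hasFDerivAt)
  have h2 := (h1.add ((h.sm_kproj.differentiableAt hX).hasFDerivAt.smul
    (hasFDerivAt_snd (𝕜 := ℝ) (E := Coord n) (F := Coord n) (p := (x, y))))).fderiv
  have h3 : fderiv ℝ (kspray a b) (x, y) = _ := h2
  have h4 : fderiv ℝ (fun X : Coord n × Coord n => bv a b X.1) (x, y) (0, w) = 0 := by
    rw [← fderiv_snd_eq (h.sm_bv.differentiableAt hX)]
    simp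
  rw [h3]
  simp only [_root_.add_apply, _root_.smul_apply, ContinuousLinearMap.smulRight_apply, h4,
    smul_zero, zero_add]
  rw [fderiv_fiberBil (Q := Gam a) (fun u v => h.Gam_smooth hx u v),
    fderiv_fiberLin (L := Uop a b) (fun v => h.Uop_smooth hx v), h.fderiv_kphi hx hX,
    h.fderiv_r_total hx, h.Uop_eq hx, h.Uop_eq hx, h.kphi_eq hx, h.Gam_symm hx w y]
  simp only [map_zero, zero_add, PointData.d, add_zero, mul_zero, zero_div, sub_zero,
    PointData.TW, smul_eq_mul]
  change _ + (_ * (2 * (h.point hx).g ((h.point hx).R y) w)) • (h.point hx).b + _ = _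
  simp only [ContinuousLinearMap.coe_snd']
  module

end Derivatives

end LocalData

end KropinaSpray


/-! ### Horizontal constancy of φ and the curvature of the candidate spray. -/

section KropinaCurvature

open Topology

variable {n : ℕ} {a : Coord n → Matrix (Fin n) (Fin n) ℝ} {b : Fin n → Coord n → ℝ}

namespace PointData

variable {E : Type*} [AddCommGroup E] [Module ℝ E] (D : PointData E)

lemma phiW_add (y u v : E) : D.phiW y (u + v) = D.phiW y u + D.phiW y v := by
  simp only [phiW, map_add]; ring

lemma phiW_smul (y v : E) (t : ℝ) : D.phiW y (t • v) = t * D.phiW y v := by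
  simp only [phiW, map_smul, smul_eq_mul]; ring

lemma sig_b : D.sig D.b = 0 := by
  have h := D.S_skew D.b D.b
  rw [D.g_symm D.b] at h
  simp only [sig]
  linarith

lemma g_b_U (v : E) : D.g D.b (D.U v) = 0 := by
  rw [D.g_symm, U]
  simp only [map_sub, map_smul, LinearMap.sub_apply, LinearMap.smul_apply, smul_eq_mul, D.b_unit,
    sig]
  ring

lemma g_R_b (v : E) : D.g (D.R v) D.b = -D.sig v := by
  rw [D.R_symm, D.R_b, sig, D.S_skew]; ring

lemma phi_mul (y : E) (hy : D.g D.b y ≠ 0) : D.g y y = 2 * D.phi y * D.g D.b y := by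
  rw [phi]; field_simp

lemma phiW_self (y : E) (hy : D.g D.b y ≠ 0) : D.phiW y y = D.phi y := by
  rw [phiW, D.phi_mul y hy]
  field_simp
  ring

lemma sig_add (u v : E) : D.sig (u + v) = D.sig u + D.sig v := by simp [sig]

lemma sig_smul (t : ℝ) (v : E) : D.sig (t • v) = t * D.sig v := by simp [sig]

lemma U_add (u v : E) : D.U (u + v) = D.U u + D.U v := by
  simp only [U, sig_add, map_add]; module

lemma U_smul (t : ℝ) (v : E) : D.U (t • v) = t • D.U v := by
  simp only [U, sig_smul, map_smul]; module

lemma U_sub (u v : E) : D.U (u - v) = D.U u - D.U v := by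
  rw [sub_eq_add_neg, ← neg_one_smul ℝ v, U_add, U_smul]; module

lemma U_neg (v : E) : D.U (-v) = -D.U v := by
  rw [← neg_one_smul ℝ v, U_smul]; module

/-- Here P is the projective factor, Q its derivative along the spray, and z stands for Γ(y,y). The
factor 0 in `hQ` is the derivative of φ along the spray. The summand P y of the spray contributes −Q
− P² as coefficient of δ to the curvature. -/
lemma kproj_eq_projTerm {y z : E} {P Q : ℝ} (hb : 0 < D.g D.b y) (hφ : 0 < D.phi y)
    (hP : D.phi y * P = -(D.phi y * D.sig y + D.g (D.R y) y / 2))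
    (hQ : 0 * (P + D.sig y) + D.phi y * (Q + (D.s1 y y
        + D.sig (z + (-z - (2 : ℝ) • D.T y - (2 * P) • y)))) =
      -(D.r2 y y y / 2 + D.g (D.R y) (z + (-z - (2 : ℝ) • D.T y - (2 * P) • y)))) :
    -Q - P ^ 2 = D.projTerm y := by
  have hz : z + (-z - (2 : ℝ) • D.T y - (2 * P) • y) = (-2 : ℝ) • D.T y + (-2 * P) • y := by module
  rw [hz] at hQ
  simp only [T, sig_add, sig_smul, map_add, map_smul, smul_eq_mul, D.sig_b, D.g_R_b] at hQ
  have hg := D.phi_mul y hb.ne'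
  have hP' : P = -(D.sig y + D.g (D.R y) y / (2 * D.phi y)) := by
    field_simp
    linarith
  have hQ' : Q = -(D.r2 y y y / 2 + ((-2) * (D.phi y * D.g (D.R y) (D.U y)
      + D.g (D.R y) y / 2 * -D.sig y) + -2 * P * D.g (D.R y) y)) / D.phi y
      - (D.s1 y y + ((-2) * (D.phi y * D.sig (D.U y) + D.g (D.R y) y / 2 * 0)
        + -2 * P * D.sig y)) := by
    field_simp
    linarith
  rw [hQ', projTerm, hg, hP']
  field_simp
  ring

end PointData

namespace LocalData

variable {U : Set (Coord n)} (h : LocalData a b U)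

include h

lemma homog_kspray : Homog (kDom b U) (kspray a b) := by
  rintro ⟨x, y⟩ hX
  have hx := hX.1
  rw [h.fderiv_kspray hx hX]
  have h1 := h.fderiv_kproj hx hX 0 y
  have h2 := h.phi_mul_kproj hx hX
  have h3 := h.phi_pos hx hX
  rw [h.fderiv_kphi hx hX] at h1
  have hb := (h.g_b_pos hx hX).ne'
  have hz : (h.point hx).s1 y 0 = 0 := by simp [PointData.s1]
  have hd : (h.point hx).d y 0 = 0 := by simp [PointData.d]
  simp only [map_zero, zero_add, hz, hd, mul_zero, zero_div, sub_zero,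
    (h.point hx).phiW_self y hb] at h1
  -- P is homogeneous of degree one: this is the derivative of φ(P + s_0) = −½ r_00 in the direction
  -- y.
  have h4 : fderiv ℝ (kproj a b) (x, y) (0, y) = kproj a b (x, y) := by
    have : (h.point hx).phi y * fderiv ℝ (kproj a b) (x, y) (0, y)
      = (h.point hx).phi y * kproj a b (x, y) := by linarith
    exact mul_left_cancel₀ h3.ne' this
  rw [h4]
  simp only [kspray, h.kphi_eq hx, h.Uop_eq hx, h.bil_r_eq hx, PointData.TW,
    (h.point hx).phiW_self y hb]
  change _ + (_ + _ + _ • bv a b x) + _ + _ = _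
  module

/-- Inserting the vertical derivative of the spray into dφ, the condition becomes the vertical
derivative of φ(P + s_0) = −½ r_00. The projective factor P is chosen to satisfy exactly this
relation. -/
lemma horConst_kphi : HorConst (kDom b U) (kspray a b) (kphi a b) := by
  rintro ⟨x, y⟩ hX w
  have hx := hX.1
  have hb := (h.g_b_pos hx hX).ne'
  have h1 := h.fderiv_kproj hx hX 0 w
  have h2 := h.phi_mul_kproj hx hX
  have hz : (h.point hx).s1 y 0 = 0 := by simp [PointData.s1]
  have hd : (h.point hx).d y 0 = 0 := by simp [PointData.d]
  rw [h.fderiv_kspray hx hX, h.fderiv_kphi hx hX, h.fderiv_kphi hx hX]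
  rw [h.fderiv_kphi hx hX] at h1
  simp only [map_zero, zero_add, hz, hd, mul_zero, zero_div, sub_zero, add_zero] at h1 ⊢
  simp only [PointData.phiW_add, PointData.phiW_smul, (h.point hx).phiW_self y hb]
  generalize fderiv ℝ (kproj a b) (x, y) (0, w) = Pw at h1 ⊢
  generalize kproj a b (x, y) = P at h1 h2 ⊢
  have h5 (v) : (h.point hx).phiW y ((h.point hx).U v) = (h.point hx).sig v
      - (h.point hx).g y ((h.point hx).S v) / (h.point hx).g (h.point hx).b y := by
    rw [PointData.phiW, PointData.g_b_U, PointData.U]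
    simp only [map_sub, map_smul, smul_eq_mul, (h.point hx).g_symm y (h.point hx).b]
    field_simp
    ring
  have h6 : (h.point hx).phiW y (h.point hx).b = 1
      - (h.point hx).phi y / (h.point hx).g (h.point hx).b y := by
    rw [PointData.phiW, PointData.b_unit, (h.point hx).g_symm y (h.point hx).b]
    field_simp
  have h7 : (h.point hx).g y ((h.point hx).S y) = 0 := by
    have := (h.point hx).S_skew y y
    rw [(h.point hx).g_symm] at this
    linarith
  simp only [PointData.TW, PointData.phiW_add, PointData.phiW_smul, h5, h6, h7, PointData.d,
    map_add, (h.point hx).R_symm]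
  rw [PointData.R_symm] at h1
  linear_combination -h1

/-- The contraction of the curvature of `α²/β` with vectors. -/
theorem curvVec_kspray {x y : Coord n} (hx : x ∈ U) (hX : (x, y) ∈ kDom b U) (κ w : Coord n)
    (hκ : (h.point hx).g κ y = 0) :
    (h.point hx).g κ (curvVec (kspray a b) (x, y) w) = (h.point hx).curv κ w y := by
  set D := h.point hx with hD
  have hW := h.isOpen_kDom
  have s1 : Sm (kDom b U) fun X => (1 / 2 : ℝ) * met a x κ (Gam a X.1 X.2 X.2) := fun X hX =>
    contDiffAt_const.mul
      ((LinearMap.toContinuousLinearMap (met a x κ)).contDiff.contDiffAt.comp X (h.sm_Gam X hX))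
  have s1' : Sm (kDom b U) fun X => met a x κ (Gam a X.1 X.2 X.2) := fun X hX =>
    (LinearMap.toContinuousLinearMap (met a x κ)).contDiff.contDiffAt.comp X (h.sm_Gam X hX)
  have s2 : Sm (kDom b U) fun X => met a x κ (Uop a b X.1 X.2) := fun X hX =>
    (LinearMap.toContinuousLinearMap (met a x κ)).contDiff.contDiffAt.comp X (h.sm_Uop X hX)
  have s3 : Sm (kDom b U) fun X => met a x κ (bv a b X.1) := fun X hX =>
    (LinearMap.toContinuousLinearMap (met a x κ)).contDiff.contDiffAt.comp X (h.sm_bv X hX)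
  have s4 : Sm (kDom b U) fun X => met a x κ X.2 := fun X hX =>
    (LinearMap.toContinuousLinearMap (met a x κ)).contDiff.contDiffAt.comp X contDiffAt_snd
  have s5 : Sm (kDom b U) fun X => kphi a b X * met a x κ (Uop a b X.1 X.2) := fun X hX =>
    (h.sm_kphi X hX).mul (s2 X hX)
  have s6 : Sm (kDom b U) fun X => 1 / 2 * bil (fun i j => r a b i j X.1) X.2 X.2 := fun X hX =>
    contDiffAt_const.mul (h.sm_r X hX)
  have s7 : Sm (kDom b U) fun X =>
      (1 / 2 * bil (fun i j => r a b i j X.1) X.2 X.2) * met a x κ (bv a b X.1) := fun X hX =>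
    (s6 X hX).mul (s3 X hX)
  have s8 : Sm (kDom b U) fun X => kproj a b X * met a x κ X.2 := fun X hX =>
    (h.sm_kproj X hX).mul (s4 X hX)
  have sc : Sm (kDom b U) fun _ => (1 / 2 : ℝ) := fun X hX => contDiffAt_const
  have e1 := curvVec_eq_cOp hW h.sm_kspray hX (LinearMap.toContinuousLinearMap (met a x κ)) w
  have e2 : (fun X => LinearMap.toContinuousLinearMap (met a x κ) (kspray a b X)) =
      fun X => (1 / 2 : ℝ) * met a x κ (Gam a X.1 X.2 X.2)
        + kphi a b X * met a x κ (Uop a b X.1 X.2)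
        + (1 / 2 * bil (fun i j => r a b i j X.1) X.2 X.2) * met a x κ (bv a b X.1)
        + kproj a b X * met a x κ X.2 := by
    funext X
    simp [kspray]
  -- The four summands of the spray are treated by the Leibniz rule. Both the operator and the spray
  -- derivative vanish on φ, so only the vertical derivative of φ survives.
  rw [e2, cOp_add hW (fun X hX => ((s1 X hX).add (s5 X hX)).add (s7 X hX)) s8 hX,
    cOp_add hW (fun X hX => (s1 X hX).add (s5 X hX)) s7 hX, cOp_add hW s1 s5 hX,
    cOp_mul hW sc s1' hX, cOp_mul hW h.sm_kphi s2 hX, cOp_mul hW s6 s3 hX,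
    cOp_mul hW sc h.sm_r hX, cOp_mul hW h.sm_kproj s4 hX,
    h.horConst_kphi.cOp_eq_zero hW h.sm_kspray h.sm_kphi h.homog_kspray hX,
    h.horConst_kphi.fderiv_spray h.homog_kspray hX] at e1
  have c0 (ξ Y) : cOp (fun _ => (1 / 2 : ℝ)) (x, y) w ξ Y = 0 := by simp [cOp]
  have c1 (ξ Y) : cOp (fun X => met a x κ (Gam a X.1 X.2 X.2)) (x, y) w ξ Y =
      2 * (D.g κ (dGam a x w y y) - D.g κ (dGam a x ξ.1 w y) - D.g κ (Gam a x w ξ.2)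
        - D.g κ (Gam a x y Y)) := by
    have hc := cOp_fiberBil (Q := fun z => (Gam a z).compr₂ (met a x κ)) hW hX
      (fun Z hZ u v => (LinearMap.toContinuousLinearMap (met a x κ)).contDiff.contDiffAt.comp Z.1
        (h.Gam_smooth hZ.1 u v))
      (fun Z hZ u v => by simp only [LinearMap.compr₂_apply, h.Gam_symm hZ.1 u v]) w ξ Y
    simp only [LinearMap.compr₂_apply, h.fderiv_Gam_const hx] at hc
    exact hc
  have c2 (ξ Y) : cOp (fun X => met a x κ (Uop a b X.1 X.2)) (x, y) w ξ Y =
      2 * (D.dU κ y w + D.g κ (D.U (Gam a x y w)) - D.g κ (Gam a x (D.U y) w))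
        - (D.dU κ w ξ.1 + D.g κ (D.U (Gam a x w ξ.1)) - D.g κ (Gam a x (D.U w) ξ.1))
        - D.g κ (D.U Y) := by
    have hc := cOp_fiberLin (L := fun z => met a x κ ∘ₗ Uop a b z) hW hX
      (fun Z hZ v => (LinearMap.toContinuousLinearMap (met a x κ)).contDiff.contDiffAt.comp Z.1
        (h.Uop_smooth hZ.1 v)) w ξ Y
    simp only [LinearMap.comp_apply, h.fderiv_Uop_const hx, h.Uop_eq hx] at hc
    exact hc
  have c3 (ξ Y) : cOp (fun X => met a x κ (bv a b X.1)) (x, y) w ξ Y =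
      2 * (D.d κ w - D.g κ (Gam a x D.b w)) := by
    have hc := cOp_fst (f := fun z => met a x κ (bv a b z)) hW hX
      (fun Z hZ => (LinearMap.toContinuousLinearMap (met a x κ)).contDiff.contDiffAt.comp Z.1
        (h.bv_smooth hZ.1)) w ξ Y
    rw [h.fderiv_bv_const hx] at hc
    exact hc
  have c4 (ξ Y) : cOp (fun X => bil (fun i j => r a b i j X.1) X.2 X.2) (x, y) w ξ Y =
      2 * (D.r2 y y w + 2 * D.g (D.R y) (Gam a x y w)
        - (D.r2 w y ξ.1 + D.g (D.R y) (Gam a x w ξ.1) + D.g (D.R w) (Gam a x y ξ.1))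
        - D.g (D.R w) ξ.2 - D.g (D.R y) Y) := by
    have hc := cOp_fiberBil (Q := fun z => bil fun i j => r a b i j z) hW hX
      (fun Z hZ u v => h.bilr_smooth hZ.1 u v)
      (fun Z hZ u v => by rw [h.bil_r hZ.1, h.bil_r hZ.1, ← h.Rop_symm hZ.1, h.met_symm hZ.1])
      w ξ Y
    simp only [h.fderiv_r_const hx, h.bil_r_eq hx] at hc
    rw [hc]
    ring
  have c5 (ξ Y) : cOp (fun X => met a x κ X.2) (x, y) w ξ Y = -D.g κ Y := by
    have hc := cOp_fiberLin (L := fun _ => met a x κ) hW hX (fun Z hZ v => contDiffAt_const) w ξ Y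
    simp only [fderiv_fun_const, Pi.zero_apply, _root_.zero_apply, mul_zero, sub_zero,
      zero_sub] at hc
    exact hc
  have d2 (p q) : fderiv ℝ (fun X : Coord n × Coord n => met a x κ (Uop a b X.1 X.2)) (x, y) (p, q)
      = D.dU κ y p + D.g κ (D.U (Gam a x y p)) - D.g κ (Gam a x (D.U y) p) + D.g κ (D.U q) := by
    have hc := fderiv_fiberLin (L := fun z => met a x κ ∘ₗ Uop a b z) (x := x) (y := y)
      (fun v => (LinearMap.toContinuousLinearMap (met a x κ)).contDiff.contDiffAt.comp x
        (h.Uop_smooth hx v)) p q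
    simp only [LinearMap.comp_apply, h.fderiv_Uop_const hx, h.Uop_eq hx] at hc
    exact hc
  have d3 (p q) : fderiv ℝ (fun X : Coord n × Coord n => met a x κ (bv a b X.1)) (x, y) (p, q)
      = D.d κ p - D.g κ (Gam a x D.b p) := by
    have hc := HasFDerivAt.comp (x, y) (g := fun z => met a x κ (bv a b z)) (f := Prod.fst)
      (((LinearMap.toContinuousLinearMap (met a x κ)).contDiff.contDiffAt.comp x
        (h.bv_smooth hx)).differentiableAt (by simp)).hasFDerivAt
      (hasFDerivAt_fst (𝕜 := ℝ) (E := Coord n) (F := Coord n) (p := (x, y)))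
    have hc' : fderiv ℝ (fun X : Coord n × Coord n => met a x κ (bv a b X.1)) (x, y) = _ := hc.fderiv
    rw [hc']
    exact h.fderiv_bv_const hx κ p
  have d4 (p q) : fderiv ℝ (fun X : Coord n × Coord n => met a x κ X.2) (x, y) (p, q) = D.g κ q := by
    rw [fderiv_fiberLin (L := fun _ => met a x κ) (fun v => contDiffAt_const)]
    simp only [fderiv_fun_const, Pi.zero_apply, _root_.zero_apply, zero_add]
    rfl
  have d6 : fderiv ℝ (fun X : Coord n × Coord n => 1 / 2 * bil (fun i j => r a b i j X.1) X.2 X.2)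
      (x, y) (0, w) = D.g (D.R y) w := by
    rw [fderiv_const_mul (h.sm_r.differentiableAt hX), _root_.smul_apply, h.fderiv_r_total hx]
    simp only [map_zero, zero_add, smul_eq_mul]
    ring
  have d7 : D.d κ 0 - D.g κ (Gam a x D.b 0) = 0 := by simp [PointData.d]
  have hξ : sprayVec (kspray a b) (x, y) = (y, -Gam a x y y - (2 : ℝ) • D.T y
      - (2 * kproj a b (x, y)) • y) := by
    simp only [sprayVec, kspray, h.kphi_eq hx, h.Uop_eq hx, h.bil_r_eq hx, PointData.T, Prod.mk.injEq,
      true_and]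
    change _ = _ - (2 : ℝ) • (_ + _ • bv a b x) - _
    module
  have p1 := h.fderiv_kproj hx hX y (-Gam a x y y - (2 : ℝ) • D.T y - (2 * kproj a b (x, y)) • y)
  have p0 := h.horConst_kphi.fderiv_spray h.homog_kspray hX
  rw [hξ] at p0
  rw [p0] at p1
  have p2 := h.fderiv_kproj hx hX 0 w
  have p3 := h.phi_mul_kproj hx hX
  rw [h.fderiv_kphi hx hX] at p2
  have hz : D.s1 y 0 = 0 := by simp [PointData.s1]
  have hd : D.d y 0 = 0 := by simp [PointData.d]
  have hφ := h.phi_pos hx hX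
  have hb := h.g_b_pos hx hX
  have hΓ := h.Gam_symm hx w y
  have hR4 : D.R4 κ y w y = D.g κ (dGam a x w y y) - D.g κ (dGam a x y w y)
      + D.g κ (Gam a x w (Gam a x y y)) - D.g κ (Gam a x y (Gam a x y w)) := by
    change met a x κ (Rvec a x y w y) = _
    simp only [Rvec, map_add, map_sub, h.dGam_symm hx y y w]
    rfl
  rw [c0, c1, c2, c3, c4, c5, h.fderiv_kspray hx hX, hξ, d2, d3, d3, d6, d7, d4, d4] at e1
  simp only [h.kphi_eq hx, h.bil_r_eq hx, h.Uop_eq hx, h.fderiv_kphi hx hX] at e1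
  -- Since κ is orthogonal to y, the summand P y enters through its coefficient of g(κ, w), besides
  -- the products of P with other terms that are removed at the end.
  have hpr := D.kproj_eq_projTerm hb hφ p3 p1
  rw [PointData.curv, hR4, ← hpr]
  have hmet : met a x = D.g := rfl
  have hbv : bv a b x = D.b := rfl
  simp only [← hD, hmet, hbv, hκ, fderiv_fun_const, Pi.zero_apply, _root_.zero_apply, map_zero,
    zero_add, hz, hd, mul_zero, zero_mul, zero_div, sub_zero, add_zero,
    LinearMap.coe_toContinuousLinearMap'] at e1 p2 p3
  rw [e1]
  clear e1 c0 c1 c2 c3 c4 c5 d2 d3 d4 d6 d7 p0 p1 hpr hξ hR4 e2 s1 s1' s2 s3 s4 s5 s6 s7 s8 sc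
  have q1 : D.g κ (D.T y) = D.phi y * D.g κ (D.U y) + D.g (D.R y) y / 2 * D.g D.b κ := by
    simp only [PointData.T, map_add, map_smul, smul_eq_mul, D.g_symm κ D.b]
  have q2 : D.g κ (D.TW y w) = D.phiW y w * D.g κ (D.U y) + D.phi y * D.g κ (D.U w)
      + D.g (D.R y) w * D.g D.b κ := by
    simp only [PointData.TW, map_add, map_smul, smul_eq_mul, D.g_symm κ D.b]
  have q3 : D.g κ (Gam a x w (D.T y)) = D.phi y * D.g κ (Gam a x w (D.U y))
      + D.g (D.R y) y / 2 * D.g κ (Gam a x w D.b) := by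
    simp only [PointData.T, map_add, map_smul, smul_eq_mul]
  have q4 : D.g κ (Gam a x y (D.TW y w)) = D.phiW y w * D.g κ (Gam a x y (D.U y))
      + D.phi y * D.g κ (Gam a x y (D.U w)) + D.g (D.R y) w * D.g κ (Gam a x y D.b) := by
    simp only [PointData.TW, map_add, map_smul, smul_eq_mul]
  simp only [map_add, map_sub, map_neg, map_smul, smul_eq_mul, PointData.U_add, PointData.U_sub,
    PointData.U_neg, PointData.U_smul, hκ, q1, q2, q3, q4, D.g_symm κ D.b, hΓ,
    h.Gam_symm hx (D.U y), h.Gam_symm hx (D.U w), h.Gam_symm hx D.b, D.r2_symm w y]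
  have q5 : D.g (D.R w) y = D.g (D.R y) w := by rw [D.R_symm, D.g_symm]
  -- The remaining occurrences of P and of its vertical derivative are eliminated by the relation φP
  -- = −(φ s_0 + ½ r_00) and its derivative.
  linear_combination -(2 * D.g κ (D.U w)) * p3 + D.g κ (D.U y) * p2
    + (2 * kproj a b (x, y) * D.g D.b κ) * q5

end LocalData

end KropinaCurvature


/-! ### The fundamental tensor, and the sprays and curvatures of α²/β and of α. -/

section SprayOfMetric

open Topology

variable {n : ℕ} {a : Coord n → Matrix (Fin n) (Fin n) ℝ} {b : Fin n → Coord n → ℝ}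

namespace PointData

variable {E : Type*} [AddCommGroup E] [Module ℝ E] (D : PointData E)

/-- The fundamental tensor of `α²/β`. -/
def fund (y u v : E) : ℝ :=
  4 * (D.phiW y u * D.phiW y v + D.phi y * ((D.g u v - D.phiW y u * D.g D.b v
    - D.phiW y v * D.g D.b u) / D.g D.b y))

lemma fund_add_left (y u u' v : E) : D.fund y (u + u') v = D.fund y u v + D.fund y u' v := by
  simp only [fund, phiW_add, map_add, LinearMap.add_apply]; ring

lemma fund_smul_left (y u v : E) (t : ℝ) : D.fund y (t • u) v = t * D.fund y u v := by
  simp only [fund, phiW_smul, map_smul, LinearMap.smul_apply, smul_eq_mul]; ring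

lemma fund_symm (y u v : E) : D.fund y u v = D.fund y v u := by
  simp only [fund, D.g_symm u v]; ring

lemma fund_self (y v : E) (hb : D.g D.b y ≠ 0) : D.fund y y v = 4 * D.phi y * D.phiW y v := by
  have h : D.g y v = D.phiW y v * D.g D.b y + D.phi y * D.g D.b v := by
    rw [phiW]; field_simp; ring
  rw [fund, D.phiW_self y hb, h]
  field_simp
  ring

lemma cauchy_schwarz (u v : E) : D.g u v ^ 2 ≤ D.g u u * D.g v v := by
  by_cases hu : u = 0
  · simp [hu]
  · have h0 := D.g_pos u hu
    have h := D.g_nonneg (D.g u u • v - D.g u v • u)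
    simp only [map_sub, map_smul, LinearMap.sub_apply, LinearMap.smul_apply, smul_eq_mul,
      D.g_symm v u] at h
    have : 0 ≤ D.g u u * (D.g u u * D.g v v - D.g u v ^ 2) := by linarith
    nlinarith [nonneg_of_mul_nonneg_right this h0]

/-- Write f for the derivative of φ along v and k = φ b(v)/β. The tensor is 4(f² + φ|v|²/β − 2fk),
and Cauchy–Schwarz for y and v gives φ|v|²/β ≥ ½(f + k)². The bracket is therefore at least f² + ½(f
− k)². -/
lemma fund_pos {y v : E} (hb : 0 < D.g D.b y) (hφ : 0 < D.phi y) (hv : v ≠ 0) :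
    0 < D.fund y v v := by
  have h1 := D.cauchy_schwarz y v
  have h2 := D.phi_mul y hb.ne'
  have h3 : D.g y v = D.phiW y v * D.g D.b y + D.phi y * D.g D.b v := by
    rw [phiW]; field_simp; ring
  have h4 := D.g_pos v hv
  rw [h2, h3] at h1
  have e : D.fund y v v = 4 * (D.phiW y v ^ 2 + D.phi y / D.g D.b y * (D.g v v
      - 2 * D.phiW y v * D.g D.b v)) := by
    rw [fund]; ring
  rw [e]
  generalize D.phiW y v = f at *
  generalize D.g D.b v = m at *
  generalize D.g v v = N at *
  generalize D.g D.b y = β at *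
  generalize D.phi y = φ at *
  have h5 : (f * β + φ * m) ^ 2 / (2 * β ^ 2) ≤ φ / β * N := by
    rw [div_le_iff₀ (by positivity)]
    calc _ ≤ 2 * φ * β * N := h1
      _ = _ := by field_simp
  set k := φ * m / β with hk
  have h6 : (f * β + φ * m) ^ 2 / (2 * β ^ 2) = (f + k) ^ 2 / 2 := by
    rw [hk]; field_simp
  have h7 : φ / β * (N - 2 * f * m) = φ / β * N - 2 * f * k := by
    rw [hk]; field_simp
  have h8 : 0 < φ / β * N := by positivity
  rw [h7]
  rw [h6] at h5
  -- For f = 0 the lower bound may be zero, but then the bracket is φ|v|²/β itself.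
  by_cases hf : f = 0
  · subst hf; linarith
  · have : 0 < f ^ 2 := by positivity
    nlinarith [sq_nonneg (f - k)]

end PointData

lemma isUnit_det_of_pos {A : Matrix (Fin n) (Fin n) ℝ}
    (hA : ∀ v : Coord n, v ≠ 0 → 0 < bil (fun i j => A i j) v v) : IsUnit A.det := by
  rw [isUnit_iff_ne_zero]
  intro h0
  obtain ⟨v, hv, h1⟩ := Matrix.exists_mulVec_eq_zero_iff.2 h0
  have h2 := hA (vec v) (fun h => hv (by funext i; simpa using congrArg (fun u : Coord n => u i) h))
  have h3 : bil (fun i j => A i j) (vec v) (vec v) = ∑ i, v i * A.mulVec v i := by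
    simp only [bil_apply, Matrix.mulVec, dotProduct, Finset.mul_sum, vec_apply]
    exact Finset.sum_congr rfl fun i _ => Finset.sum_congr rfl fun j _ => by ring
  rw [h3, h1] at h2
  simp at h2

namespace LocalData

variable {U : Set (Coord n)} (h : LocalData a b U)

include h

lemma sm_four_kphi_sq : Sm (kDom b U) fun X => 4 * kphi a b X ^ 2 := fun X hX =>
  contDiffAt_const.mul ((h.sm_kphi X hX).pow 2)

lemma fderiv_four_kphi_sq {X : Coord n × Coord n} (hX : X ∈ kDom b U) (v : Coord n × Coord n) :
    fderiv ℝ (fun X => 4 * kphi a b X ^ 2) X v = 8 * (kphi a b X * fderiv ℝ (kphi a b) X v) := by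
  have h1 := ((h.sm_kphi.differentiableAt hX).hasFDerivAt.pow 2).const_mul 4
  have h2 : fderiv ℝ (fun X => 4 * kphi a b X ^ 2) X = _ := h1.fderiv
  rw [h2]
  simp
  ring

lemma horConst_four_kphi_sq :
    HorConst (kDom b U) (kspray a b) (fun X => 4 * kphi a b X ^ 2) := fun X hX w => by
  rw [h.fderiv_four_kphi_sq hX, h.fderiv_four_kphi_sq hX, h.horConst_kphi X hX]

section Point

variable {x y : Coord n} (hx : x ∈ U) (hX : (x, y) ∈ kDom b U)

include hx hX

/-- The vertical derivative of φ along w satisfies β φ_w = a(w, y) − φ b(w). One more vertical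
derivative of this product gives the Hessian. -/
lemma fderiv_fderiv_kphi (v w : Coord n) :
    fderiv ℝ (fun Z => fderiv ℝ (kphi a b) Z (0, w)) (x, y) (0, v) =
      ((h.point hx).g v w - (h.point hx).phiW y v * (h.point hx).g (h.point hx).b w
        - (h.point hx).phiW y w * (h.point hx).g (h.point hx).b v)
        / (h.point hx).g (h.point hx).b y := by
  have hv (v) : fderiv ℝ (kphi a b) (x, y) (0, v) = (h.point hx).phiW y v := by
    rw [h.fderiv_kphi hx hX]
    simp [PointData.d]
  have h1 : (fun Z : Coord n × Coord n => fderiv ℝ (kphi a b) Z (0, w) * lin (fun i => b i Z.1) Z.2)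
      =ᶠ[𝓝 (x, y)] fun Z => met a Z.1 w Z.2 - kphi a b Z * (fun z => lin (fun i => b i z) w) Z.1 := by
    filter_upwards [h.isOpen_kDom.mem_nhds hX] with ⟨z, u⟩ hZ
    have hb := (h.g_b_pos hZ.1 hZ).ne'
    rw [h.fderiv_kphi hZ.1 hZ, h.kphi_eq hZ.1]
    simp only [PointData.d, PointData.phiW, map_zero, zero_add, add_zero, mul_zero, zero_div,
      sub_zero, h.lin_b hZ.1, h.met_symm hZ.1 w u]
    exact div_mul_cancel₀ _ hb
  have h2 := congrArg (fun A : Coord n × Coord n →L[ℝ] ℝ => A (0, v)) h1.fderiv_eq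
  have d1 : DifferentiableAt ℝ (fun Z : Coord n × Coord n => met a Z.1 w Z.2) (x, y) :=
    (contDiffAt_fiberLin (L := fun z => met a z w) (X := (x, y))
      fun v => h.met_smooth hx w v).differentiableAt (by simp)
  have d2 : DifferentiableAt ℝ (fun Z : Coord n × Coord n => (fun z => lin (fun i => b i z) w) Z.1)
      (x, y) :=
    ((h.linb_smooth hx w).comp (x, y) contDiffAt_fst).differentiableAt (by simp)
  have d3 : fderiv ℝ (fun Z : Coord n × Coord n => (fun z => lin (fun i => b i z) w) Z.1) (x, y)
      (0, v) = 0 := by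
    rw [← fderiv_snd_eq d2]
    simp
  rw [fderiv_mul_apply ((h.sm_kphi.smooth_fderiv_apply (0, w)).differentiableAt hX)
      (h.sm_b.differentiableAt hX), fderiv_fun_sub d1 ((h.sm_kphi.differentiableAt hX).fun_mul d2),
    _root_.sub_apply, fderiv_mul_apply (h.sm_kphi.differentiableAt hX) d2, d3,
    fderiv_fiberLin (L := fun z => met a z w) (fun v => h.met_smooth hx w v),
    h.fderiv_b_total hx, hv, hv] at h2
  simp only [map_zero, zero_add, mul_zero, PointData.d, add_zero, h.lin_b hx,
    h.met_symm hx w v] at h2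
  have hb := (h.g_b_pos hx hX).ne'
  rw [eq_div_iff hb]
  change _ + met a x (bv a b x) y * _ = met a x v w - met a x (bv a b x) w * _ at h2
  change _ * met a x (bv a b x) y = met a x v w - _ * met a x (bv a b x) w - _
  linarith

variable {F : Coord n → Coord n → ℝ}
  (hF : ∀ z ∈ U, ∀ y, F z y = met a z y y / lin (fun i => b i z) y)

include hF

omit h hx hX in
lemma sq_eq (z y : Coord n) (hz : (z, y) ∈ kDom b U) : F z y ^ 2 = 4 * kphi a b (z, y) ^ 2 := by
  rw [hF z hz.1, kphi]
  have := hz.2.ne'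
  field_simp
  ring

lemma bil_fundTensor (u v : Coord n) :
    bil (fun i j => fundTensor F x y i j) u v = (h.point hx).fund y u v := by
  have h0 (i j) : fundTensor F x y i j =
      (h.point hx).fund y (EuclideanSpace.single i 1) (EuclideanSpace.single j 1) := by
    rw [fundTensor_eq h.isOpen_kDom h.sm_four_kphi_sq hX (sq_eq hF)]
    have h1 := h.sm_four_kphi_sq.hasFDerivAt_fderiv_apply hX (0, EuclideanSpace.single i 1)
    have h2 := congrArg (fun A : Coord n × Coord n →L[ℝ] ℝ => A (0, EuclideanSpace.single j 1)) h1
    simp only [ContinuousLinearMap.flip_apply] at h2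
    rw [← h2]
    have h3 : (fun Z => fderiv ℝ (fun X => 4 * kphi a b X ^ 2) Z (0, EuclideanSpace.single i 1))
        =ᶠ[𝓝 (x, y)] fun Z => 8 * (kphi a b Z
          * fderiv ℝ (kphi a b) Z (0, EuclideanSpace.single i 1)) := by
      filter_upwards [h.isOpen_kDom.mem_nhds hX] with Z hZ using h.fderiv_four_kphi_sq hZ _
    have d1 := h.sm_kphi.differentiableAt hX
    have d2 := (h.sm_kphi.smooth_fderiv_apply (0, EuclideanSpace.single i 1)).differentiableAt hX
    rw [h3.fderiv_eq, fderiv_const_mul (d1.fun_mul d2), _root_.smul_apply, fderiv_mul_apply d1 d2,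
      h.fderiv_fderiv_kphi hx hX, h.fderiv_kphi hx hX, h.fderiv_kphi hx hX, h.kphi_eq hx,
      (h.point hx).fund_symm]
    simp only [PointData.d, map_zero, zero_add, mul_zero, zero_div, sub_zero, add_zero, smul_eq_mul,
      PointData.fund]
    ring
  rw [← sub_eq_zero]
  refine eq_zero_of_single (f := fun u => bil (fun i j => fundTensor F x y i j) u v
    - (h.point hx).fund y u v) (by intros; simp [PointData.fund_add_left]; ring)
    (by intros; simp [PointData.fund_smul_left]; ring) (fun i => ?_) u
  simp only [(h.point hx).fund_symm _ _ v]
  refine eq_zero_of_single (f := fun v => bil (fun i j => fundTensor F x y i j) _ v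
    - (h.point hx).fund y v _) (by intros; simp [PointData.fund_add_left]; ring)
    (by intros; simp [PointData.fund_smul_left]; ring) (fun j => ?_) v
  rw [bil_single, h0, PointData.fund_symm, sub_self]

lemma lowerDir_eq (k : Fin n) : lowerDir F k x y =
    4 * (h.point hx).phi y * (h.point hx).phiW y (EuclideanSpace.single k 1) := by
  rw [← (h.point hx).fund_self y _ (h.g_b_pos hx hX).ne', ← h.bil_fundTensor hx hX hF, lowerDir,
    bil_apply]
  simp

/-- The function F² = 4φ² is horizontally constant for the candidate because φ is, so the
Euler–Lagrange equation holds; positivity supplies the invertible fundamental tensor. -/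
lemma spray_kropina (i : Fin n) : spray F i x y = kspray a b (x, y) i := by
  refine spray_eq h.isOpen_kDom h.sm_four_kphi_sq hX (sq_eq hF) _ (isUnit_det_of_pos fun v hv => ?_)
    (fun w => ?_) i
  · rw [h.bil_fundTensor hx hX hF]
    exact (h.point hx).fund_pos (h.g_b_pos hx hX) (h.phi_pos hx hX) hv
  · exact h.horConst_four_kphi_sq.fderiv_vertical_sprayVec h.isOpen_kDom h.sm_kspray
      h.sm_four_kphi_sq h.homog_kspray hX w

omit hx in
theorem riemann_kropina (i k : Fin n) : riemann F i k x y =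
    curvVec (kspray a b) (x, y) (EuclideanSpace.single k 1) i :=
  riemann_eq_curvVec h.isOpen_kDom h.sm_kspray
    (fun _ _ hZ i => h.spray_kropina hZ.1 hZ hF i) hX i k

end Point

section Riemannian

lemma isOpen_prod : IsOpen (U ×ˢ (Set.univ : Set (Coord n))) := h.isOpen.prod isOpen_univ

lemma sm_met_univ : Sm (U ×ˢ Set.univ) fun X => met a X.1 X.2 X.2 :=
  fun _ hX => contDiffAt_fiberBil fun u v => h.met_smooth hX.1 u v

lemma sm_half_Gam : Sm (U ×ˢ Set.univ) fun X => (1 / 2 : ℝ) • Gam a X.1 X.2 X.2 :=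
  fun _ hX => (contDiffAt_fiberBil fun u v => h.Gam_smooth hX.1 u v).const_smul (1 / 2 : ℝ)

lemma fderiv_half_Gam {x : Coord n} (hx : x ∈ U) (y w : Coord n) :
    fderiv ℝ (fun X : Coord n × Coord n => (1 / 2 : ℝ) • Gam a X.1 X.2 X.2) (x, y) (0, w)
      = Gam a x y w := by
  have d1 : DifferentiableAt ℝ (fun X : Coord n × Coord n => Gam a X.1 X.2 X.2) (x, y) :=
    (contDiffAt_fiberBil (X := (x, y)) fun u v => h.Gam_smooth hx u v).differentiableAt (by simp)
  rw [fderiv_fun_const_smul d1, _root_.smul_apply,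
    fderiv_fiberBil (fun u v => h.Gam_smooth hx u v), h.Gam_symm hx w y, map_zero]
  module

lemma homog_half_Gam :
    Homog (U ×ˢ Set.univ) fun X : Coord n × Coord n => (1 / 2 : ℝ) • Gam a X.1 X.2 X.2 := by
  rintro ⟨x, y⟩ hX
  rw [h.fderiv_half_Gam hX.1]
  module

lemma horConst_met : HorConst (U ×ˢ Set.univ)
    (fun X : Coord n × Coord n => (1 / 2 : ℝ) • Gam a X.1 X.2 X.2)
    fun X => met a X.1 X.2 X.2 := by
  rintro ⟨x, y⟩ hX w
  have hx : x ∈ U := hX.1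
  rw [h.fderiv_half_Gam hx, h.fderiv_met_total hx, h.fderiv_met_total hx]
  simp

variable {x : Coord n} (hx : x ∈ U) {F : Coord n → Coord n → ℝ}
  (hF : ∀ z ∈ U, ∀ y, F z y = √(met a z y y))

include hx hF

/-- The same method with L = α². Only the square of F enters, which is smooth also at y = 0, so all
directions are allowed. -/
lemma spray_riemannian (y : Coord n) (i : Fin n) :
    spray F i x y = ((1 / 2 : ℝ) • Gam a x y y) i := by
  have hX : (x, y) ∈ U ×ˢ (Set.univ : Set (Coord n)) := ⟨hx, trivial⟩
  have hsq : ∀ z y, (z, y) ∈ U ×ˢ (Set.univ : Set (Coord n)) → F z y ^ 2 = met a z y y := by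
    intro z y hz
    rw [hF z hz.1, Real.sq_sqrt]
    exact (h.point hz.1).g_nonneg y
  refine spray_eq h.isOpen_prod h.sm_met_univ hX hsq _ (isUnit_det_of_pos fun v hv => ?_)
    (fun w => ?_) i
  · have h0 (i j) : fundTensor F x y i j = a x i j := by
      rw [fundTensor_eq h.isOpen_prod h.sm_met_univ hX hsq]
      have h1 := h.sm_met_univ.hasFDerivAt_fderiv_apply hX (0, EuclideanSpace.single i 1)
      have h2 := congrArg (fun A : Coord n × Coord n →L[ℝ] ℝ => A (0, EuclideanSpace.single j 1)) h1
      simp only [ContinuousLinearMap.flip_apply] at h2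
      rw [← h2]
      have h3 : (fun Z => fderiv ℝ (fun X : Coord n × Coord n => met a X.1 X.2 X.2) Z
          (0, EuclideanSpace.single i 1)) =ᶠ[𝓝 (x, y)]
          fun Z => 2 * (fun z => met a z (EuclideanSpace.single i 1)) Z.1 Z.2 := by
        filter_upwards [h.isOpen_prod.mem_nhds hX] with ⟨z, u⟩ hZ
        have hz : z ∈ U := hZ.1
        rw [h.fderiv_met_total hz, map_zero, zero_add, (h.point hz).g_symm]
        rfl
      have d1 : DifferentiableAt ℝ (fun Z : Coord n × Coord n =>
          (fun z => met a z (EuclideanSpace.single i 1)) Z.1 Z.2) (x, y) :=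
        (contDiffAt_fiberLin (X := (x, y)) fun v => h.met_smooth hx _ v).differentiableAt (by simp)
      rw [h3.fderiv_eq, fderiv_const_mul d1, _root_.smul_apply,
        fderiv_fiberLin (L := fun z => met a z (EuclideanSpace.single i 1))
          (fun v => h.met_smooth hx _ v)]
      simp [met]
    simp only [h0]
    exact h.met_pos hx v hv
  · exact h.horConst_met.fderiv_vertical_sprayVec h.isOpen_prod h.sm_half_Gam h.sm_met_univ
      h.homog_half_Gam hX w

/-- The spray is quadratic in y, so the operator `cOp` only meets first derivatives of Γ. They
combine with the products ΓΓ into the curvature tensor contracted twice with y. -/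
theorem riemann_riemannian (y : Coord n) (i k : Fin n) :
    riemann F i k x y = Rvec a x y (EuclideanSpace.single k 1) y i := by
  have hX : (x, y) ∈ U ×ˢ (Set.univ : Set (Coord n)) := ⟨hx, trivial⟩
  rw [riemann_eq_curvVec h.isOpen_prod h.sm_half_Gam
    (fun z y hZ i => h.spray_riemannian hZ.1 hF y i) hX i k]
  generalize EuclideanSpace.single k (1 : ℝ) = w
  refine congrArg (fun u : Coord n => u i) ?_
  refine h.met_ext hx fun κ => ?_
  have e1 := curvVec_eq_cOp h.isOpen_prod h.sm_half_Gam hX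
    (LinearMap.toContinuousLinearMap (met a x κ)) w
  refine Eq.trans e1 ?_
  have hc := cOp_fiberBil (Q := fun z => (1 / 2 : ℝ) • (Gam a z).compr₂ (met a x κ)) h.isOpen_prod hX
    (fun Z hZ u v => contDiffAt_const.mul
      ((LinearMap.toContinuousLinearMap (met a x κ)).contDiff.contDiffAt.comp Z.1
        (h.Gam_smooth hZ.1 u v)))
    (fun Z hZ u v => by simp only [LinearMap.smul_apply, LinearMap.compr₂_apply,
      h.Gam_symm hZ.1 u v]) w
      (sprayVec (fun X => (1 / 2 : ℝ) • Gam a X.1 X.2 X.2) (x, y)) (Gam a x y w)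
  have e2 : (fun Z : Coord n × Coord n => LinearMap.toContinuousLinearMap (met a x κ)
      ((1 / 2 : ℝ) • Gam a Z.1 Z.2 Z.2)) = fun Z : Coord n × Coord n =>
      ((1 / 2 : ℝ) • (Gam a Z.1).compr₂ (met a x κ)) Z.2 Z.2 := by
    funext Z
    simp
  have e3 (u v p) : fderiv ℝ (fun z => ((1 / 2 : ℝ) • (Gam a z).compr₂ (met a x κ)) u v) x p =
      1 / 2 * met a x κ (dGam a x p u v) := by
    have d1 : DifferentiableAt ℝ (fun z => met a x κ (Gam a z u v)) x :=
      ((LinearMap.toContinuousLinearMap (met a x κ)).contDiff.contDiffAt.comp x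
        (h.Gam_smooth hx u v)).differentiableAt (by simp)
    have e4 := fderiv_const_mul d1 (1 / 2 : ℝ)
    have e5 := congrArg (fun A : Coord n →L[ℝ] ℝ => A p) e4
    refine Eq.trans e5 ?_
    rw [_root_.smul_apply, h.fderiv_Gam_const hx]
    rfl
  rw [e2, h.fderiv_half_Gam hx, hc, e3, e3]
  simp only [sprayVec, LinearMap.smul_apply, LinearMap.compr₂_apply, smul_eq_mul, Rvec, map_add,
    map_sub, map_smul, h.dGam_symm hx y w y]
  ring

end Riemannian

end LocalData

end SprayOfMetric


/-! ### Index equations as equations between multilinear forms. -/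

section Translation

open Topology

variable {n : ℕ} {a : Coord n → Matrix (Fin n) (Fin n) ℝ} {b : Fin n → Coord n → ℝ}

/-- The vectors of the standard basis. -/
abbrev stdVec (i : Fin n) : Coord n := EuclideanSpace.single i 1

lemma sum_mul_map_stdVec (f : Coord n →ₗ[ℝ] ℝ) (v : Coord n) : ∑ l, v l * f (stdVec l) = f v := by
  conv_rhs => rw [← sum_smul_single v]
  simp [stdVec]

lemma sum_map_stdVec_mul (f : Coord n →ₗ[ℝ] ℝ) (v : Coord n) : ∑ l, f (stdVec l) * v l = f v := by
  simp only [mul_comm _ (v _)]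
  exact sum_mul_map_stdVec f v

namespace PointData

variable {E : Type*} [AddCommGroup E] [Module ℝ E] (D : PointData E)

lemma s1_add_left (u v p : E) : D.s1 (u + v) p = D.s1 u p + D.s1 v p := by
  simp only [s1, map_add, LinearMap.add_apply]; ring

lemma s1_smul_left (t : ℝ) (u p : E) : D.s1 (t • u) p = t * D.s1 u p := by
  simp only [s1, map_add, map_smul, LinearMap.smul_apply, smul_eq_mul]; ring

lemma s1_add_right (u p p' : E) : D.s1 u (p + p') = D.s1 u p + D.s1 u p' := by
  simp only [s1, map_add]; ring

lemma s1_smul_right (t : ℝ) (u p : E) : D.s1 u (t • p) = t * D.s1 u p := by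
  simp only [s1, map_add, map_smul, smul_eq_mul]; ring

lemma B_symm (μ : ℝ) (u v : E) : D.B μ u v = D.B μ v u := by
  simp only [B]; ring

lemma B_add_left (μ : ℝ) (u u' v : E) : D.B μ (u + u') v = D.B μ u v + D.B μ u' v := by
  simp only [B, BTerm, bbr, s1_add_left, s1_add_right, map_add, LinearMap.add_apply]; ring

lemma B_smul_left (μ t : ℝ) (u v : E) : D.B μ (t • u) v = t * D.B μ u v := by
  simp only [B, BTerm, bbr, s1_smul_left, s1_smul_right, map_smul, LinearMap.smul_apply,
    smul_eq_mul]; ring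

/-- `B_{ik}` as a bilinear form. -/
def BForm (μ : ℝ) : E →ₗ[ℝ] E →ₗ[ℝ] ℝ :=
  LinearMap.mk₂ ℝ (D.B μ) (D.B_add_left μ) (D.B_smul_left μ)
    (fun u v v' => by rw [B_symm, B_add_left, B_symm, D.B_symm μ v']) fun t u v => by
      rw [B_symm, B_smul_left, B_symm]; rfl

@[simp] lemma BForm_apply (μ : ℝ) (u v : E) : D.BForm μ u v = D.B μ u v := rfl

end PointData

variable (a b) in
/-- The constant `c = (tˡ_l - (n-3) sˡs_l)/(n-1)`. -/
def cst (x : Coord n) : ℝ :=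
  (tTrace a b x - ((n : ℝ) - 3) * sNormSq a b x) / ((n : ℝ) - 1)

namespace LocalData

variable {U : Set (Coord n)} (h : LocalData a b U) {x : Coord n} (hx : x ∈ U)

include h hx

lemma a_eq (i j : Fin n) : a x i j = (h.point hx).g (stdVec i) (stdVec j) :=
  (bil_single (fun i j => a x i j) i j).symm

lemma b_eq (i : Fin n) : b i x = (h.point hx).g (h.point hx).b (stdVec i) :=
  ((h.lin_b hx _).symm.trans (lin_single _ i)).symm

lemma r_eq (i j : Fin n) :
    r a b i j x = (h.point hx).g ((h.point hx).R (stdVec i)) (stdVec j) := by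
  rw [← h.bil_r_eq hx, bil_single]

lemma s_eq (i j : Fin n) :
    s a b i j x = (h.point hx).g (stdVec i) ((h.point hx).S (stdVec j)) :=
  ((h.met_Sop hx _ _).trans (bil_single _ i j)).symm

omit h hx in
lemma sUp_eq (k j : Fin n) : sUp a b k j x = Sop a b x (stdVec j) k := by
  simp [Sop, stdVec]

omit h hx in
lemma rUp_eq (k j : Fin n) : rUp a b k j x = Rop a b x (stdVec j) k := by
  simp [Rop, stdVec]

lemma q_eq (i j : Fin n) : q a b i j x =
    (h.point hx).g ((h.point hx).R (stdVec i)) ((h.point hx).S (stdVec j)) := by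
  simp only [q, h.r_eq hx, sUp_eq]
  exact sum_map_stdVec_mul ((h.point hx).g ((h.point hx).R (stdVec i))) _

lemma rSq_eq (i j : Fin n) : rSq a b i j x =
    (h.point hx).g ((h.point hx).R (stdVec i)) ((h.point hx).R (stdVec j)) := by
  simp only [rSq, h.r_eq hx, rUp_eq]
  exact sum_map_stdVec_mul ((h.point hx).g ((h.point hx).R (stdVec i))) _

lemma t_eq (i j : Fin n) : t a b i j x =
    -(h.point hx).g ((h.point hx).S (stdVec i)) ((h.point hx).S (stdVec j)) := by
  have h1 (k) : s a b i k x = (-(h.point hx).g ((h.point hx).S (stdVec i))) (stdVec k) := by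
    rw [h.s_eq hx, LinearMap.neg_apply, PointData.S_skew, neg_neg]
  simp only [t, h1, sUp_eq]
  exact sum_map_stdVec_mul (-(h.point hx).g ((h.point hx).S (stdVec i))) _

lemma sVec_eq (i : Fin n) : sVec a b i x = (h.point hx).sig (stdVec i) := by
  rw [← h.lin_sVec_eq hx, lin_single]

lemma tVec_eq (j : Fin n) : tVec a b j x =
    -(h.point hx).g ((h.point hx).S (h.point hx).b) ((h.point hx).S (stdVec j)) := by
  have h1 (i) : t a b i j x = (-((h.point hx).g.flip ((h.point hx).S (stdVec j))
      ∘ₗ (h.point hx).S)) (stdVec i) := by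
    rw [h.t_eq hx]; rfl
  simp only [tVec, h1]
  exact sum_mul_map_stdVec _ (bv a b x)

/-- The trace of a rank-one form. -/
lemma trace_rank_one (v : Coord n) (f : Coord n →ₗ[ℝ] ℝ) :
    ∑ l, ∑ m, (a x)⁻¹ l m * ((h.point hx).g v (stdVec m) * f (stdVec l)) = f v := by
  have h1 : (vec fun l => ∑ m, (a x)⁻¹ l m * met a x v (stdVec m)) = v := by
    refine h.met_ext hx fun u => ?_
    rw [met, bil_inv (h.isUnit_det hx), lin_apply]
    change ∑ i, met a x v (stdVec i) * u i = met a x u v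
    rw [sum_map_stdVec_mul, h.met_symm hx]
  rw [← sum_mul_map_stdVec f v]
  refine Finset.sum_congr rfl fun l _ => ?_
  conv_rhs => rw [← h1]
  rw [vec_apply, Finset.sum_mul]
  exact Finset.sum_congr rfl fun m _ => by rw [mul_assoc]; rfl

lemma trace_metric : ∑ l, ∑ m, (a x)⁻¹ l m * a x m l = n := by
  have h1 : ∀ l, ∑ m, (a x)⁻¹ l m * a x m l = 1 := fun l => by
    have := congrFun (congrFun (Matrix.nonsing_inv_mul _ (h.isUnit_det hx)) l) l
    rwa [Matrix.mul_apply, Matrix.one_apply_eq] at this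
  simp [h1]

lemma sNormSq_eq : sNormSq a b x =
    (h.point hx).g ((h.point hx).S (h.point hx).b) ((h.point hx).S (h.point hx).b) := by
  have h1 (v) : (h.point hx).sig v = (h.point hx).g (-(h.point hx).S (h.point hx).b) v := by
    rw [PointData.sig, PointData.S_skew, (h.point hx).g_symm, map_neg, LinearMap.neg_apply]
  simp only [sNormSq, h.sVec_eq hx, h1, mul_assoc]
  rw [h.trace_rank_one hx]
  simp

/-- The trace of the equation for t_{ij} is t^l_l = (n−1)c + (n−3) s^l s_l: the three rank-one terms
contribute −3 s^l s_l, the metric term n(c + s^l s_l), and the last term −c. -/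
lemma cst_eq_of_TEq (hn : 3 ≤ n) {c : ℝ} (hT : (h.point hx).TEq c) : c = cst a b x := by
  have hn' : ((n : ℝ) - 1) ≠ 0 := by
    have : (3 : ℝ) ≤ n := by exact_mod_cast hn
    linarith
  have h1 (v) : (h.point hx).sig v = (h.point hx).g (-(h.point hx).S (h.point hx).b) v := by
    rw [PointData.sig, PointData.S_skew, (h.point hx).g_symm, map_neg, LinearMap.neg_apply]
  have h2 (v) : (h.point hx).g ((h.point hx).S (h.point hx).b) ((h.point hx).S v) =
      (h.point hx).g (-(h.point hx).S ((h.point hx).S (h.point hx).b)) v := by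
    rw [map_neg, LinearMap.neg_apply, PointData.S_skew (h.point hx) ((h.point hx).S _), neg_neg]
  have h3 : tTrace a b x = -(h.point hx).g ((h.point hx).S (h.point hx).b)
        ((h.point hx).S (h.point hx).b)
      - (h.point hx).g ((h.point hx).S (h.point hx).b) ((h.point hx).S (h.point hx).b)
      - (h.point hx).g ((h.point hx).S (h.point hx).b) ((h.point hx).S (h.point hx).b)
      + (c + (h.point hx).g ((h.point hx).S (h.point hx).b) ((h.point hx).S (h.point hx).b)) * n
      - c := by
    have e1 := h.trace_rank_one hx (h.point hx).b
      ((h.point hx).g (-(h.point hx).S ((h.point hx).S (h.point hx).b)))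
    have e2 := h.trace_rank_one hx (-(h.point hx).S ((h.point hx).S (h.point hx).b))
      ((h.point hx).g (h.point hx).b)
    have e3 := h.trace_rank_one hx (-(h.point hx).S (h.point hx).b)
      ((h.point hx).g (-(h.point hx).S (h.point hx).b))
    have e4 := h.trace_metric hx
    have e5 := h.trace_rank_one hx (h.point hx).b ((h.point hx).g (h.point hx).b)
    have e0 (m l) : t a b m l x = -((h.point hx).g (h.point hx).b (stdVec m)
          * (h.point hx).g (-(h.point hx).S ((h.point hx).S (h.point hx).b)) (stdVec l))
        - (h.point hx).g (-(h.point hx).S ((h.point hx).S (h.point hx).b)) (stdVec m)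
          * (h.point hx).g (h.point hx).b (stdVec l)
        - (h.point hx).g (-(h.point hx).S (h.point hx).b) (stdVec m)
          * (h.point hx).g (-(h.point hx).S (h.point hx).b) (stdVec l)
        + (c + (h.point hx).g ((h.point hx).S (h.point hx).b) ((h.point hx).S (h.point hx).b))
          * a x m l
        - c * ((h.point hx).g (h.point hx).b (stdVec m)
          * (h.point hx).g (h.point hx).b (stdVec l)) := by
      rw [h.t_eq hx, hT, h1, h1, h2 (stdVec m), h2 (stdVec l), h.a_eq hx]
      ring
    have e6 (k X1 X2 X3 X4 X5 C c : ℝ) : k * (-X1 - X2 - X3 + C * X4 - c * X5) =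
        -(k * X1) - k * X2 - k * X3 + C * (k * X4) - c * (k * X5) := by ring
    simp only [tTrace, e0, e6, Finset.sum_sub_distrib, Finset.sum_add_distrib,
      Finset.sum_neg_distrib, ← Finset.mul_sum]
    rw [e1, e2, e3, e4, e5, (h.point hx).b_unit, ← h2,
      (h.point hx).g_symm (h.point hx).b, ← h2]
    simp
  rw [cst, h3, h.sNormSq_eq hx, eq_div_iff hn']
  ring

lemma TEquation_iff (hn : 3 ≤ n) : TEquation a b x ↔ (h.point hx).TEq (cst a b x) := by
  have hn' : ((n : ℝ) - 1) ≠ 0 := by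
    have : (3 : ℝ) ≤ n := by exact_mod_cast hn
    linarith
  have h1 (i j) : b i x * tVec a b j x + b j x * tVec a b i x - sVec a b i x * sVec a b j x
      + 1 / ((n : ℝ) - 1) * ((tTrace a b x + 2 * sNormSq a b x) * a x i j
        - (tTrace a b x - ((n : ℝ) - 3) * sNormSq a b x) * b i x * b j x) =
      -(h.point hx).g (h.point hx).b (stdVec i)
          * (h.point hx).g ((h.point hx).S (h.point hx).b) ((h.point hx).S (stdVec j))
        - (h.point hx).g (h.point hx).b (stdVec j)
          * (h.point hx).g ((h.point hx).S (h.point hx).b) ((h.point hx).S (stdVec i))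
        - (h.point hx).sig (stdVec i) * (h.point hx).sig (stdVec j)
        + (cst a b x + (h.point hx).g ((h.point hx).S (h.point hx).b)
          ((h.point hx).S (h.point hx).b)) * (h.point hx).g (stdVec i) (stdVec j)
        - cst a b x * (h.point hx).g (h.point hx).b (stdVec i)
          * (h.point hx).g (h.point hx).b (stdVec j) := by
    rw [← h.sNormSq_eq hx, h.b_eq hx, h.b_eq hx, h.tVec_eq hx, h.tVec_eq hx, h.sVec_eq hx,
      h.sVec_eq hx, h.a_eq hx, cst]
    field_simp
    ring
  constructor
  · intro hT i j
    rw [← sub_eq_zero]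
    set D := h.point hx with hD
    refine eq_zero_of_single (f := fun i => -D.g (D.S i) (D.S j) -
      (-D.g D.b i * D.g (D.S D.b) (D.S j) - D.g D.b j * D.g (D.S D.b) (D.S i) - D.sig i * D.sig j
        + (cst a b x + D.g (D.S D.b) (D.S D.b)) * D.g i j - cst a b x * D.g D.b i * D.g D.b j))
      (by intros; simp only [PointData.sig_add, map_add, LinearMap.add_apply]; ring)
      (by intros; simp only [PointData.sig_smul, map_smul, LinearMap.smul_apply, smul_eq_mul]; ring)
      (fun i => ?_) i
    refine eq_zero_of_single (f := fun j => -D.g (D.S _) (D.S j) -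
      (-D.g D.b _ * D.g (D.S D.b) (D.S j) - D.g D.b j * D.g (D.S D.b) (D.S _) - D.sig _ * D.sig j
        + (cst a b x + D.g (D.S D.b) (D.S D.b)) * D.g _ j - cst a b x * D.g D.b _ * D.g D.b j))
      (by intros; simp only [PointData.sig_add, map_add]; ring)
      (by intros; simp only [PointData.sig_smul, map_smul, smul_eq_mul]; ring)
      (fun j => ?_) j
    rw [sub_eq_zero]
    have := hT i j
    rw [h1, h.t_eq hx] at this
    exact this
  · intro hT i j
    rw [h1, h.t_eq hx]
    exact hT _ _

lemma sCov_eq (i j k : Fin n) :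
    sCov a b i j k x = (h.point hx).s2 (stdVec i) (stdVec j) (stdVec k) :=
  (tri_single (fun i j k => sCov a b i j k x) i j k).symm

lemma rCov_eq (i j k : Fin n) :
    rCov a b i j k x = (h.point hx).r2 (stdVec i) (stdVec j) (stdVec k) :=
  (tri_single (fun i j k => rCov a b i j k x) i j k).symm

lemma sVecCov_eq (i k : Fin n) : sVecCov a b i k x = (h.point hx).s1 (stdVec i) (stdVec k) :=
  (bil_single _ i k).symm.trans (h.bil_sVecCov hx _ _)

lemma bR_eq (k i : Fin n) : bR a b k i x = (h.point hx).r2 (h.point hx).b (stdVec k) (stdVec i) := by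
  simp only [bR, h.rCov_eq hx]
  exact sum_mul_map_stdVec (((h.point hx).r2.flip (stdVec k)).flip (stdVec i)) (bv a b x)

lemma bbR_eq (i : Fin n) : bbR a b i x = (h.point hx).bbr (stdVec i) := by
  have h1 (p) : ∑ l, bUp a b p x * bUp a b l x * (rCov a b l p i x - rCov a b l i p x) =
      bUp a b p x * ((((h.point hx).r2 (h.point hx).b).flip (stdVec i)
        - (h.point hx).r2 (h.point hx).b (stdVec i)) (stdVec p)) := by
    have e := sum_mul_map_stdVec (((h.point hx).r2.flip (stdVec p)).flip (stdVec i)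
      - ((h.point hx).r2.flip (stdVec i)).flip (stdVec p)) (bv a b x)
    simp only [mul_assoc, ← Finset.mul_sum, h.rCov_eq hx]
    exact congrArg _ e
  simp only [bbR, h1]
  exact sum_mul_map_stdVec _ (bv a b x)

lemma SEquation_iff : SEquation a b x ↔ (h.point hx).SEq (cst a b x) := by
  have h1 (i j k) : sCovTerm a b i j k x =
      (h.point hx).sTerm (cst a b x) (stdVec i) (stdVec j) (stdVec k) := by
    rw [sCovTerm, h.tVec_eq hx, h.b_eq hx, h.b_eq hx, h.a_eq hx, h.r_eq hx, h.sVec_eq hx, h.q_eq hx,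
      h.sVecCov_eq hx]
    rfl
  constructor
  · intro hS i j k
    rw [← sub_eq_zero]
    set D := h.point hx with hD
    refine eq_zero_of_single
      (f := fun i => D.s2 i j k - (D.sTerm (cst a b x) i j k - D.sTerm (cst a b x) j i k))
      (by intros; simp only [PointData.sTerm, PointData.sig_add, PointData.s1_add_left, map_add,
            LinearMap.add_apply]; ring)
      (by intros; simp only [PointData.sTerm, PointData.sig_smul, PointData.s1_smul_left, map_smul,
            LinearMap.smul_apply, smul_eq_mul]; ring)
      (fun i => ?_) i
    refine eq_zero_of_single
      (f := fun j => D.s2 _ j k - (D.sTerm (cst a b x) _ j k - D.sTerm (cst a b x) j _ k))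
      (by intros; simp only [PointData.sTerm, PointData.sig_add, PointData.s1_add_left, map_add,
            LinearMap.add_apply]; ring)
      (by intros; simp only [PointData.sTerm, PointData.sig_smul, PointData.s1_smul_left, map_smul,
            LinearMap.smul_apply, smul_eq_mul]; ring)
      (fun j => ?_) j
    refine eq_zero_of_single
      (f := fun k => D.s2 _ _ k - (D.sTerm (cst a b x) _ _ k - D.sTerm (cst a b x) _ _ k))
      (by intros; simp only [PointData.sTerm, PointData.s1_add_right, map_add,
            LinearMap.add_apply]; ring)
      (by intros; simp only [PointData.sTerm, PointData.s1_smul_right, map_smul,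
            LinearMap.smul_apply, smul_eq_mul]; ring)
      (fun k => ?_) k
    rw [sub_eq_zero]
    have := hS i j k
    rw [h1, h1, h.sCov_eq hx] at this
    exact this
  · intro hS i j k
    rw [h1, h1, h.sCov_eq hx]
    exact hS _ _ _

lemma QEquation_of_QEq (hQ : (h.point hx).QEq) : QEquation a b x := by
  intro i k
  rw [h.q_eq hx, h.bbR_eq hx, h.bbR_eq hx, h.b_eq hx, h.b_eq hx, h.bR_eq hx, h.bR_eq hx,
    h.rSq_eq hx, h.sVecCov_eq hx]
  exact hQ _ _

lemma bTensor_eq (hn : 3 ≤ n) (lam : ℝ) (i k : Fin n) : bTensor a b lam i k x =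
    (h.point hx).BForm (lam + cst a b x) (stdVec i) (stdVec k) := by
  have hn' : ((n : ℝ) - 1) ≠ 0 := by
    have : (3 : ℝ) ≤ n := by exact_mod_cast hn
    linarith
  have h1 (i k) : bTensorTerm a b lam i k x =
      (h.point hx).BTerm (lam + cst a b x) (stdVec i) (stdVec k) := by
    rw [bTensorTerm, sigma, h.rSq_eq hx, h.bR_eq hx, h.sVecCov_eq hx, h.bbR_eq hx, h.b_eq hx,
      h.b_eq hx, PointData.BTerm, cst]
    field_simp
    ring
  rw [bTensor, h1, h1]
  rfl

lemma met_bTensorUp (hn : 3 ≤ n) (lam : ℝ) (κ v : Coord n) :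
    met a x κ (vec fun i => ∑ j, bTensorUp a b lam i j x * v j) =
      (h.point hx).B (lam + cst a b x) κ v := by
  have h1 : (vec fun i => ∑ j, bTensorUp a b lam i j x * v j) =
      vec fun i => ∑ l, (a x)⁻¹ i l * (h.point hx).B (lam + cst a b x) (stdVec l) v := by
    ext i
    simp only [vec_apply, bTensorUp, h.bTensor_eq hx hn, Finset.sum_mul]
    rw [Finset.sum_comm]
    refine Finset.sum_congr rfl fun l _ => ?_
    have := sum_map_stdVec_mul ((h.point hx).BForm (lam + cst a b x) (stdVec l)) v
    rw [PointData.BForm_apply] at this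
    rw [← this, Finset.mul_sum]
    exact Finset.sum_congr rfl fun j _ => by ring
  rw [h1, met, bil_inv (h.isUnit_det hx), lin_apply]
  have := sum_map_stdVec_mul (((h.point hx).BForm (lam + cst a b x)).flip v) κ
  exact this

/-- The formula involves α and s only through α², s² and s/α = β/α², so no square root survives. The
traces are rewritten through c, and λ becomes μ − c. -/
lemma flagFormula_eq (hn : 3 ≤ n) (lam : ℝ) {y : Coord n} (hX : (x, y) ∈ kDom b U) :
    flagFormula a b lam x y = (h.point hx).flag (cst a b x) (lam + cst a b x) y := by
  have hn' : ((n : ℝ) - 1) ≠ 0 := by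
    have : (3 : ℝ) ≤ n := by exact_mod_cast hn
    linarith
  have hA : alphaSq a x y = (h.point hx).g y y := (bil_apply _ y y).symm
  have hApos := h.g_self_pos hx hX
  have hb : ∑ i, b i x * y i = (h.point hx).g (h.point hx).b y := h.lin_b hx y
  have hs : ∑ i, sVec a b i x * y i = (h.point hx).sig y := h.lin_sVec_eq hx y
  have hr : r00 a b x y = (h.point hx).g ((h.point hx).R y) y := by
    rw [← h.bil_r_eq hx, bil_apply]; rfl
  have hq : ∑ i, ∑ j, q a b i j x * y i * y j =
      (h.point hx).g ((h.point hx).R y) ((h.point hx).S y) := by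
    have e1 (i) : ∑ j, q a b i j x * y i * y j =
        ((h.point hx).g.flip ((h.point hx).S y) ∘ₗ (h.point hx).R) (stdVec i) * y i := by
      have := sum_map_stdVec_mul ((h.point hx).g ((h.point hx).R (stdVec i)) ∘ₗ (h.point hx).S) y
      change _ = (h.point hx).g ((h.point hx).R (stdVec i)) ((h.point hx).S y) * y i
      change _ = (h.point hx).g ((h.point hx).R (stdVec i)) ((h.point hx).S y) at this
      rw [← this, Finset.sum_mul]
      refine Finset.sum_congr rfl fun j _ => ?_
      rw [h.q_eq hx, LinearMap.comp_apply]
      ring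
    simp only [e1]
    exact sum_map_stdVec_mul _ y
  have hr3 : ∑ i, ∑ j, ∑ k, rCov a b i j k x * y i * y j * y k = (h.point hx).r2 y y y :=
    (tri_apply _ y y y).symm
  have hbdr : ∑ l, bUp a b l x * ∑ i, ∑ j, (rCov a b l i j x - rCov a b i j l x) * y i * y j =
      (h.point hx).r2 (h.point hx).b y y - (h.point hx).r2 y y (h.point hx).b := by
    have e1 (l) : ∑ i, ∑ j, (rCov a b l i j x - rCov a b i j l x) * y i * y j =
        (((h.point hx).r2.flip y).flip y - (h.point hx).r2 y y) (stdVec l) := by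
      have e2 : bil (fun i j => rCov a b l i j x) = (h.point hx).r2 (stdVec l) :=
        bil_hom_ext fun i j => by rw [bil_single, h.rCov_eq hx]
      have e3 : bil (fun i j => rCov a b i j l x) y y = (h.point hx).r2 y y (stdVec l) := by
        change _ = tri (fun i j k => rCov a b i j k x) y y (stdVec l)
        rw [bil_apply, tri_apply]
        simp [stdVec]
      have e4 : ((((h.point hx).r2.flip y).flip y - (h.point hx).r2 y y) (stdVec l)) =
          (h.point hx).r2 (stdVec l) y y - (h.point hx).r2 y y (stdVec l) := rfl
      rw [e4, ← e2, ← e3, bil_apply, bil_apply]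
      simp only [sub_mul, Finset.sum_sub_distrib]
    simp only [e1]
    exact sum_mul_map_stdVec _ (bv a b x)
  have hsq : √((h.point hx).g y y) ^ 2 = (h.point hx).g y y := Real.sq_sqrt hApos.le
  have hsp : √((h.point hx).g y y) ≠ 0 := (Real.sqrt_pos.2 hApos).ne'
  simp only [flagFormula, hA, hb, hs, hr, hq, hr3, hbdr]
  have e1 : ((h.point hx).g (h.point hx).b y / √((h.point hx).g y y)) ^ 2 =
      (h.point hx).g (h.point hx).b y ^ 2 / (h.point hx).g y y := by rw [div_pow, hsq]
  have e2 : (h.point hx).g (h.point hx).b y / √((h.point hx).g y y) / √((h.point hx).g y y) =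
      (h.point hx).g (h.point hx).b y / (h.point hx).g y y := by rw [div_div, ← sq, hsq]
  rw [e1, e2, hsq, PointData.flag, ← h.sNormSq_eq hx, cst]
  have hA0 := hApos.ne'
  field_simp
  ring

end LocalData

end Translation


/-! ### The equivalence at a point of a coordinate domain. -/

section LocalTheorem

open Topology

variable {n : ℕ} {a : Coord n → Matrix (Fin n) (Fin n) ℝ} {b : Fin n → Coord n → ℝ}

lemma curvVec_add (G : Coord n × Coord n → Coord n) (X : Coord n × Coord n) (u v : Coord n) :
    curvVec G X (u + v) = curvVec G X u + curvVec G X v := by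
  have h1 : ((u + v, 0) : Coord n × Coord n) = (u, 0) + (v, 0) := by simp
  have h2 (u v : Coord n) : ((0, u + v) : Coord n × Coord n) = (0, u) + (0, v) := by simp
  simp only [curvVec, h1, h2, map_add, _root_.add_apply]
  module

lemma curvVec_smul (G : Coord n × Coord n → Coord n) (X : Coord n × Coord n) (t : ℝ)
    (v : Coord n) : curvVec G X (t • v) = t • curvVec G X v := by
  have h1 : ((t • v, 0) : Coord n × Coord n) = t • (v, 0) := by simp
  have h2 (v : Coord n) : ((0, t • v) : Coord n × Coord n) = t • (0, v) := by simp
  simp only [curvVec, h1, h2, map_smul, _root_.smul_apply]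
  module

/-- The curvature of a spray as a linear map. -/
def curvMap (G : Coord n × Coord n → Coord n) (X : Coord n × Coord n) : Coord n →ₗ[ℝ] Coord n :=
  ⟨⟨curvVec G X, curvVec_add G X⟩, curvVec_smul G X⟩

namespace PointData

variable {E : Type*} [AddCommGroup E] [Module ℝ E] (D : PointData E)

lemma B_add_right (μ : ℝ) (u v v' : E) : D.B μ u (v + v') = D.B μ u v + D.B μ u v' :=
  (D.BForm μ u).map_add v v'

lemma B_smul_right (μ t : ℝ) (u v : E) : D.B μ u (t • v) = t * D.B μ u v :=
  (D.BForm μ u).map_smul t v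

/-- A vector which is orthogonal to all the vectors orthogonal to `y` is a multiple of `y`. -/
lemma exists_eq_smul {y N : E} (hy : 0 < D.g y y) (h : ∀ κ, D.g κ y = 0 → D.g κ N = 0) :
    ∃ τ : ℝ, N = τ • y := by
  refine ⟨D.g N y / D.g y y, ?_⟩
  set κ := N - (D.g N y / D.g y y) • y with hκ
  have h1 : D.g κ y = 0 := by
    simp only [hκ, map_sub, map_smul, LinearMap.sub_apply, LinearMap.smul_apply, smul_eq_mul]
    field_simp
    ring
  have h2 : D.g κ κ = 0 := by
    conv_lhs => rw [hκ]
    rw [← hκ, LinearMap.map_sub₂, LinearMap.map_smul₂, D.g_symm N, h κ h1, D.g_symm y κ, h1]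
    simp
  by_contra hne
  exact (D.g_pos κ (sub_ne_zero.2 hne)).ne' h2

end PointData

namespace LocalData

variable {U : Set (Coord n)} (h : LocalData a b U) {x : Coord n} (hx : x ∈ U)

include h hx

lemma CurvatureEquation_iff (hn : 3 ≤ n) {F : Coord n → Coord n → ℝ}
    (hF : ∀ z ∈ U, ∀ y, F z y = √(met a z y y)) (lam : ℝ) :
    CurvatureEquation a b (fun i k y => riemann F i k x y) lam x ↔
      (h.point hx).CEq (cst a b x) (lam + cst a b x) := by
  have hn' : ((n : ℝ) - 1) ≠ 0 := by
    have : (3 : ℝ) ≤ n := by exact_mod_cast hn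
    linarith
  let Bup : Coord n → Coord n := fun v => vec fun i => ∑ j, bTensorUp a b lam i j x * v j
  -- The k-th column of the right-hand side as a vector. Comparing its entries is the same as
  -- comparing its contractions with all κ.
  let V : Coord n → Fin n → Coord n := fun y k =>
    (-cst a b x) • (met a x y y • stdVec k - met a x (stdVec k) y • y)
      - (h.point hx).B (lam + cst a b x) y y • stdVec k - met a x y y • Bup (stdVec k)
      + (h.point hx).B (lam + cst a b x) y (stdVec k) • y + met a x (stdVec k) y • Bup y
      + met a x (Rop a b x (stdVec k)) y • Rop a b x y
      - met a x (Rop a b x y) y • Rop a b x (stdVec k)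
  have hV (y k κ) : met a x κ (V y k) =
      (h.point hx).curvRHS (cst a b x) (lam + cst a b x) κ y (stdVec k) := by
    have e1 := h.met_bTensorUp hx hn lam κ
    simp only [V, map_add, map_sub, map_smul, smul_eq_mul, Bup, e1, PointData.curvRHS,
      ← h.Rop_symm hx κ]
    have hm : (h.point hx).g = met a x := rfl
    have hR : (h.point hx).R = Rop a b x := rfl
    simp only [hm, hR]
    ring
  have hA (y) : alphaSq a x y = met a x y y := (bil_apply _ y y).symm
  have hB0 (y) : ∑ j, ∑ l, bTensor a b lam j l x * y j * y l =
      (h.point hx).B (lam + cst a b x) y y := by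
    have e1 : bil (fun j l => bTensor a b lam j l x) = (h.point hx).BForm (lam + cst a b x) :=
      bil_hom_ext fun i j => by rw [bil_single, h.bTensor_eq hx hn]
    rw [← bil_apply, e1]
    rfl
  have hB1 (y k) : ∑ j, bTensor a b lam j k x * y j =
      (h.point hx).B (lam + cst a b x) y (stdVec k) := by
    simp only [h.bTensor_eq hx hn]
    exact sum_map_stdVec_mul (((h.point hx).BForm (lam + cst a b x)).flip (stdVec k)) y
  have hyl (y k) : yLow a k x y = met a x (stdVec k) y := by
    simp only [yLow, h.a_eq hx]
    exact sum_map_stdVec_mul (met a x (stdVec k)) y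
  have hr0 (y k) : ∑ j, r a b k j x * y j = met a x (Rop a b x (stdVec k)) y := by
    simp only [h.r_eq hx]
    exact sum_map_stdVec_mul (met a x (Rop a b x (stdVec k))) y
  have hr00 (y) : r00 a b x y = met a x (Rop a b x y) y := by
    have := h.bil_r_eq hx y y
    rw [bil_apply] at this
    exact this
  have hVi (y i k) : V y k i = (((n : ℝ) - 3) * sNormSq a b x - tTrace a b x) / ((n : ℝ) - 1)
          * (alphaSq a x y * (1 : Matrix (Fin n) (Fin n) ℝ) i k - y i * yLow a k x y)
        - (∑ j, ∑ l, bTensor a b lam j l x * y j * y l) * (1 : Matrix (Fin n) (Fin n) ℝ) i k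
        - bTensorUp a b lam i k x * alphaSq a x y
        + (∑ j, bTensor a b lam j k x * y j) * y i
        + (∑ j, bTensorUp a b lam i j x * y j) * yLow a k x y
        + (∑ j, rUp a b i j x * y j) * (∑ j, r a b k j x * y j)
        - r00 a b x y * rUp a b i k x := by
    have e1 : (1 : Matrix (Fin n) (Fin n) ℝ) i k = stdVec k i := by
      simp [stdVec, Matrix.one_apply]
    have e2 : bTensorUp a b lam i k x = Bup (stdVec k) i := by simp [Bup, stdVec]
    have e3 : ∑ j, rUp a b i j x * y j = Rop a b x y i := rfl
    have e4 : ∑ j, bTensorUp a b lam i j x * y j = Bup y i := rfl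
    have e5 : (((n : ℝ) - 3) * sNormSq a b x - tTrace a b x) / ((n : ℝ) - 1) = -cst a b x := by
      rw [cst]; ring
    rw [hA, hB0, hB1, hyl, hr0, hr00, e1, e2, e3, e4, e5, rUp_eq]
    simp only [V, PiLp.add_apply, PiLp.sub_apply, PiLp.smul_apply, smul_eq_mul]
    ring
  have hR (y i k) : riemann F i k x y = Rvec a x y (stdVec k) y i :=
    h.riemann_riemannian hx hF y i k
  constructor
  · intro hC v y w
    have h1 (k) : (h.point hx).R4 v y (stdVec k) y =
        (h.point hx).curvRHS (cst a b x) (lam + cst a b x) v y (stdVec k) := by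
      rw [← hV]
      have : V y k = Rvec a x y (stdVec k) y := by
        ext i
        rw [hVi, ← hR]
        exact (hC y i k).symm
      rw [this]
      rfl
    rw [← sub_eq_zero]
    refine eq_zero_of_single (f := fun w => (h.point hx).R4 v y w y -
      (h.point hx).curvRHS (cst a b x) (lam + cst a b x) v y w) ?_ ?_ (fun k => ?_) w
    · intros
      simp only [PointData.curvRHS, PointData.B_add_right, map_add, LinearMap.add_apply]
      ring
    · intros
      simp only [PointData.curvRHS, PointData.B_smul_right, map_smul, LinearMap.smul_apply,
        smul_eq_mul]
      ring
    · rw [h1, sub_self]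
  · intro hC y i k
    refine Eq.trans ?_ (hVi y i k)
    change riemann F i k x y = _
    rw [hR]
    refine congrArg (fun u : Coord n => u i) (h.met_ext hx fun κ => ?_)
    rw [hV, ← hC]
    rfl

variable {F : Coord n → Coord n → ℝ}
  (hF : ∀ z ∈ U, ∀ y, F z y = met a z y y / lin (fun i => b i z) y)

include hF

/-- Scalar flag curvature at a tangent vector in terms of the curvature map. -/
lemma scalar_iff {y : Coord n} (hX : (x, y) ∈ kDom b U) (K : ℝ) :
    (∀ i k, riemann F i k x y = K * (F x y ^ 2 * (1 : Matrix (Fin n) (Fin n) ℝ) i k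
        - y i * lowerDir F k x y)) ↔
      ∀ w, curvVec (kspray a b) (x, y) w = K • ((4 * (h.point hx).phi y ^ 2) • w
        - (4 * (h.point hx).phi y * (h.point hx).phiW y w) • y) := by
  have e0 (i k) : K * (F x y ^ 2 * (1 : Matrix (Fin n) (Fin n) ℝ) i k - y i * lowerDir F k x y) =
      (K • ((4 * (h.point hx).phi y ^ 2) • stdVec k
        - (4 * (h.point hx).phi y * (h.point hx).phiW y (stdVec k)) • y)) i := by
    have e1 : (1 : Matrix (Fin n) (Fin n) ℝ) i k = stdVec k i := by
      simp [stdVec, Matrix.one_apply]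
    rw [e1, sq_eq hF x y hX, h.kphi_eq hx, h.lowerDir_eq hx hX hF]
    simp only [PiLp.sub_apply, PiLp.smul_apply, smul_eq_mul]
    ring
  constructor
  · intro h1
    let R : Coord n →ₗ[ℝ] Coord n :=
      { toFun := fun w => K • ((4 * (h.point hx).phi y ^ 2) • w
          - (4 * (h.point hx).phi y * (h.point hx).phiW y w) • y)
        map_add' := fun u v => by rw [PointData.phiW_add]; module
        map_smul' := fun t v => by rw [PointData.phiW_smul, RingHom.id_apply]; module }
    have h2 : curvMap (kspray a b) (x, y) = R := by
      refine lin_hom_ext fun k => ?_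
      ext i
      have := h1 i k
      rw [e0, h.riemann_kropina hX hF] at this
      exact this
    intro w
    exact LinearMap.congr_fun h2 w
  · intro h1 i k
    rw [e0, h.riemann_kropina hX hF, h1]

/-- For κ orthogonal to y, pairing with K(F² w − (…) y) gives K F² g(κ, w). This is zero when w is
orthogonal to b and to v, whatever K is, and that is the vanishing required by the pointwise
theorem. -/
theorem equations_of_scalar (hn : 3 ≤ n) {Fa : Coord n → Coord n → ℝ}
    (hFa : ∀ z ∈ U, ∀ y, Fa z y = √(met a z y y))
    (hK : ∀ y, (x, y) ∈ kDom b U → ∃ K, ∀ i k, riemann F i k x y =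
      K * (F x y ^ 2 * (1 : Matrix (Fin n) (Fin n) ℝ) i k - y i * lowerDir F k x y)) :
    ∃ lam, TEquation a b x ∧ SEquation a b x ∧ QEquation a b x ∧
      CurvatureEquation a b (fun i k y => riemann Fa i k x y) lam x := by
  have hW : (h.point hx).WeylVanishes := by
    intro v w z hv hw hz hvw β hβ
    have hby : (h.point hx).g (h.point hx).b (β • (h.point hx).b + z) = β := by
      simp [(h.point hx).b_unit, hz]
    have hX : (x, β • (h.point hx).b + z) ∈ kDom b U := by
      refine ⟨hx, ?_⟩
      simp only [h.lin_b hx]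
      exact lt_of_lt_of_eq hβ hby.symm
    obtain ⟨K, h1⟩ := hK _ hX
    rw [h.scalar_iff hx hF hX] at h1
    have hκ : (h.point hx).g (v - ((h.point hx).g v z / β) • (h.point hx).b)
        (β • (h.point hx).b + z) = 0 := by
      rw [LinearMap.map_sub₂, LinearMap.map_smul₂, hby, map_add, map_smul, (h.point hx).g_symm v, hv]
      simp only [smul_eq_mul]
      field_simp
      ring
    rw [← h.curvVec_kspray hx hX _ _ hκ, h1]
    rw [map_smul, LinearMap.map_sub, map_smul, map_smul, hκ, LinearMap.map_sub₂, LinearMap.map_smul₂,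
      hw, hvw]
    simp
  obtain ⟨c, hT⟩ := hW.exists_TEq
  have hc := h.cst_eq_of_TEq hx hn hT
  subst hc
  obtain ⟨hS, hQ, μ, hC⟩ := hW.equations hT
  -- The scalar function is recovered from μ = λ + c.
  refine ⟨μ - cst a b x, (h.TEquation_iff hx hn).2 hT, (h.SEquation_iff hx).2 hS,
    h.QEquation_of_QEq hx hQ, ?_⟩
  rw [h.CurvatureEquation_iff hx hn hFa, sub_add_cancel]
  exact hC

/-- The pointwise formula fixes R w, for w orthogonal to b, up to a multiple of y. That multiple is
zero because dφ annihilates R w while dφ(y) = φ > 0. The remaining direction is w = y, where both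
sides vanish. -/
theorem scalar_of_equations (hn : 3 ≤ n) {Fa : Coord n → Coord n → ℝ}
    (hFa : ∀ z ∈ U, ∀ y, Fa z y = √(met a z y y)) {lam : ℝ} (hT : TEquation a b x)
    (hS : SEquation a b x) (hC : CurvatureEquation a b (fun i k y => riemann Fa i k x y) lam x)
    {y : Coord n} (hX : (x, y) ∈ kDom b U) (i k : Fin n) :
    riemann F i k x y = flagFormula a b lam x y *
      (F x y ^ 2 * (1 : Matrix (Fin n) (Fin n) ℝ) i k - y i * lowerDir F k x y) := by
  revert i k
  rw [h.scalar_iff hx hF hX, h.flagFormula_eq hx hn lam hX]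
  rw [h.TEquation_iff hx hn] at hT
  rw [h.SEquation_iff hx] at hS
  rw [h.CurvatureEquation_iff hx hn hFa] at hC
  have hb := h.g_b_pos hx hX
  have hφ := h.phi_pos hx hX
  have key := fun v w hv hw => (h.point hx).curv_of_equations hT hS hC (v := v) (w := w) hv hw hb
  have hself : curvVec (kspray a b) (x, y) y = 0 :=
    curvVec_self h.isOpen_kDom h.sm_kspray h.homog_kspray hX
  have hphi (w) : (h.point hx).phiW y (curvVec (kspray a b) (x, y) w) = 0 := by
    have := h.horConst_kphi.fderiv_curvVec h.isOpen_kDom h.sm_kspray h.sm_kphi h.homog_kspray hX w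
    rw [h.fderiv_kphi hx hX] at this
    simpa [PointData.d] using this
  have hAφ : (h.point hx).g y y / (h.point hx).g (h.point hx).b y = 2 * (h.point hx).phi y := by
    rw [(h.point hx).phi_mul y hb.ne']
    field_simp
  have hperp (w) (hw : (h.point hx).g (h.point hx).b w = 0) :
      curvVec (kspray a b) (x, y) w = (h.point hx).flag (cst a b x) (lam + cst a b x) y •
        ((4 * (h.point hx).phi y ^ 2) • w
          - (4 * (h.point hx).phi y * (h.point hx).phiW y w) • y) := by
    rw [← sub_eq_zero]
    set K := (h.point hx).flag (cst a b x) (lam + cst a b x) y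
    set N := curvVec (kspray a b) (x, y) w - K • ((4 * (h.point hx).phi y ^ 2) • w
          - (4 * (h.point hx).phi y * (h.point hx).phiW y w) • y) with hN
    obtain ⟨τ, hτ⟩ := (h.point hx).exists_eq_smul (y := y) (N := N) (h.g_self_pos hx hX)
      (fun κ hκ => by
        -- Every κ orthogonal to y has the form covered by the pointwise formula, with v its part
        -- orthogonal to b.
        have e1 : κ = (h.point hx).perp κ
            - ((h.point hx).g ((h.point hx).perp κ) y / (h.point hx).g (h.point hx).b y)
              • (h.point hx).b := by
          have e2 : (h.point hx).g ((h.point hx).perp κ) y / (h.point hx).g (h.point hx).b y =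
              -(h.point hx).g (h.point hx).b κ := by
            rw [PointData.perp, LinearMap.map_sub₂, LinearMap.map_smul₂, hκ]
            simp only [smul_eq_mul]
            field_simp
            ring
          rw [e2, PointData.perp]
          module
        have e3 := key _ _ ((h.point hx).b_perp κ) hw
        rw [← e1, ← h.curvVec_kspray hx hX _ _ hκ, hAφ] at e3
        have e4 : (h.point hx).g ((h.point hx).perp κ) w = (h.point hx).g κ w := by
          rw [PointData.perp, LinearMap.map_sub₂, LinearMap.map_smul₂, hw]
          simp
        rw [hN]
        simp only [map_sub, map_smul, smul_eq_mul, hκ, e3, e4]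
        ring)
    have e5 : (h.point hx).phiW y N = 0 := by
      have e6 : N = curvVec (kspray a b) (x, y) w + (-(K * (4 * (h.point hx).phi y ^ 2))) • w
          + (K * (4 * (h.point hx).phi y * (h.point hx).phiW y w)) • y := by
        rw [hN]; module
      rw [e6, PointData.phiW_add, PointData.phiW_add, PointData.phiW_smul, PointData.phiW_smul,
        hphi, (h.point hx).phiW_self y hb.ne']
      ring
    rw [hτ, PointData.phiW_smul, (h.point hx).phiW_self y hb.ne'] at e5
    have e7 : τ = 0 := (mul_eq_zero.1 e5).resolve_right hφ.ne'
    rw [hτ, e7, zero_smul]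
  intro w
  set t := (h.point hx).g (h.point hx).b w / (h.point hx).g (h.point hx).b y with ht
  have hw : w = (w - t • y) + t • y := by module
  have hw0 : (h.point hx).g (h.point hx).b (w - t • y) = 0 := by
    rw [map_sub, map_smul, ht, smul_eq_mul, div_mul_cancel₀ _ hb.ne', sub_self]
  have e8 : (h.point hx).phiW y (w - t • y) = (h.point hx).phiW y w - t * (h.point hx).phi y := by
    have : (h.point hx).phiW y w = (h.point hx).phiW y (w - t • y)
        + t * (h.point hx).phi y := by
      conv_lhs => rw [hw]
      rw [PointData.phiW_add, PointData.phiW_smul, (h.point hx).phiW_self y hb.ne']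
    linarith
  conv_lhs => rw [hw]
  rw [curvVec_add, curvVec_smul, hself, hperp _ hw0, e8]
  module

/-- The trace of F² δ − y ⊗ (y_k) is (n − 1)F², since y^k y_k = F² by homogeneity, and this is
positive. -/
theorem flag_unique (hn : 3 ≤ n) {y : Coord n} (hX : (x, y) ∈ kDom b U) {K K' : ℝ}
    (hK : ∀ i k, K * (F x y ^ 2 * (1 : Matrix (Fin n) (Fin n) ℝ) i k - y i * lowerDir F k x y) =
      K' * (F x y ^ 2 * (1 : Matrix (Fin n) (Fin n) ℝ) i k - y i * lowerDir F k x y)) :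
    K = K' := by
  have hφ := h.phi_pos hx hX
  have hl : ∑ i, y i * lowerDir F i x y = 4 * (h.point hx).phi y ^ 2 := by
    let f : Coord n →ₗ[ℝ] ℝ := ⟨⟨(h.point hx).phiW y, (h.point hx).phiW_add y⟩,
      fun t v => (h.point hx).phiW_smul y v t⟩
    have e := sum_mul_map_stdVec f y
    simp only [h.lowerDir_eq hx hX hF]
    have e2 : f y = (h.point hx).phi y := (h.point hx).phiW_self y (h.g_b_pos hx hX).ne'
    have e3 : ∀ i, y i * (4 * (h.point hx).phi y * (h.point hx).phiW y (EuclideanSpace.single i 1))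
        = 4 * (h.point hx).phi y * (y i * f (stdVec i)) := fun i => by
      change _ = 4 * (h.point hx).phi y * (y i * (h.point hx).phiW y (stdVec i))
      ring
    simp only [e3, ← Finset.mul_sum, e, e2]
    ring
  have hsum : ∑ i, (F x y ^ 2 * (1 : Matrix (Fin n) (Fin n) ℝ) i i - y i * lowerDir F i x y) =
      ((n : ℝ) - 1) * (4 * (h.point hx).phi y ^ 2) := by
    rw [Finset.sum_sub_distrib, hl, sq_eq hF x y hX, h.kphi_eq hx]
    simp
    ring
  have h1 : K * (((n : ℝ) - 1) * (4 * (h.point hx).phi y ^ 2)) =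
      K' * (((n : ℝ) - 1) * (4 * (h.point hx).phi y ^ 2)) := by
    rw [← hsum, Finset.mul_sum, Finset.mul_sum]
    exact Finset.sum_congr rfl fun i _ => hK i i
  have hn' : 0 < ((n : ℝ) - 1) := by
    have : (3 : ℝ) ≤ n := by exact_mod_cast hn
    linarith
  exact mul_right_cancel₀ (by positivity) h1

end LocalData

end LocalTheorem


/-! ### From the manifold to the chart at a point. -/

section Manifold

variable {n : ℕ} {M : Type*} [TopologicalSpace M] [ChartedSpace (Coord n) M]

/-- `coordVec` as a linear map of the components. -/
def coordVecL (p : M) (u : Coord n) :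
    Coord n →L[ℝ] TangentSpace (𝓡 n) ((extChartAt (𝓡 n) p).symm u) :=
  mfderiv 𝓘(ℝ, Coord n) (𝓡 n) (extChartAt (𝓡 n) p).symm u

lemma coordVecL_apply (p : M) (u y : Coord n) : coordVecL p u y = coordVec p u y := rfl

lemma coordVec_eq_sum (p : M) (u v : Coord n) :
    coordVec p u v = ∑ i, v i • coordVec p u (EuclideanSpace.single i 1) := by
  simp only [← coordVecL_apply]
  conv_lhs => rw [← sum_smul_single v]
  simp only [map_sum, map_smul]

lemma chartPt_mem_target (p : M) : chartPt p ∈ (extChartAt (𝓡 n) p).target := mem_extChartAt_target p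

variable [IsManifold (𝓡 n) ∞ M]

lemma coordVec_bijective {p : M} {u : Coord n} (hu : u ∈ (extChartAt (𝓡 n) p).target) :
    Function.Bijective (coordVec p u) := by
  have : IsManifold (𝓡 n) 1 M := IsManifold.of_le (n := ∞) (by simp)
  have h := isInvertible_mfderivWithin_extChartAt_symm (I := 𝓡 n) hu
  rw [ModelWithCorners.range_eq_univ, mfderivWithin_univ] at h
  exact h.bijective

/-- The tangent space at p is the model space read in the preferred chart at p, so the derivative of
that chart at p is the identity. -/
lemma components_eq_self (p : M) (y : TangentSpace (𝓡 n) p) : components p y = y := by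
  have : IsManifold (𝓡 n) 1 M := IsManifold.of_le (n := ∞) (by simp)
  exact DFunLike.congr_fun (mfderiv_extChartAt_self (I := 𝓡 n) (x := p)) y

lemma coordVec_chartPt (p : M) (y : Coord n) : coordVec p (chartPt p) y = y := by
  have : IsManifold (𝓡 n) 1 M := IsManifold.of_le (n := ∞) (by simp)
  have h := mfderivWithin_range_extChartAt_symm (I := 𝓡 n) (x := p)
  rw [ModelWithCorners.range_eq_univ, mfderivWithin_univ] at h
  exact DFunLike.congr_fun h y

lemma localExpr_chartPt (F : ∀ p : M, TangentSpace (𝓡 n) p → ℝ) (p : M)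
    (y : TangentSpace (𝓡 n) p) : localExpr F p (chartPt p) (components p y) = F p y := by
  -- The inverse chart returns p only up to a propositional equality. All tangent spaces are
  -- definitionally the model space, so a vector can be moved along that equality.
  have h : ∀ q : M, q = p → ∀ v : Coord n,
      F q (v : TangentSpace (𝓡 n) q) = F p (v : TangentSpace (𝓡 n) p) := by
    rintro q rfl v
    rfl
  rw [localExpr, coordVec_chartPt, components_eq_self]
  exact h _ (extChartAt_to_inv p) y

/-- The coordinate field is the tangent map of the smooth inverse chart applied to a constant field.
-/
lemma contMDiffAt_coordVec (p : M) (y : Coord n) {u : Coord n}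
    (hu : u ∈ (extChartAt (𝓡 n) p).target) :
    ContMDiffAt 𝓘(ℝ, Coord n) ((𝓡 n).prod 𝓘(ℝ, Coord n)) ∞
      (fun u => Bundle.TotalSpace.mk' (Coord n) (E := fun q : M => TangentSpace (𝓡 n) q)
        ((extChartAt (𝓡 n) p).symm u) (coordVec p u y)) u := by
  have ho : IsOpen (extChartAt (𝓡 n) p).target := isOpen_extChartAt_target p
  have h1 := (contMDiffOn_extChartAt_symm (I := 𝓡 n) (n := ∞) p).contMDiffOn_tangentMapWithin
    (m := ∞) (by simp) ho.uniqueMDiffOn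
  have h2 : ContMDiff 𝓘(ℝ, Coord n) (𝓘(ℝ, Coord n).prod 𝓘(ℝ, Coord n)) ∞
      (fun u : Coord n => (⟨u, y⟩ : TangentBundle 𝓘(ℝ, Coord n) (Coord n))) :=
    contMDiff_vectorSpace_iff_contDiff.2 contDiff_const
  have h3 := (h1.comp h2.contMDiffOn (s := (extChartAt (𝓡 n) p).target) fun u hu => hu).contMDiffAt
    (ho.mem_nhds hu)
  refine h3.congr_of_eventuallyEq ?_
  filter_upwards [ho.mem_nhds hu] with v hv
  simp only [Function.comp, tangentMapWithin]
  rw [mfderivWithin_of_isOpen ho hv]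
  rfl

variable (g : RiemMetric n M) (β : OneForm n M) (p : M)

lemma contDiffAt_metricCoord {u : Coord n} (hu : u ∈ (extChartAt (𝓡 n) p).target) (i j : Fin n) :
    ContDiffAt ℝ ∞ (fun z => metricCoord g p z i j) u := by
  have hb : ContMDiffAt 𝓘(ℝ, Coord n) (𝓡 n) ∞ (extChartAt (𝓡 n) p).symm u :=
    (contMDiffOn_extChartAt_symm p).contMDiffAt ((isOpen_extChartAt_target p).mem_nhds hu)
  have h : ContMDiffAt 𝓘(ℝ, Coord n) ((𝓡 n).prod 𝓘(ℝ)) ∞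
      (fun z => Bundle.TotalSpace.mk' ℝ (E := Bundle.Trivial M ℝ) ((extChartAt (𝓡 n) p).symm z)
        (g.inner ((extChartAt (𝓡 n) p).symm z) (coordVec p z (EuclideanSpace.single i 1))
          (coordVec p z (EuclideanSpace.single j 1)))) u := by
    apply ContMDiffAt.clm_bundle_apply₂ (F₁ := Coord n) (F₂ := Coord n)
      (E₁ := fun q : M => TangentSpace (𝓡 n) q) (E₂ := fun q : M => TangentSpace (𝓡 n) q)
    · exact ContMDiffAt.comp u g.contMDiff.contMDiffAt hb
    · exact contMDiffAt_coordVec p _ hu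
    · exact contMDiffAt_coordVec p _ hu
  rw [Bundle.contMDiffAt_totalSpace] at h
  exact h.2.contDiffAt

lemma contDiffAt_formCoord {u : Coord n} (hu : u ∈ (extChartAt (𝓡 n) p).target) (i : Fin n) :
    ContDiffAt ℝ ∞ (formCoord β p i) u := by
  have hb : ContMDiffAt 𝓘(ℝ, Coord n) (𝓡 n) ∞ (extChartAt (𝓡 n) p).symm u :=
    (contMDiffOn_extChartAt_symm p).contMDiffAt ((isOpen_extChartAt_target p).mem_nhds hu)
  have h : ContMDiffAt 𝓘(ℝ, Coord n) ((𝓡 n).prod 𝓘(ℝ)) ∞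
      (fun z => Bundle.TotalSpace.mk' ℝ (E := Bundle.Trivial M ℝ) ((extChartAt (𝓡 n) p).symm z)
        (β ((extChartAt (𝓡 n) p).symm z) (coordVec p z (EuclideanSpace.single i 1)))) u := by
    apply ContMDiffAt.clm_bundle_apply (F₁ := Coord n) (E₁ := fun q : M => TangentSpace (𝓡 n) q)
    · exact ContMDiffAt.comp u β.contMDiff.contMDiffAt hb
    · exact contMDiffAt_coordVec p _ hu
  rw [Bundle.contMDiffAt_totalSpace] at h
  exact h.2.contDiffAt

lemma met_metricCoord (u v w : Coord n) :
    met (metricCoord g p) u v w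
      = g.inner ((extChartAt (𝓡 n) p).symm u) (coordVec p u v) (coordVec p u w) := by
  rw [coordVec_eq_sum p u v, coordVec_eq_sum p u w, met, bil_apply, Finset.sum_comm]
  simp only [map_sum, map_smul, sum_apply, smul_apply,
    smul_eq_mul, Finset.mul_sum]
  refine Finset.sum_congr rfl fun i _ => Finset.sum_congr rfl fun j _ => ?_
  simp only [metricCoord, Matrix.of_apply]
  ring

lemma lin_formCoord (u v : Coord n) :
    lin (fun i => formCoord β p i u) v = β ((extChartAt (𝓡 n) p).symm u) (coordVec p u v) := by
  rw [coordVec_eq_sum, lin_apply]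
  simp only [map_sum, map_smul, smul_eq_mul]
  exact Finset.sum_congr rfl fun i _ => mul_comm _ _

lemma inner_self_nonneg (q : M) (v : TangentSpace (𝓡 n) q) : 0 ≤ g.inner q v v := by
  by_cases hv : v = 0
  · simp [hv]
  · exact (g.pos q v hv).le

lemma localExpr_alpha (u y : Coord n) :
    localExpr (alpha g) p u y = √(met (metricCoord g p) u y y) := by
  rw [met_metricCoord]
  rfl

lemma localExpr_kropinaMetric (u y : Coord n) :
    localExpr (kropinaMetric g β) p u y
      = met (metricCoord g p) u y y / lin (fun i => formCoord β p i u) y := by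
  rw [met_metricCoord, lin_formCoord, localExpr, kropinaMetric, alpha,
    Real.sq_sqrt (inner_self_nonneg g _ _)]

lemma posDef_metricCoord {u : Coord n} (hu : u ∈ (extChartAt (𝓡 n) p).target) :
    (metricCoord g p u).PosDef := by
  refine Matrix.PosDef.of_dotProduct_mulVec_pos ?_ fun {v} hv => ?_
  · ext i j
    simp only [Matrix.conjTranspose_apply, metricCoord, Matrix.of_apply, star_trivial]
    exact g.symm _ _ _
  · have h : star v ⬝ᵥ (metricCoord g p u).mulVec v
        = met (metricCoord g p) u (WithLp.toLp 2 v) (WithLp.toLp 2 v) := by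
      rw [met, bil_apply]
      simp only [dotProduct, Matrix.mulVec, Pi.star_apply, star_trivial, Finset.mul_sum]
      exact Finset.sum_congr rfl fun i _ => Finset.sum_congr rfl fun j _ => by ring
    rw [h, met_metricCoord]
    refine g.pos _ _ fun h0 => hv ?_
    have h1 : coordVec p u (WithLp.toLp 2 v) = coordVec p u 0 := by
      rw [h0, ← coordVecL_apply, map_zero]
    have h2 := (coordVec_bijective hu).1 h1
    simpa using congrArg (WithLp.ofLp) h2

variable {g β}

lemma localData (hβ : HasUnitLength g β) :
    LocalData (metricCoord g p) (formCoord β p) (extChartAt (𝓡 n) p).target where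
  isOpen := isOpen_extChartAt_target p
  a_smooth _ hz i j := contDiffAt_metricCoord g p hz i j
  b_smooth _ hz i := contDiffAt_formCoord β p hz i
  posDef _ hz := posDef_metricCoord g p hz
  unit z hz := by
    obtain ⟨v, hv, hv1⟩ := hβ ((extChartAt (𝓡 n) p).symm z)
    obtain ⟨V, rfl⟩ := (coordVec_bijective hz).2 v
    -- V denotes the components of the vector dual to β. Inverting the metric matrix identifies them
    -- with bⁱ, so b^i b_i is the squared length of that vector.
    have hb : (fun j => formCoord β p j z) = (metricCoord g p z).mulVec V := by
      funext j
      rw [formCoord, ← hv, g.symm, ← met_metricCoord, met, bil_apply]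
      simp [Matrix.mulVec, dotProduct]
    have hU : ∀ i, bUp (metricCoord g p) (formCoord β p) i z = V i := by
      intro i
      have h1 : bUp (metricCoord g p) (formCoord β p) i z
          = ((metricCoord g p z)⁻¹.mulVec fun j => formCoord β p j z) i := rfl
      rw [h1, hb, Matrix.mulVec_mulVec, Matrix.nonsing_inv_mul _
        ((Matrix.isUnit_iff_isUnit_det _).1 (posDef_metricCoord g p hz).isUnit), Matrix.one_mulVec]
    have h2 := lin_formCoord β p z V
    rw [← hv, hv1, lin_apply] at h2
    rw [← h2]
    exact Finset.sum_congr rfl fun i _ => by rw [hU, mul_comm]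

lemma mem_kDom_iff (y : TangentSpace (𝓡 n) p) :
    (chartPt p, components p y) ∈ kDom (formCoord β p) (extChartAt (𝓡 n) p).target
      ↔ y ∈ kropinaCone β p := by
  have h := localExpr_chartPt (fun q v => β q v) p y
  rw [localExpr, ← lin_formCoord] at h
  simp only [kDom, Set.mem_ofPred_eq, h, kropinaCone, chartPt_mem_target, true_and]

end Manifold

end Kropina

end

theorem theorem4p1 {n : ℕ} (hn : 3 ≤ n) {M : Type*} [TopologicalSpace M]
    [ChartedSpace (Kropina.Coord n) M] [IsManifold (𝓡 n) ∞ M]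
    (g : Kropina.RiemMetric n M) (β : Kropina.OneForm n M) (hβ : Kropina.HasUnitLength g β) :
    ((∃ K : ∀ p : M, TangentSpace (𝓡 n) p → ℝ,
        Kropina.HasScalarFlagCurvature (Kropina.kropinaMetric g β) (Kropina.kropinaCone β) K) ↔
      ∃ lam : M → ℝ, ∀ p : M, Kropina.KropinaEquations g β p (lam p)) ∧
    ∀ (K : ∀ p : M, TangentSpace (𝓡 n) p → ℝ) (lam : M → ℝ),
      Kropina.HasScalarFlagCurvature (Kropina.kropinaMetric g β) (Kropina.kropinaCone β) K →
      (∀ p : M, Kropina.KropinaEquations g β p (lam p)) →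
      ∀ p : M, ∀ y ∈ Kropina.kropinaCone β p,
        K p y = Kropina.flagFormula (Kropina.metricCoord g p) (Kropina.formCoord β p) (lam p)
          (Kropina.chartPt p) (Kropina.components p y) := by
  have hL := fun p => Kropina.localData p hβ
  have hx := fun p : M => Kropina.chartPt_mem_target (n := n) p
  have hF := fun p z (_ : z ∈ (extChartAt (𝓡 n) p).target) y =>
    Kropina.localExpr_kropinaMetric g β p z y
  have hFa := fun p z (_ : z ∈ (extChartAt (𝓡 n) p).target) y => Kropina.localExpr_alpha g p z y
  have hflag : ∀ (lam : M → ℝ), (∀ p, Kropina.KropinaEquations g β p (lam p)) →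
      ∀ (p : M), ∀ y ∈ Kropina.kropinaCone β p, ∀ i k : Fin n,
        Kropina.riemann (Kropina.localExpr (Kropina.kropinaMetric g β) p) i k (Kropina.chartPt p)
            (Kropina.components p y)
          = Kropina.flagFormula (Kropina.metricCoord g p) (Kropina.formCoord β p) (lam p)
              (Kropina.chartPt p) (Kropina.components p y)
            * (Kropina.kropinaMetric g β p y ^ 2 * (1 : Matrix (Fin n) (Fin n) ℝ) i k
              - Kropina.components p y i
                * Kropina.lowerDir (Kropina.localExpr (Kropina.kropinaMetric g β) p) k
                  (Kropina.chartPt p) (Kropina.components p y)) := by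
    intro lam h p y hy i k
    obtain ⟨hT, hS, -, hC⟩ := h p
    rw [← Kropina.localExpr_chartPt (Kropina.kropinaMetric g β) p y]
    exact (hL p).scalar_of_equations (hx p) (hF p) hn (hFa p) hT hS hC
      ((Kropina.mem_kDom_iff p y).2 hy) i k
  refine ⟨⟨fun ⟨K, hK⟩ => ?_, fun ⟨lam, h⟩ => ⟨_, hflag lam h⟩⟩, fun K lam hK h p y hy => ?_⟩
  -- The equations are pointwise, so λ is chosen independently at each point, in the chart at that
  -- point.
  · choose lam hlam using fun p => (hL p).equations_of_scalar (hx p) (hF p) hn (hFa p)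
      fun y hy => by
        obtain ⟨v, rfl⟩ : ∃ v : TangentSpace (𝓡 n) p, Kropina.components p v = y :=
          ⟨y, Kropina.components_eq_self p y⟩
        refine ⟨K p v, ?_⟩
        rw [Kropina.localExpr_chartPt]
        exact hK p v ((Kropina.mem_kDom_iff p v).1 hy)
    exact ⟨lam, hlam⟩
  · refine (hL p).flag_unique (hx p) (hF p) hn ((Kropina.mem_kDom_iff p y).2 hy) fun i k => ?_
    rw [Kropina.localExpr_chartPt, ← hK p y hy i k]
    exact hflag lam h p y hy i k
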